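/- Let $p$ be a prime, $q$ a power of $p$, and let $R$ be the ring of integers of the unramified extension of $\mathbb{Q}_p$ with residue field $\mathbb{F}_q$, with maximal ideal $\mathfrak{m}$ (equivalently, $R$ is a complete discrete valuation ring with uniformizer $p$ and residue field $\mathbb{F}_q$). For a partition $\lambda=(\lambda_1\ge\lambda_2\ge\cdots)$ let $\lambda'$ be its conjugate, $|\lambda|=\sum_j\lambda_j$ and $N_\lambda=\bigoplus_j R/\mathfrak{m}^{\lambda_j}$. For an $R$-module $P$ write $P^{\le k}=P/\mathfrak{m}^kP$. Let $\eta(k)=\prod_{i=1}^k(1-q^{-i})$ and $$\mathrm{Pf}_q(t,m)=\sum_{e=0}^m\frac{(-1)^e q^{-(t+1)e}\,\eta(m)}{\eta(e)\,\eta(m-e)}.$$ Let $\mathcal{P}$ be the set of isomorphism classes of finitely generated $R$-modules, with the topology generated by the sets $\{P \mid P^{\le k}\cong N\}$ ($k\in\mathbb{N}$, $N$ a finite $R/\mathfrak{m}^k$-module) and its Borel $\sigma$-algebra. The $N$-moment of a measure $\nu$ on $\mathcal{P}$ is $\int_{\mathcal{P}}|\mathrm{Sur}_R(X,N)|\,d\nu(X)$.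 For a surjection $g$ of finite $R$-modules let $\mu(g)=(-1)^eq^{\binom e2}$ if $\ker g\cong(R/\mathfrak{m})^e$ and $\mu(g)=0$ if $\ker g$ is not semisimple, and let $\hat\mu(N,P)=\sum_{g\in\mathrm{Sur}(P,N)/\mathrm{Aut}(N)}\mu(g)$. Values $M_N\in\mathbb{R}$ (for finite $R$-modules $N$, depending only on the isomorphism class) are called well-behaved if for every $k\in\mathbb{N}$ and every finite $R/\mathfrak{m}^k$-module $N$ the sum $\sum_P\frac{\hat\mu(N,P)}{|\mathrm{Aut}(P)|}M_P$ over isomorphism classes of finite $R/\mathfrak{m}^k$-modules $P$ converges absolutely. Let $s,\epsilon$ be real numbers with $s\ge0$ and $s-\epsilon\ge0$, and let $r$ be a positive integer or $r=\infty$ (where $N[p^\infty]$ is the submodule of elements killed by a power of $p$). For a finite $R$-module $N$ put $$M_N=|(\wedge^2_RN)[p^r]|\cdot|N[p^r]|^{\epsilon}\cdot|N|^{-s}.$$ Then: 1. $\mathrm{Pf}_q(t,m)>0$ for all real $t\ge0$ and all $m\in\mathbb{N}$. 2. For every partition $\rho$, $M_{N_{\rho'}}=q^{\sum_{j=1}^r\left(\binom{\rho_j}{2}+\epsilon\rho_j\right)-s|\rho|}$.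 3. The values $M_N$ are well-behaved. 4. There is a unique measure $\nu$ on $\mathcal{P}$ such that for all $k\ge1$ and all partitions $\lambda$ with $\lambda_{k+1}=0$ $$\nu(\{P\mid P^{\le k}\cong N_{\lambda'}\})=\frac{q^{\sum_j\left(-\binom{\lambda_j}{2}-(s-\epsilon+1)\lambda_j\right)+\sum_{j\ge r+1}\left(-\binom{\lambda_j}{2}-\epsilon\lambda_j\right)}}{\prod_{j\ge2}\eta(\lambda_{j-1}-\lambda_j)}\;F_k(\lambda),$$ $$F_k(\lambda)=\prod_{i\ge0}(1+q^{-s+\epsilon-1-i})^{-1}\prod_{j=2}^{\min(k,r)}\mathrm{Pf}_q(s-\epsilon,\lambda_{j-1}-\lambda_j)\prod_{i=\lambda_k+1}^{\lambda_{\min(k,r)}}(1-q^{-s-i}),$$ where the infinite product converges and the last product is $1$ if $\lambda_k=\lambda_{\min(k,r)}$. The right-hand side is also equal to $\frac{M_{N_{\lambda'}}}{|\mathrm{Aut}(N_{\lambda'})|}F_k(\lambda)$. 5. For every finite $R$-module $N$ the $N$-moment of this $\nu$ is $M_N$, and $\nu$ is supported on finite $R$-modules, i.e. the set of classes of infinite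 modules has $\nu$-measure $0$. 6. For every partition $\lambda$ and every $k>\lambda'_1$, $\nu(\{N_{\lambda'}\})$ is equal to the expression in 4 for that $k$ and $\lambda$. -/

import Mathlib

open scoped ENNReal
open IsLocalRing

universe u

noncomputable section

namespace ModuleMoments

/-! ### Isomorphism classes of finitely generated modules -/

/-- Two finitely generated `R`-modules are identified when they are `R`-linearly isomorphic. -/
def isoSetoid (R : Type u) [CommRing R] : Setoid (FGModuleCat.{u} R) where
  r M N := Nonempty (M ≃ₗ[R] N)
  iseqv :=
    { refl := fun M => ⟨LinearEquiv.refl R M⟩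
      symm := fun ⟨f⟩ => ⟨f.symm⟩
      trans := fun ⟨f⟩ ⟨g⟩ => ⟨f.trans g⟩ }

/-- The set of isomorphism classes of finitely generated `R`-modules. -/
def FGIsoClass (R : Type u) [CommRing R] : Type (u + 1) :=
  Quotient (isoSetoid R)

/-- The isomorphism class of a finitely generated `R`-module. -/
def FGIsoClass.mk (R : Type u) [CommRing R] (N : Type u) [AddCommGroup N] [Module R N]
    [Module.Finite R N] : FGIsoClass R :=
  Quotient.mk (isoSetoid R) (FGModuleCat.of R N)

/-- A module in the isomorphism class `X`.  It is used only in expressions that do not change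
when the module is replaced by an isomorphic one. -/
abbrev FGIsoClass.rep {R : Type u} [CommRing R] (X : FGIsoClass R) : Type u :=
  (Quotient.out X : FGModuleCat.{u} R)

theorem FGIsoClass.nonempty_rep_mk_equiv (R : Type u) [CommRing R] (N : Type u)
    [AddCommGroup N] [Module R N] [Module.Finite R N] :
    Nonempty ((FGIsoClass.mk R N).rep ≃ₗ[R] N) :=
  Quotient.exact (s := isoSetoid R) (Quotient.out_eq (FGIsoClass.mk R N))

/-! ### Truncations, topology and Borel structure -/

section Local

variable (R : Type u) [CommRing R] [IsLocalRing R]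

/-- The truncation `X / 𝔪 ^ k X`. -/
abbrev Trunc (k : ℕ) (X : Type u) [AddCommGroup X] [Module R X] : Type u :=
  X ⧸ ((maximalIdeal R) ^ k • (⊤ : Submodule R X))

/-- `N` is a finite `R / 𝔪 ^ k`-module, that is, a finite `R`-module killed by `𝔪 ^ k`. -/
def IsFiniteOfLevel (k : ℕ) (N : Type u) [AddCommGroup N] [Module R N] : Prop :=
  Finite N ∧ (maximalIdeal R) ^ k • (⊤ : Submodule R N) = ⊥

/-- The set of (classes of) modules `X` with `X / 𝔪 ^ k X ≅ N`. -/
def levelSet (k : ℕ) (N : Type u) [AddCommGroup N] [Module R N] : Set (FGIsoClass R) :=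
  {X | Nonempty (Trunc R k X.rep ≃ₗ[R] N)}

instance : TopologicalSpace (FGIsoClass R) :=
  TopologicalSpace.generateFrom
    {S | ∃ (k : ℕ) (N : FGIsoClass R), IsFiniteOfLevel R k N.rep ∧ S = levelSet R k N.rep}

instance : MeasurableSpace (FGIsoClass R) := borel (FGIsoClass R)

instance : BorelSpace (FGIsoClass R) := ⟨rfl⟩

/-! ### Surjections, the Möbius function, moments, well-behavedness -/

/-- The set of surjective `R`-linear maps `P → N`. -/
abbrev Sur (P N : Type u) [AddCommGroup P] [Module R P] [AddCommGroup N] [Module R N] : Type u :=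
  {g : P →ₗ[R] N // Function.Surjective g}

/-- Surjections `P → N` up to automorphisms of `N`. -/
def surSetoid (P N : Type u) [AddCommGroup P] [Module R P] [AddCommGroup N] [Module R N] :
    Setoid (Sur R P N) where
  r g g' := ∃ φ : N ≃ₗ[R] N, g'.1 = φ.toLinearMap ∘ₗ g.1
  iseqv :=
    { refl := fun g => ⟨LinearEquiv.refl R N, by ext; simp⟩
      symm := fun {g g'} ⟨φ, h⟩ => ⟨φ.symm, by rw [h]; ext; simp⟩
      trans := fun {g g' g''} ⟨φ, h⟩ ⟨ψ, h'⟩ => ⟨φ.trans ψ, by rw [h', h]; ext; simp⟩ }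

open Classical in
/-- `(-1) ^ e * q ^ (e choose 2)` with `q = |R / 𝔪|` if `K ≅ (R / 𝔪) ^ e` for some `e ≥ 0`,
and `0` if `K` is not semi-simple. -/
def kerMoebius {P : Type u} [AddCommGroup P] [Module R P] (K : Submodule R P) : ℝ :=
  if h : ∃ e : ℕ, Nonempty (K ≃ₗ[R] (Fin e → ResidueField R)) then
    (-1) ^ h.choose * (Nat.card (ResidueField R) : ℝ) ^ (h.choose.choose 2)
  else 0

/-- `μ(g)` for the class of a surjection `g`. -/
def moebius (P N : Type u) [AddCommGroup P] [Module R P] [AddCommGroup N] [Module R N] :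
    Quotient (surSetoid R P N) → ℝ :=
  Quotient.lift (fun g : Sur R P N => kerMoebius R (LinearMap.ker g.1)) (by
    rintro g g' ⟨φ, h⟩
    have hk : LinearMap.ker g'.1 = LinearMap.ker g.1 := by
      rw [h]; ext x; simp
    simp only [hk])

/-- `μ̂(N, P)`, the sum of `μ(g)` over the classes `g` in `Sur(P, N) / Aut(N)`
(a finite set if `P` and `N` are finite). -/
def moebiusHat (N P : Type u) [AddCommGroup P] [Module R P] [AddCommGroup N] [Module R N] : ℝ :=
  ∑ᶠ g : Quotient (surSetoid R P N), moebius R P N g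

/-- The values `M` are well-behaved: for every `k` and every finite `R / 𝔪 ^ k`-module `N` the sum
`∑_P μ̂(N, P) / |Aut P| * M P` over the isomorphism classes of finite `R / 𝔪 ^ k`-modules `P`
converges absolutely. -/
def WellBehaved (M : FGIsoClass R → ℝ) : Prop :=
  ∀ (k : ℕ) (N : FGIsoClass R), IsFiniteOfLevel R k N.rep →
    Summable fun P : {P : FGIsoClass R // IsFiniteOfLevel R k P.rep} =>
      |moebiusHat R N.rep P.1.rep / (Nat.card (P.1.rep ≃ₗ[R] P.1.rep) : ℝ) * M P.1|

/-- The `N`-moment `∫ |Sur(X, N)| dν(X)` of a measure `ν` on isomorphism classes. -/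
def moment (ν : MeasureTheory.Measure (FGIsoClass R)) (N : Type u) [AddCommGroup N]
    [Module R N] : ℝ≥0∞ :=
  ∫⁻ X, (Nat.card (Sur R X.rep N) : ℝ≥0∞) ∂ν

/-! ### Partitions and the associated modules -/

/-- The module `N_lam = ⨁_j R / 𝔪 ^ (lam_j)` of a partition `lam`, given as a Young diagram with
row lengths `lam_1 ≥ lam_2 ≥ …`. -/
abbrev partModule (lam : YoungDiagram) : Type u :=
  (i : Fin (lam.colLen 0)) → R ⧸ (maximalIdeal R) ^ (lam.rowLen i)

end Local

/-- The part `lam_j` of a partition, for `j ≥ 1`. -/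
def part (lam : YoungDiagram) (j : ℕ) : ℕ := lam.rowLen (j - 1)

/-! ### The prescribed moments -/

/-- `N[p ^ r]`, the elements killed by `p ^ r`; for `r = ∞`, those killed by a power of `p`. -/
def torsionPow (R : Type u) [CommRing R] (p : ℕ) (r : ℕ∞) (N : Type u) [AddCommGroup N]
    [Module R N] : Submodule R N :=
  ⨆ (n : ℕ) (_ : (n : ℕ∞) ≤ r), Submodule.torsionBy R N ((p : R) ^ n)

theorem torsionPow_coe (R : Type u) [CommRing R] (p r : ℕ) (N : Type u) [AddCommGroup N]
    [Module R N] : torsionPow R p (r : ℕ∞) N = Submodule.torsionBy R N ((p : R) ^ r) := by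
  apply le_antisymm
  · refine iSup₂_le fun n hn => ?_
    exact Submodule.torsionBy_le_torsionBy_of_dvd _ _ (pow_dvd_pow _ (by exact_mod_cast hn))
  · exact le_iSup₂_of_le r le_rfl le_rfl

/-- `M_N = |(∧²_R N)[p ^ r]| * |N[p ^ r]| ^ ε * |N| ^ (-s)`. -/
def momentValue (R : Type u) [CommRing R] (p : ℕ) (r : ℕ∞) (s ε : ℝ) (N : Type u)
    [AddCommGroup N] [Module R N] : ℝ :=
  (Nat.card (torsionPow R p r (⋀[R]^2 N)) : ℝ) *
    (Nat.card (torsionPow R p r N) : ℝ) ^ ε * (Nat.card N : ℝ) ^ (-s)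

/-! ### The explicit formula -/

/-- `η_q(k) = ∏_{i=1}^k (1 - q ^ (-i))`. -/
def eta (q k : ℕ) : ℝ := ∏ i ∈ Finset.Icc 1 k, (1 - (q : ℝ) ^ (-(i : ℝ)))

/-- `Pf_q(t, m) = ∑_{e=0}^m (-1) ^ e q ^ (-(t+1)e) η(m) / (η(e) η(m-e))`. -/
def Pf (q : ℕ) (t : ℝ) (m : ℕ) : ℝ :=
  ∑ e ∈ Finset.range (m + 1),
    (-1) ^ e * (q : ℝ) ^ (-(t + 1) * (e : ℝ)) * eta q m / (eta q e * eta q (m - e))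

/-- `min(k, r)` as a natural number. -/
def minLevel (k : ℕ) (r : ℕ∞) : ℕ := (min (k : ℕ∞) r).toNat

open Classical in
/-- The exponent `∑_{j=1}^r (C(rho_j, 2) + ε rho_j) - s |rho|`; the summands with `rho_j = 0`,
that is `j > rho'_1`, vanish. -/
def momentExponent (r : ℕ∞) (s ε : ℝ) (rho : YoungDiagram) : ℝ :=
  (∑ j ∈ (Finset.Icc 1 (rho.colLen 0)).filter (fun j : ℕ => (j : ℕ∞) ≤ r),
      (((part rho j).choose 2 : ℝ) + ε * (part rho j : ℝ))) - s * (rho.card : ℝ)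

/-- The factor `∏_{i ≥ 0} (1 + q ^ (-s+ε-1-i))⁻¹ * ∏_{j=2}^{min(k,r)} Pf_q(s-ε, lam_{j-1} - lam_j)
* ∏_{i = lam_k + 1}^{lam_{min(k,r)}} (1 - q ^ (-s-i))`. -/
def levelFactor (q : ℕ) (r : ℕ∞) (s ε : ℝ) (k : ℕ) (lam : YoungDiagram) : ℝ :=
  (∏' i : ℕ, (1 + (q : ℝ) ^ (-s + ε - 1 - (i : ℝ)))⁻¹) *
    (∏ j ∈ Finset.Icc 2 (minLevel k r), Pf q (s - ε) (part lam (j - 1) - part lam j)) *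
    ∏ i ∈ Finset.Icc (part lam k + 1) (part lam (minLevel k r)),
      (1 - (q : ℝ) ^ (-s - (i : ℝ)))

open Classical in
/-- The explicit formula for the measure of `{P | P / 𝔪 ^ k P ≅ N_{lam'}}`, for a partition `lam`
with `lam_{k+1} = 0` (so that all sums and products over `j` stop at `k` or `k + 1`). -/
def levelFormula (q : ℕ) (r : ℕ∞) (s ε : ℝ) (k : ℕ) (lam : YoungDiagram) : ℝ :=
  (q : ℝ) ^ ((∑ j ∈ Finset.Icc 1 k,
        (-((part lam j).choose 2 : ℝ) - (s - ε + 1) * (part lam j : ℝ))) +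
      ∑ j ∈ (Finset.Icc 1 k).filter (fun j : ℕ => r + 1 ≤ (j : ℕ∞)),
        (-((part lam j).choose 2 : ℝ) - ε * (part lam j : ℝ))) /
    (∏ j ∈ Finset.Icc 2 (k + 1), eta q (part lam (j - 1) - part lam j)) *
    levelFactor q r s ε k lam

/-- `ν` takes the prescribed values on all sets `{P | P / 𝔪 ^ k P ≅ N_{lam'}}` with `k ≥ 1` and
`lam_{k+1} = 0`. -/
def HasLevelFormula (R : Type u) [CommRing R] [IsLocalRing R]
    (ν : MeasureTheory.Measure (FGIsoClass R)) (q : ℕ) (r : ℕ∞) (s ε : ℝ) : Prop :=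
  ∀ (k : ℕ) (lam : YoungDiagram), 1 ≤ k → part lam (k + 1) = 0 →
    ν (levelSet R k (partModule R lam.transpose)) = ENNReal.ofReal (levelFormula q r s ε k lam)

end ModuleMoments

end

noncomputable section

namespace ModuleMoments

/-! ### Identities between `q`-series -/

section QSeries

open Finset PowerSeries

variable {q : ℕ}

/-! A finite module is encoded by a diagram `κ` whose rows are the exponents of its cyclic summands.
The columns of `κ` are then the parts λ_1 ≥ λ_2 ≥ … of the theorem, counted from zero in `colLen`.

The prescribed value of a level set is a product over consecutive parts. It is the law of the first
steps of a Markov chain λ_1 → λ_2 → …, with initial law `firstWeight` and kernel `torsionStep` up to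
row r and `freeStep` beyond it. Everything about the measure rests on one property of this kernel.
Let Sur(n, μ) be the number of surjections 𝔽_q^n → 𝔽_q^μ (`surCount`) and w_j(μ) the factor that row
j of length μ contributes to M_N (`rowMoment`). Then ∑_m step_j(n, m) Sur(m, μ) = w_j(μ) q^(-nμ)
Sur(n, μ), and the initial law satisfies ∑_m first(m) Sur(m, μ) = w_0(μ). These are
`sum_torsionStep`, `sum_freeStep` and `hasSum_firstWeight`; they come from Euler's expansions of
q-products and from a finite Cauchy identity.

For μ = 0 the kernel identity says that the steps have total weight one, so the level weights are
consistent. For μ = 1 it says that q^(λ_j) - 1 shrinks on average by a factor q at least, so the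
chain dies out and no mass escapes to infinite modules (`fiberSum_pointWeight`). The measure is
therefore a sum of point masses at finite modules. For general μ it gives the moments: |Sur(P, N)|
is a product over rows (`card_sur_partModule`), and summing over the deepest row first collapses the
whole sum to ∏ w_j(τ_j) (`fiberSum_moment`). This product is M_N, because the exterior square of a
sum of cyclic modules is again an explicit sum of cyclic modules (`momentValue_partModule`).

For uniqueness, Nakayama's lemma shows that the class of a finite module is itself a level set
(`levelSet_eq_singleton`). Hence the formula fixes all atoms at finite modules and the total mass.
The atoms already add up to one, so infinite modules are null (`HasLevelFormula.eq_law`).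

For well-behavedness with N fixed, only surjections P → N with kernel in the socle of P count. This
bounds every part of P except the first. Comparing the number of such kernels with M_P / |Aut P|
leaves geometric decay in the rank of P (`abs_moebiusHat_le`, `exponent_bound`). -/

theorem eta_eq_prod_range (q k : ℕ) :
    eta q k = ∏ i ∈ range k, (1 - ((q : ℝ)⁻¹) ^ (i + 1)) := by
  unfold eta
  rw [← Finset.Ico_succ_right_eq_Icc, Finset.prod_Ico_eq_prod_range]
  refine Finset.prod_congr (by simp) fun i _ => ?_
  rw [Real.rpow_neg (by positivity), Real.rpow_natCast, inv_pow, add_comm 1 i]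

@[simp] theorem eta_zero (q : ℕ) : eta q 0 = 1 := by simp [eta]

theorem eta_succ (q k : ℕ) : eta q (k + 1) = eta q k * (1 - ((q : ℝ)⁻¹) ^ (k + 1)) := by
  rw [eta_eq_prod_range, eta_eq_prod_range, prod_range_succ]

theorem inv_natCast_pos (hq : 2 ≤ q) : 0 < (q : ℝ)⁻¹ := by positivity

theorem inv_natCast_le_half (hq : 2 ≤ q) : (q : ℝ)⁻¹ ≤ 1 / 2 := by
  rw [one_div]; exact inv_anti₀ (by norm_num) (by exact_mod_cast hq)

theorem inv_natCast_lt_one (hq : 2 ≤ q) : (q : ℝ)⁻¹ < 1 :=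
  (inv_natCast_le_half hq).trans_lt (by norm_num)

theorem inv_natCast_pow_lt_one (hq : 2 ≤ q) (n : ℕ) : ((q : ℝ)⁻¹) ^ (n + 1) < 1 :=
  pow_lt_one₀ (inv_natCast_pos hq).le (inv_natCast_lt_one hq) (by simp)

theorem eta_pos (hq : 2 ≤ q) (k : ℕ) : 0 < eta q k := by
  rw [eta_eq_prod_range]
  exact prod_pos fun i _ => sub_pos.2 (inv_natCast_pow_lt_one hq i)

theorem eta_ne_zero (hq : 2 ≤ q) (k : ℕ) : eta q k ≠ 0 := (eta_pos hq k).ne'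

theorem quarter_le_eta (hq : 2 ≤ q) (k : ℕ) : 1 / 4 ≤ eta q k := by
  -- The bare bound 1/4 does not survive the induction. With x = 2^(-(k+2)) ≤ 1/4 one has (1/4 +
  -- x)(1 - x) ≥ 1/4 + x/2, so the extra term does.
  suffices h : ∀ k, 1 / 4 + (1 / 2 : ℝ) ^ (k + 2) ≤ eta q (k + 1) by
    rcases k with _ | k
    · norm_num
    · exact le_trans (by have : (0 : ℝ) < (1 / 2) ^ (k + 2) := by positivity
                         linarith) (h k)
  intro k
  induction k with
  | zero => rw [eta_succ]; norm_num; linarith [inv_natCast_le_half hq]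
  | succ k ih =>
    rw [eta_succ]
    have h1 : ((q : ℝ)⁻¹) ^ (k + 1 + 1) ≤ (1 / 2) ^ (k + 2) :=
      pow_le_pow_left₀ (inv_natCast_pos hq).le (inv_natCast_le_half hq) _
    have h2 : (1 / 2 : ℝ) ^ (k + 2) ≤ 1 / 4 := by
      rw [pow_add]
      have : (1 / 2 : ℝ) ^ k ≤ 1 := pow_le_one₀ (by norm_num) (by norm_num)
      linarith
    have h3 : (1 / 2 : ℝ) ^ (k + 1 + 2) = (1 / 2) ^ (k + 2) / 2 := by ring
    have h4 : (0 : ℝ) < (1 / 2) ^ (k + 2) := by positivity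
    rw [h3]
    calc _ ≤ (1 / 4 + (1 / 2 : ℝ) ^ (k + 2)) * (1 - (1 / 2) ^ (k + 2)) := by nlinarith
      _ ≤ _ := by
        apply mul_le_mul ih (by linarith) (by linarith) (eta_pos hq _).le

/-- The generating series `∑ X ^ n / η(n)`. -/
def expSeries (q : ℕ) : PowerSeries ℝ := PowerSeries.mk fun n => (eta q n)⁻¹

/-- The generating series `∑ q ^ (-(n choose 2)) u ^ n X ^ n / η(n)`. -/
def chooseSeries (q : ℕ) (u : ℝ) : PowerSeries ℝ :=
  PowerSeries.mk fun n => ((q : ℝ)⁻¹) ^ (n.choose 2) * u ^ n / eta q n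

theorem one_sub_pow_mul_inv_eta (hq : 2 ≤ q) (n : ℕ) :
    (1 - ((q : ℝ)⁻¹) ^ (n + 1)) * (eta q (n + 1))⁻¹ = (eta q n)⁻¹ := by
  have := (sub_pos.2 (inv_natCast_pow_lt_one hq n)).ne'
  have := eta_ne_zero hq n
  rw [eta_succ, mul_inv, mul_left_comm, mul_inv_cancel₀ ‹_›, mul_one]

/-- This q-difference equation is the formal shadow of the product ∏ (1 - q^(-i) X)⁻¹. Products of
series are compared through such equations, without infinite products of power series. -/
theorem rescale_expSeries (hq : 2 ≤ q) :
    rescale ((q : ℝ)⁻¹) (expSeries q) = (1 - X) * expSeries q := by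
  ext n
  rw [sub_mul, one_mul, map_sub, coeff_rescale]
  rcases n with _ | n
  · simp [expSeries]
  · rw [coeff_succ_X_mul]
    simp only [expSeries, coeff_mk]
    linarith [one_sub_pow_mul_inv_eta hq n]

theorem chooseSeries_eq (hq : 2 ≤ q) (u : ℝ) :
    chooseSeries q u =
      (1 + C u * X) * rescale ((q : ℝ)⁻¹) (chooseSeries q u) := by
  ext n
  rw [add_mul, one_mul, map_add, mul_assoc, coeff_C_mul]
  rcases n with _ | n
  · simp [chooseSeries]
  · rw [coeff_succ_X_mul]
    simp only [chooseSeries, coeff_mk, coeff_rescale]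
    have h := one_sub_pow_mul_inv_eta hq n
    have e : (n + 1).choose 2 = n + n.choose 2 := by
      rw [Nat.choose_succ_succ' n 1, Nat.choose_one_right]
    rw [e, pow_add, div_eq_mul_inv, div_eq_mul_inv, ← h]
    ring

theorem rescale_rescale_comm (a b : ℝ) (f : PowerSeries ℝ) :
    rescale a (rescale b f) = rescale b (rescale a f) := by
  ext n; simp only [coeff_rescale]; ring

theorem rescale_neg_expSeries (hq : 2 ≤ q) (u : ℝ) :
    rescale ((q : ℝ)⁻¹) (rescale (-u) (expSeries q)) =
      (1 + C u * X) * rescale (-u) (expSeries q) := by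
  rw [rescale_rescale_comm, rescale_expSeries hq, map_mul]
  congr 1
  simp [map_sub, rescale_X]

theorem eq_C_of_rescale_eq (hq : 2 ≤ q) {f : PowerSeries ℝ}
    (h : rescale ((q : ℝ)⁻¹) f = f) : f = C (constantCoeff f) := by
  ext n
  rcases n with _ | n
  · simp
  · have := congrArg (coeff (n + 1)) h
    rw [coeff_rescale] at this
    rw [coeff_C, if_neg (by simp)]
    have h2 := inv_natCast_pow_lt_one hq n
    have : (1 - ((q : ℝ)⁻¹) ^ (n + 1)) * coeff (n + 1) f = 0 := by linarith
    exact (mul_eq_zero.1 this).resolve_left (by linarith)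

theorem constantCoeff_rescale_expSeries (q : ℕ) (b : ℝ) :
    constantCoeff (rescale b (expSeries q)) = 1 := by
  rw [← coeff_zero_eq_constantCoeff_apply, coeff_rescale]
  simp [expSeries]

/-- Under X ↦ X/q the two factors change by 1 + uX in opposite directions, so their product is
invariant and must be constant. -/
theorem chooseSeries_mul_rescale (hq : 2 ≤ q) (u : ℝ) :
    chooseSeries q u * rescale (-u) (expSeries q) = 1 := by
  have h := eq_C_of_rescale_eq (f := chooseSeries q u * rescale (-u) (expSeries q)) hq (by
    conv_rhs => rw [chooseSeries_eq hq u]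
    rw [map_mul, rescale_neg_expSeries hq]; ring)
  rw [h, map_mul, constantCoeff_rescale_expSeries]
  simp [chooseSeries]

/-- The generating series of `Pf_q(t, n) / η(n)` is `expSeries X * expSeries (-u X)`. -/
theorem coeff_expSeries_mul (hq : 2 ≤ q) (t : ℝ) (n : ℕ) :
    coeff n (rescale (-((q : ℝ) ^ (-(t + 1)))) (expSeries q) * expSeries q) =
      Pf q t n / eta q n := by
  rw [coeff_mul, Finset.Nat.sum_antidiagonal_eq_sum_range_succ_mk, Pf, Finset.sum_div]
  refine Finset.sum_congr rfl fun e _ => ?_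
  simp only [coeff_rescale, expSeries, coeff_mk]
  rw [Real.rpow_mul (by positivity), Real.rpow_natCast, neg_pow]
  have := eta_ne_zero hq n
  have := eta_ne_zero hq e
  have := eta_ne_zero hq (n - e)
  field_simp

/-- The generating series of Pf/η is E(-uX) E(X) with E = `expSeries q` and u = q^(-(t+1)).
Multiplying by `chooseSeries q u` cancels the first factor, and coefficients of E remain. -/
theorem sum_choose_mul_Pf (hq : 2 ≤ q) (t : ℝ) (n : ℕ) :
    ∑ l ∈ range (n + 1), ((q : ℝ)⁻¹) ^ (l.choose 2) * ((q : ℝ) ^ (-(t + 1))) ^ l / eta q l *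
      (Pf q t (n - l) / eta q (n - l)) = (eta q n)⁻¹ := by
  have h : chooseSeries q ((q : ℝ) ^ (-(t + 1))) *
      (rescale (-((q : ℝ) ^ (-(t + 1)))) (expSeries q) * expSeries q) = expSeries q := by
    rw [← mul_assoc, chooseSeries_mul_rescale hq, one_mul]
  have h2 := congrArg (coeff n) h
  rw [coeff_mul, Finset.Nat.sum_antidiagonal_eq_sum_range_succ_mk] at h2
  simp only [coeff_expSeries_mul hq] at h2
  simpa [chooseSeries, expSeries] using h2

/-- The defining sum alternates, so positivity is read off from the q-difference equation f(X/q) =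
(1 + uX)(1 - X) f(X) of the generating series. It amounts to a three-term recursion with
coefficients 1 - u and u, both positive because 0 < u < 1. -/
theorem Pf_pos (hq : 2 ≤ q) {t : ℝ} (ht : 0 ≤ t) (m : ℕ) : 0 < Pf q t m := by
  set u : ℝ := (q : ℝ) ^ (-(t + 1)) with hu
  have hq1 : (1 : ℝ) < q := by exact_mod_cast hq
  have hu0 : 0 < u := by positivity
  have hu1 : u < 1 := Real.rpow_lt_one_of_one_lt_of_neg hq1 (by linarith)
  set f := rescale (-u) (expSeries q) * expSeries q with hf
  have hfe : rescale ((q : ℝ)⁻¹) f = (1 + C u * X) * ((1 - X) * f) := by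
    rw [hf, map_mul, rescale_neg_expSeries hq, rescale_expSeries hq]; ring
  have hfe' : rescale ((q : ℝ)⁻¹) f =
      f - X * (C (1 - u) * f) - X * (X * (C u * f)) := by
    rw [hfe, map_sub, map_one]; ring
  have rec0 : (1 - (q : ℝ)⁻¹) * coeff 1 f = (1 - u) * coeff 0 f := by
    have := congrArg (coeff 1) hfe'
    simp only [map_sub (coeff 1), coeff_rescale] at this
    rw [coeff_succ_X_mul, coeff_C_mul, show (1 : ℕ) = 0 + 1 from rfl, coeff_succ_X_mul,
      coeff_zero_X_mul] at this
    simp only [zero_add, pow_one] at this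
    linarith
  have rec1 (n : ℕ) : (1 - (q : ℝ)⁻¹ ^ (n + 2)) * coeff (n + 2) f =
      (1 - u) * coeff (n + 1) f + u * coeff n f := by
    have := congrArg (coeff (n + 2)) hfe'
    simp only [map_sub (coeff (n + 2)), coeff_rescale] at this
    rw [coeff_succ_X_mul, coeff_C_mul, coeff_succ_X_mul, coeff_succ_X_mul, coeff_C_mul] at this
    linarith
  have key : ∀ n, 0 < coeff n f ∧ 0 < coeff (n + 1) f := by
    intro n
    induction n with
    | zero =>
      have h0 : coeff 0 f = 1 := by
        rw [coeff_zero_eq_constantCoeff_apply, hf, map_mul, constantCoeff_rescale_expSeries]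
        simp [expSeries]
      refine ⟨by rw [h0]; norm_num, ?_⟩
      rw [h0] at rec0
      have := inv_natCast_lt_one hq
      exact pos_of_mul_pos_right (a := 1 - (q : ℝ)⁻¹) (by rw [rec0]; linarith) (by linarith)
    | succ n ih =>
      refine ⟨ih.2, ?_⟩
      have h1 := inv_natCast_pow_lt_one hq (n + 1)
      refine pos_of_mul_pos_right (a := 1 - (q : ℝ)⁻¹ ^ (n + 2)) ?_ (sub_pos.2 h1).le
      rw [rec1]
      have := mul_pos (sub_pos.2 hu1) ih.2
      have := mul_pos hu0 ih.1
      linarith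
  have h := (key m).1
  rw [hf, coeff_expSeries_mul hq] at h
  exact (div_pos_iff_of_pos_right (eta_pos hq m)).1 h

/-- A finite form of the Cauchy identity. -/
theorem sum_sq_mul_prod (hq : 2 ≤ q) (n : ℕ) (x : ℝ) :
    ∑ l ∈ range (n + 1), ((q : ℝ)⁻¹) ^ (l ^ 2) * x ^ l / (eta q (n - l) * eta q l) *
      ∏ i ∈ Ico l n, (1 - x * ((q : ℝ)⁻¹) ^ (i + 1)) = (eta q n)⁻¹ := by
  set a : ℝ := (q : ℝ)⁻¹ with ha
  induction n generalizing x with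
  | zero => simp
  | succ n ih =>
    -- Split 1 - a^(n+1) as (1 - a^(n+1-l)) + a^(n+1-l) (1 - a^l). The first part of the sum is the
    -- case n at x, the second, after l ↦ l + 1, the case n at x a. Their factors 1 - x a^(n+1) and
    -- x a^(n+1) add up to one.
    have hE (l : ℕ) (hl : l ∈ range (n + 2)) :
        (1 - a ^ (n + 1)) * (a ^ (l ^ 2) * x ^ l / (eta q (n + 1 - l) * eta q l) *
          ∏ i ∈ Ico l (n + 1), (1 - x * a ^ (i + 1))) =
        (1 - a ^ (n + 1 - l)) * (a ^ (l ^ 2) * x ^ l / (eta q (n + 1 - l) * eta q l) *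
          ∏ i ∈ Ico l (n + 1), (1 - x * a ^ (i + 1))) +
        a ^ (n + 1 - l) * (1 - a ^ l) * (a ^ (l ^ 2) * x ^ l / (eta q (n + 1 - l) * eta q l) *
          ∏ i ∈ Ico l (n + 1), (1 - x * a ^ (i + 1))) := by
      have : a ^ (n + 1) = a ^ (n + 1 - l) * a ^ l := by
        rw [← pow_add]; congr 1; have := mem_range.1 hl; omega
      rw [this]; ring
    have hne : (1 - a ^ (n + 1)) ≠ 0 := (sub_pos.2 (inv_natCast_pow_lt_one hq n)).ne'
    apply mul_left_cancel₀ hne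
    rw [one_sub_pow_mul_inv_eta hq, mul_sum, sum_congr rfl hE, sum_add_distrib,
      sum_range_succ, sum_range_succ' (fun l => a ^ (n + 1 - l) * (1 - a ^ l) * _)]
    have h1 : ∑ l ∈ range (n + 1), (1 - a ^ (n + 1 - l)) *
        (a ^ (l ^ 2) * x ^ l / (eta q (n + 1 - l) * eta q l) *
          ∏ i ∈ Ico l (n + 1), (1 - x * a ^ (i + 1))) =
        (1 - x * a ^ (n + 1)) * (eta q n)⁻¹ := by
      rw [← ih x, mul_sum]
      refine sum_congr rfl fun l hl => ?_
      have hl' := mem_range.1 hl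
      rw [prod_Ico_succ_top (by omega), show n + 1 - l = (n - l) + 1 by omega, eta_succ]
      have e1 := (sub_pos.2 (inv_natCast_pow_lt_one hq (n - l))).ne'
      rw [← ha] at e1 ⊢
      have := eta_ne_zero hq (n - l)
      have := eta_ne_zero hq l
      field_simp
    have h2 : ∑ l ∈ range (n + 1), a ^ (n + 1 - (l + 1)) * (1 - a ^ (l + 1)) *
        (a ^ ((l + 1) ^ 2) * x ^ (l + 1) / (eta q (n + 1 - (l + 1)) * eta q (l + 1)) *
          ∏ i ∈ Ico (l + 1) (n + 1), (1 - x * a ^ (i + 1))) =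
        x * a ^ (n + 1) * (eta q n)⁻¹ := by
      rw [← ih (x * a), mul_sum]
      refine sum_congr rfl fun l hl => ?_
      have hl' := mem_range.1 hl
      rw [← prod_Ico_add' (fun i => (1 - x * a ^ (i + 1))) l n 1,
        show n + 1 - (l + 1) = n - l by omega, eta_succ]
      have e1 := (sub_pos.2 (inv_natCast_pow_lt_one hq l)).ne'
      rw [← ha] at e1 ⊢
      have := eta_ne_zero hq (n - l)
      have := eta_ne_zero hq l
      have e2 : ∏ i ∈ Ico l n, (1 - x * a ^ (i + 1 + 1)) =
          ∏ i ∈ Ico l n, (1 - x * a * a ^ (i + 1)) :=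
        prod_congr rfl fun i _ => by ring
      have e3 : a ^ (n + 1) = a ^ (n - l) * a ^ (l + 1) := by
        rw [← pow_add]; congr 1; omega
      rw [e2, e3, show (l + 1) ^ 2 = l ^ 2 + l + (l + 1) by ring, pow_add a (l ^ 2 + l) (l + 1),
        pow_add a (l ^ 2)]
      field_simp
      rw [mul_pow]
      ring
    rw [h1, h2]
    simp
    ring



/-! ### Convergent q-series and Euler's product. -/

theorem summable_chooseSeries (hq : 2 ≤ q) {u : ℝ} (hu0 : 0 ≤ u) (hu1 : u < 1) :
    Summable fun n : ℕ => ((q : ℝ)⁻¹) ^ (n.choose 2) * u ^ n / eta q n := by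
  refine Summable.of_nonneg_of_le (fun n => ?_) (fun n => ?_)
    ((summable_geometric_of_lt_one hu0 hu1).mul_left 4)
  · have := (eta_pos hq n).le
    positivity
  · rw [div_le_iff₀ (eta_pos hq n)]
    have h1 := quarter_le_eta hq n
    have h2 : ((q : ℝ)⁻¹) ^ (n.choose 2) ≤ 1 :=
      pow_le_one₀ (inv_natCast_pos hq).le (inv_natCast_lt_one hq).le
    have h3 : 0 ≤ u ^ n := by positivity
    nlinarith

theorem tsum_chooseSeries_eq (hq : 2 ≤ q) {u : ℝ} (hu0 : 0 ≤ u) (hu1 : u < 1) :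
    ∑' n : ℕ, ((q : ℝ)⁻¹) ^ (n.choose 2) * u ^ n / eta q n =
      (1 + u) * ∑' n : ℕ, ((q : ℝ)⁻¹) ^ (n.choose 2) * (u * (q : ℝ)⁻¹) ^ n / eta q n := by
  have ha := inv_natCast_lt_one hq
  have ha0 := inv_natCast_pos hq
  have hs := summable_chooseSeries hq hu0 hu1
  have hs' := summable_chooseSeries hq (u := u * (q : ℝ)⁻¹) (by positivity) (by nlinarith)
  have h : ∑' n : ℕ, (((q : ℝ)⁻¹) ^ (n.choose 2) * u ^ n / eta q n -
      ((q : ℝ)⁻¹) ^ (n.choose 2) * (u * (q : ℝ)⁻¹) ^ n / eta q n) =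
      ∑' n : ℕ, u * (((q : ℝ)⁻¹) ^ (n.choose 2) * (u * (q : ℝ)⁻¹) ^ n / eta q n) := by
    rw [(hs.sub hs').tsum_eq_zero_add]
    simp only [pow_zero, sub_self, zero_add]
    refine tsum_congr fun n => ?_
    have h := one_sub_pow_mul_inv_eta hq n
    have e : (n + 1).choose 2 = n + n.choose 2 := by
      rw [Nat.choose_succ_succ' n 1, Nat.choose_one_right]
    rw [e, pow_add, div_eq_mul_inv, div_eq_mul_inv, div_eq_mul_inv, ← h]
    ring
  rw [hs.tsum_sub hs', tsum_mul_left] at h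
  linarith

/-- The constant term is 1 and every other term carries at least one factor q^(-N), so the sum lies
between 1 and 1 + q^(-N) w with w the tail at N = 0. -/
theorem tendsto_tsum_chooseSeries (hq : 2 ≤ q) {u : ℝ} (hu0 : 0 ≤ u) (hu1 : u < 1) :
    Filter.Tendsto (fun N : ℕ => ∑' n : ℕ,
      ((q : ℝ)⁻¹) ^ (n.choose 2) * (u * ((q : ℝ)⁻¹) ^ N) ^ n / eta q n) Filter.atTop (nhds 1) := by
  have ha := inv_natCast_lt_one hq
  have ha0 := inv_natCast_pos hq
  have hs := summable_chooseSeries hq hu0 hu1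
  set a : ℝ := (q : ℝ)⁻¹
  set w := ∑' n : ℕ, (a ^ ((n + 1).choose 2) * u ^ (n + 1) / eta q (n + 1)) with hw
  have hpos (n : ℕ) : 0 ≤ a ^ ((n + 1).choose 2) * u ^ (n + 1) / eta q (n + 1) := by
    have := (eta_pos hq (n + 1)).le
    positivity
  have hlim : Filter.Tendsto (fun N : ℕ => 1 + a ^ N * w) Filter.atTop (nhds 1) := by
    simpa using ((tendsto_pow_atTop_nhds_zero_of_lt_one ha0.le ha).mul_const w).const_add 1
  have hle (N : ℕ) : a ^ N ≤ 1 := pow_le_one₀ ha0.le ha.le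
  have hsN (N : ℕ) : Summable fun n : ℕ => a ^ (n.choose 2) * (u * a ^ N) ^ n / eta q n :=
    summable_chooseSeries hq (by positivity)
      (by have := hle N; have : 0 < a ^ N := by positivity
          nlinarith)
  refine tendsto_of_tendsto_of_tendsto_of_le_of_le tendsto_const_nhds hlim (fun N => ?_)
    (fun N => ?_)
  · dsimp only
    rw [(hsN N).tsum_eq_zero_add]
    have : 0 ≤ ∑' n : ℕ, a ^ ((n + 1).choose 2) * (u * a ^ N) ^ (n + 1) / eta q (n + 1) :=
      tsum_nonneg fun n => by
        have := (eta_pos hq (n + 1)).le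
        positivity
    simpa using this
  · dsimp only
    rw [(hsN N).tsum_eq_zero_add, hw, ← tsum_mul_left]
    have h2 : ∑' n : ℕ, a ^ ((n + 1).choose 2) * (u * a ^ N) ^ (n + 1) / eta q (n + 1) ≤
        ∑' n : ℕ, a ^ N * (a ^ ((n + 1).choose 2) * u ^ (n + 1) / eta q (n + 1)) := by
      refine ((summable_nat_add_iff 1).2 (hsN N)).tsum_le_tsum (fun n => ?_)
        (((summable_nat_add_iff 1).2 hs).mul_left _)
      have h3 : (a ^ N) ^ (n + 1) ≤ a ^ N := by
        rw [pow_succ]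
        exact mul_le_of_le_one_left (by positivity) (pow_le_one₀ (by positivity) (hle N))
      calc _ = (a ^ N) ^ (n + 1) * (a ^ ((n + 1).choose 2) * u ^ (n + 1) / eta q (n + 1)) := by
            rw [mul_pow]; ring
        _ ≤ _ := mul_le_mul_of_nonneg_right h3 (hpos n)
    simpa using h2

theorem multipliable_inv_one_add (hq : 2 ≤ q) {u : ℝ} (hu0 : 0 ≤ u) :
    Multipliable fun i : ℕ => (1 + u * ((q : ℝ)⁻¹) ^ i)⁻¹ := by
  have ha := inv_natCast_lt_one hq
  have ha0 := inv_natCast_pos hq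
  set a : ℝ := (q : ℝ)⁻¹
  have h : Summable fun i : ℕ => ‖(1 + u * a ^ i)⁻¹ - 1‖ := by
    refine Summable.of_nonneg_of_le (fun i => norm_nonneg _) (fun i => ?_)
      ((summable_geometric_of_lt_one ha0.le ha).mul_left u)
    have hx : 0 ≤ u * a ^ i := by positivity
    have e : (1 + u * a ^ i)⁻¹ - 1 = - (u * a ^ i / (1 + u * a ^ i)) := by
      field_simp; ring
    rw [e, norm_neg, Real.norm_of_nonneg (by positivity)]
    exact div_le_self hx (by linarith)
  have := multipliable_one_add_of_summable h
  simpa using this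

/-- Iterating S(u) = (1 + u) S(u/q) shows that the product of the first N inverse factors with S(u)
is S(u q^(-N)), which tends to 1. This makes the initial law a probability. -/
theorem tprod_mul_tsum_chooseSeries (hq : 2 ≤ q) {u : ℝ} (hu0 : 0 ≤ u) (hu1 : u < 1) :
    (∏' i : ℕ, (1 + u * ((q : ℝ)⁻¹) ^ i)⁻¹) *
      ∑' n : ℕ, ((q : ℝ)⁻¹) ^ (n.choose 2) * u ^ n / eta q n = 1 := by
  have ha := inv_natCast_lt_one hq
  have ha0 := inv_natCast_pos hq
  have h1 := (multipliable_inv_one_add hq hu0).hasProd.tendsto_prod_nat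
  have h2 := h1.mul_const (∑' n : ℕ, ((q : ℝ)⁻¹) ^ (n.choose 2) * u ^ n / eta q n)
  refine tendsto_nhds_unique h2 ((tendsto_tsum_chooseSeries hq hu0 hu1).congr fun N => ?_)
  induction N with
  | zero => simp
  | succ N ih =>
    have hx : 0 ≤ u * ((q : ℝ)⁻¹) ^ N := by positivity
    have hx1 : u * ((q : ℝ)⁻¹) ^ N < 1 := by
      have : ((q : ℝ)⁻¹) ^ N ≤ 1 := pow_le_one₀ ha0.le ha.le
      nlinarith
    rw [prod_range_succ, mul_right_comm, ← ih, tsum_chooseSeries_eq hq hx hx1, pow_succ,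
      ← mul_assoc u]
    field_simp

theorem tprod_inv_one_add_pos (hq : 2 ≤ q) {u : ℝ} (hu0 : 0 ≤ u) (hu1 : u < 1) :
    0 < ∏' i : ℕ, (1 + u * ((q : ℝ)⁻¹) ^ i)⁻¹ := by
  have h := tprod_mul_tsum_chooseSeries hq hu0 hu1
  have h2 : 0 ≤ ∑' n : ℕ, ((q : ℝ)⁻¹) ^ (n.choose 2) * u ^ n / eta q n :=
    tsum_nonneg fun n => by
      have := (eta_pos hq n).le
      positivity
  by_contra h3
  have := mul_nonpos_of_nonpos_of_nonneg (not_lt.1 h3) h2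
  linarith

/-! ### The transition weights -/

/-- The number of surjections `𝔽_q ^ n → 𝔽_q ^ m`. -/
def surCount (q n m : ℕ) : ℝ := ∏ i ∈ range m, ((q ^ n - q ^ i : ℕ) : ℝ)

@[simp] theorem surCount_zero (q n : ℕ) : surCount q n 0 = 1 := by simp [surCount]

/-- The factor with i = n vanishes, so truncated subtraction in the later factors does no harm. -/
theorem surCount_of_lt {n m : ℕ} (h : n < m) : surCount q n m = 0 :=
  prod_eq_zero (mem_range.2 h) (by simp)

theorem surCount_nonneg (q n m : ℕ) : 0 ≤ surCount q n m :=
  prod_nonneg fun _ _ => Nat.cast_nonneg _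

theorem surCount_add (hq : 2 ≤ q) (m l : ℕ) :
    surCount q (m + l) m = (q : ℝ) ^ ((m + l) * m) * eta q (m + l) / eta q l := by
  have hq0 : (q : ℝ) ≠ 0 := by positivity
  rw [eq_div_iff (eta_ne_zero hq l)]
  induction m generalizing l with
  | zero => simp
  | succ m ih =>
    have h1 : surCount q (m + 1 + l) (m + 1) =
        surCount q (m + (l + 1)) m * ((q : ℝ) ^ (m + (l + 1)) - (q : ℝ) ^ m) := by
      rw [surCount, prod_range_succ, surCount, show m + 1 + l = m + (l + 1) by ring,
        Nat.cast_sub (Nat.pow_le_pow_right (by omega) (by omega)), Nat.cast_pow, Nat.cast_pow]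
    have h2 : (q : ℝ) ^ (m + (l + 1)) - (q : ℝ) ^ m =
        (q : ℝ) ^ (m + (l + 1)) * (1 - ((q : ℝ)⁻¹) ^ (l + 1)) := by
      rw [mul_sub, inv_pow, pow_add (q : ℝ) m (l + 1)]
      field_simp
    have h3 := ih (l + 1)
    rw [eta_succ] at h3
    calc _ = (surCount q (m + (l + 1)) m * (eta q l * (1 - ((q : ℝ)⁻¹) ^ (l + 1)))) *
          (q : ℝ) ^ (m + (l + 1)) := by rw [h1, h2]; ring
      _ = _ := by
        rw [h3, show m + 1 + l = m + (l + 1) by ring, mul_right_comm, ← pow_add]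
        congr 2

/-- The weight of the step from `n` to `m` in a row with index at most `r`. -/
def torsionStep (q : ℕ) (t : ℝ) (n m : ℕ) : ℝ :=
  ((q : ℝ)⁻¹) ^ (m.choose 2) * ((q : ℝ) ^ (-(t + 1))) ^ m * Pf q t (n - m) * eta q n /
    (eta q (n - m) * eta q m)

/-- The weight of the step from `n` to `m` in a row with index larger than `r`. -/
def freeStep (q : ℕ) (v : ℝ) (n m : ℕ) : ℝ :=
  ((q : ℝ)⁻¹) ^ (m ^ 2) * v ^ m * (∏ i ∈ Ico m n, (1 - v * ((q : ℝ)⁻¹) ^ (i + 1))) * eta q n /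
    (eta q (n - m) * eta q m)

theorem sq_eq_choose_two (μ : ℕ) : μ ^ 2 = μ.choose 2 + μ.choose 2 + μ := by
  have := Nat.choose_two_right μ
  have h3 := Nat.even_mul_pred_self μ
  have : μ.choose 2 * 2 = μ * (μ - 1) := by rw [this]; exact Nat.div_mul_cancel h3.two_dvd
  rcases μ with _ | μ
  · simp
  · simp only [Nat.add_sub_cancel] at this
    nlinarith

theorem add_choose_two (m l : ℕ) : (m + l).choose 2 = m.choose 2 + m * l + l.choose 2 := by
  have := Nat.add_choose_eq m l 2
  rw [this, Finset.Nat.sum_antidiagonal_eq_sum_range_succ_mk]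
  simp [sum_range_succ]; ring

theorem sum_range_mul_surCount {n μ : ℕ} (h : μ ≤ n) (f : ℕ → ℝ) :
    ∑ m ∈ range (n + 1), f m * surCount q m μ =
      ∑ l ∈ range (n - μ + 1), f (μ + l) * surCount q (μ + l) μ := by
  rw [← sum_range_add_sum_Ico _ (show μ ≤ n + 1 by omega), sum_eq_zero, zero_add,
    sum_Ico_eq_sum_range, show n + 1 - μ = n - μ + 1 by omega]
  intro m hm
  rw [surCount_of_lt (mem_range.1 hm), mul_zero]

/-- Only m = μ + l contributes. The cross term μl of the binomial exponent cancels against the power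
of q in the number of surjections, and the sum over l becomes `sum_choose_mul_Pf` for n - μ. -/
theorem sum_torsionStep (hq : 2 ≤ q) (t : ℝ) (n μ : ℕ) :
    ∑ m ∈ range (n + 1), torsionStep q t n m * surCount q m μ =
      (q : ℝ) ^ (μ.choose 2) * ((q : ℝ) * (q : ℝ) ^ (-(t + 1))) ^ μ *
        ((q : ℝ)⁻¹) ^ (n * μ) * surCount q n μ := by
  have hq0 : (q : ℝ) ≠ 0 := by positivity
  set u := (q : ℝ) ^ (-(t + 1)) with hu
  rcases lt_or_ge n μ with h | h
  · rw [surCount_of_lt h, mul_zero]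
    refine sum_eq_zero fun m hm => ?_
    rw [surCount_of_lt (by have := mem_range.1 hm; omega), mul_zero]
  · obtain ⟨d, rfl⟩ := Nat.exists_eq_add_of_le h
    rw [sum_range_mul_surCount h, Nat.add_sub_cancel_left, surCount_add hq]
    have key (l : ℕ) (hl : l ∈ range (d + 1)) :
        torsionStep q t (μ + d) (μ + l) * surCount q (μ + l) μ =
        ((q : ℝ) ^ (μ ^ 2) * ((q : ℝ)⁻¹) ^ (μ.choose 2) * u ^ μ * eta q (μ + d)) *
        (((q : ℝ)⁻¹) ^ (l.choose 2) * u ^ l / eta q l *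
      (Pf q t (d - l) / eta q (d - l))) := by
      rw [torsionStep, surCount_add hq, ← hu, Nat.add_sub_add_left, add_choose_two,
        show (μ + l) * μ = μ ^ 2 + μ * l by ring]
      have := eta_ne_zero hq (μ + l)
      have := eta_ne_zero hq (d - l)
      have := eta_ne_zero hq l
      simp only [pow_add, inv_pow]
      field_simp
    rw [sum_congr rfl key, ← mul_sum, sum_choose_mul_Pf hq, inv_pow, inv_pow, mul_pow]
    rw [sq_eq_choose_two μ]
    have := eta_ne_zero hq (μ + d)
    have := eta_ne_zero hq d
    simp only [pow_add]
    field_simp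

/-- The same substitution m = μ + l reduces the sum to the finite Cauchy identity for n - μ at x = v
q^(-μ). -/
theorem sum_freeStep (hq : 2 ≤ q) (v : ℝ) (n μ : ℕ) :
    ∑ m ∈ range (n + 1), freeStep q v n m * surCount q m μ =
      v ^ μ * ((q : ℝ)⁻¹) ^ (n * μ) * surCount q n μ := by
  have hq0 : (q : ℝ) ≠ 0 := by positivity
  rcases lt_or_ge n μ with h | h
  · rw [surCount_of_lt h, mul_zero]
    refine sum_eq_zero fun m hm => ?_
    rw [surCount_of_lt (by have := mem_range.1 hm; omega), mul_zero]
  · obtain ⟨d, rfl⟩ := Nat.exists_eq_add_of_le h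
    rw [sum_range_mul_surCount h, Nat.add_sub_cancel_left, surCount_add hq]
    have key (l : ℕ) (hl : l ∈ range (d + 1)) :
        freeStep q v (μ + d) (μ + l) * surCount q (μ + l) μ =
        (v ^ μ * eta q (μ + d)) *
        (((q : ℝ)⁻¹) ^ (l ^ 2) * (v * ((q : ℝ)⁻¹) ^ μ) ^ l / (eta q (d - l) * eta q l) *
      ∏ i ∈ Ico l d, (1 - (v * ((q : ℝ)⁻¹) ^ μ) * ((q : ℝ)⁻¹) ^ (i + 1))) := by
      rw [freeStep, surCount_add hq, Nat.add_sub_add_left, add_comm μ d, add_comm μ l,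
        ← prod_Ico_add' (fun i => (1 - v * ((q : ℝ)⁻¹) ^ (i + 1))) l d μ,
        show (l + μ) ^ 2 = l ^ 2 + μ * l + (l + μ) * μ by ring]
      have e2 : ∏ i ∈ Ico l d, (1 - v * ((q : ℝ)⁻¹) ^ (i + μ + 1)) =
          ∏ i ∈ Ico l d, (1 - (v * ((q : ℝ)⁻¹) ^ μ) * ((q : ℝ)⁻¹) ^ (i + 1)) :=
        prod_congr rfl fun i _ => by ring
      rw [e2]
      generalize ∏ i ∈ Ico l d, (1 - (v * ((q : ℝ)⁻¹) ^ μ) * ((q : ℝ)⁻¹) ^ (i + 1)) = Q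
      have := eta_ne_zero hq (l + μ)
      have := eta_ne_zero hq (d - l)
      have := eta_ne_zero hq l
      simp only [pow_add, inv_pow, mul_pow, pow_mul]
      field_simp
    rw [sum_congr rfl key, ← mul_sum, sum_sq_mul_prod hq, inv_pow]
    have := eta_ne_zero hq (μ + d)
    have := eta_ne_zero hq d
    field_simp

/-- The probability of the first row `m`. -/
def firstWeight (q : ℕ) (t : ℝ) (m : ℕ) : ℝ :=
  (∏' i : ℕ, (1 + (q : ℝ) ^ (-(t + 1)) * ((q : ℝ)⁻¹) ^ i)⁻¹) *
    (((q : ℝ)⁻¹) ^ (m.choose 2) * ((q : ℝ) ^ (-(t + 1))) ^ m / eta q m)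

theorem rpow_neg_add_one_lt_one (hq : 2 ≤ q) {t : ℝ} (ht : 0 ≤ t) : (q : ℝ) ^ (-(t + 1)) < 1 :=
  Real.rpow_lt_one_of_one_lt_of_neg (by exact_mod_cast hq) (by linarith)

/-- The analogue for the initial law: after m = μ + l, the remaining series is the inverse of
Euler's product, which the normalising constant cancels. -/
theorem hasSum_firstWeight (hq : 2 ≤ q) {t : ℝ} (ht : 0 ≤ t) (μ : ℕ) :
    HasSum (fun m => firstWeight q t m * surCount q m μ)
      ((q : ℝ) ^ (μ.choose 2) * ((q : ℝ) * (q : ℝ) ^ (-(t + 1))) ^ μ) := by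
  have hq0 : (q : ℝ) ≠ 0 := by positivity
  set u := (q : ℝ) ^ (-(t + 1)) with hu
  have hu0 : 0 < u := by positivity
  have hu1 : u < 1 := rpow_neg_add_one_lt_one hq ht
  have h1 : HasSum (fun l => (((q : ℝ)⁻¹) ^ (l.choose 2) * u ^ l / eta q l))
      (∏' i : ℕ, (1 + u * ((q : ℝ)⁻¹) ^ i)⁻¹)⁻¹ := by
    rw [← eq_inv_of_mul_eq_one_right (tprod_mul_tsum_chooseSeries hq hu0.le hu1)]
    exact (summable_chooseSeries hq hu0.le hu1).hasSum
  have hc := (tprod_inv_one_add_pos hq hu0.le hu1).ne'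
  set c := ∏' i : ℕ, (1 + u * ((q : ℝ)⁻¹) ^ i)⁻¹ with hcdef
  have h2 := h1.mul_left ((q : ℝ) ^ (μ ^ 2) * ((q : ℝ)⁻¹) ^ (μ.choose 2) * u ^ μ * c)
  have h3 : (q : ℝ) ^ (μ ^ 2) * ((q : ℝ)⁻¹) ^ (μ.choose 2) * u ^ μ * c * c⁻¹ =
      (q : ℝ) ^ (μ.choose 2) * ((q : ℝ) * u) ^ μ := by
    rw [sq_eq_choose_two μ]; simp only [pow_add, inv_pow, mul_pow]; field_simp
  rw [h3] at h2
  rw [← hasSum_nat_add_iff' μ, sum_eq_zero (fun m hm => by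
    rw [surCount_of_lt (mem_range.1 hm), mul_zero]), sub_zero]
  suffices h : ∀ l, firstWeight q t (l + μ) * surCount q (l + μ) μ =
      (q : ℝ) ^ (μ ^ 2) * ((q : ℝ)⁻¹) ^ (μ.choose 2) * u ^ μ * c *
        (((q : ℝ)⁻¹) ^ (l.choose 2) * u ^ l / eta q l) by
    simp only [h]; exact h2
  intro l
  rw [firstWeight, ← hu, ← hcdef, add_comm l μ, surCount_add hq, add_choose_two,
    show (μ + l) * μ = μ ^ 2 + μ * l by ring]
  have := eta_ne_zero hq (μ + l)
  have := eta_ne_zero hq l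
  simp only [pow_add, inv_pow]
  field_simp

end QSeries


/-! ### Homomorphisms between cyclic torsion modules -/

section Cyclic

theorem card_ker_eq_card_coker {R N : Type*} [CommRing R] [AddCommGroup N] [Module R N] [Finite N]
    (f : N →ₗ[R] N) : Nat.card (LinearMap.ker f) = Nat.card (N ⧸ LinearMap.range f) := by
  have h1 := Submodule.card_eq_card_quotient_mul_card (LinearMap.ker f)
  have h2 := Submodule.card_eq_card_quotient_mul_card (LinearMap.range f)
  have h3 := Nat.card_congr f.quotKerEquivRange.toEquiv
  have h4 : 0 < Nat.card (LinearMap.range f) := Nat.card_pos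
  rw [h3] at h1
  rw [h2] at h1
  apply Nat.eq_of_mul_eq_mul_left h4
  linarith

/-- Homomorphisms from a cyclic module are given by the image of `1`. -/
def cyclicHomEquiv {R N : Type*} [CommRing R] [AddCommGroup N] [Module R N] {I : Ideal R} {x : R}
    (h : I = Ideal.span {x}) : ((R ⧸ I) →ₗ[R] N) ≃ Submodule.torsionBy R N x where
  toFun f := ⟨f 1, by
    rw [Submodule.mem_torsionBy_iff, ← map_smul, Algebra.smul_def, mul_one,
      Ideal.Quotient.algebraMap_eq, Ideal.Quotient.eq_zero_iff_mem.2
        (h ▸ Ideal.mem_span_singleton_self x), map_zero]⟩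
  invFun y := Submodule.liftQ I (LinearMap.toSpanSingleton R N y) (by
    intro r hr
    rw [h, Ideal.mem_span_singleton] at hr
    obtain ⟨c, rfl⟩ := hr
    rw [LinearMap.mem_ker, LinearMap.toSpanSingleton_apply, mul_comm, mul_smul,
      (Submodule.mem_torsionBy_iff _ _).1 y.2, smul_zero])
  left_inv f := by
    ext
    simp
  right_inv y := by
    ext
    change (1 : R) • (y : N) = y
    simp

variable {R : Type u} [CommRing R] [IsDomain R] [IsDiscreteValuationRing R]

theorem maximalIdeal_pow_sup (m n : ℕ) :
    maximalIdeal R ^ m ⊔ maximalIdeal R ^ n = maximalIdeal R ^ (min m n) := by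
  rcases le_total m n with h | h
  · rw [min_eq_left h, sup_eq_left]; exact Ideal.pow_le_pow_right h
  · rw [min_eq_right h, sup_eq_right]; exact Ideal.pow_le_pow_right h

theorem maximalIdeal_pow_eq_span {ϖ : R} (hϖ : Irreducible ϖ) (n : ℕ) :
    maximalIdeal R ^ n = Ideal.span {ϖ ^ n} := by
  rw [hϖ.maximalIdeal_eq, Ideal.span_singleton_pow]

theorem card_quotient_maximalIdeal_pow (n : ℕ) :
    Nat.card (R ⧸ maximalIdeal R ^ n) = Nat.card (ResidueField R) ^ n := by
  have := cardQuot_pow_of_prime (P := maximalIdeal R) (IsDiscreteValuationRing.not_a_field R)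
    (i := n)
  rwa [Submodule.cardQuot_apply, Submodule.cardQuot_apply] at this

/-- The reduction map from `R / 𝔪 ^ (b + 1)` to the residue field. -/
def reduction (R : Type u) [CommRing R] [IsLocalRing R] (b : ℕ) :
    (R ⧸ maximalIdeal R ^ (b + 1)) →ₗ[R] ResidueField R :=
  Submodule.factor (Ideal.pow_le_self (Nat.succ_ne_zero b))

/-- Multiplication by a uniformizer, as a map from `R / 𝔪 ^ b` to `R / 𝔪 ^ (b + 1)`. -/
def mulUniformizer {ϖ : R} (hϖ : Irreducible ϖ) (b : ℕ) :
    (R ⧸ maximalIdeal R ^ b) →ₗ[R] (R ⧸ maximalIdeal R ^ (b + 1)) :=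
  Submodule.mapQ _ _ (LinearMap.lsmul R R ϖ) (by
    intro r hr
    rw [Submodule.mem_comap, pow_succ', LinearMap.lsmul_apply, smul_eq_mul]
    exact Ideal.mul_mem_mul (hϖ.maximalIdeal_eq ▸ Ideal.mem_span_singleton_self ϖ) hr)

theorem mulUniformizer_injective {ϖ : R} (hϖ : Irreducible ϖ) (b : ℕ) :
    Function.Injective (mulUniformizer hϖ b) := by
  rw [injective_iff_map_eq_zero]
  intro x hx
  obtain ⟨r, rfl⟩ := Submodule.Quotient.mk_surjective _ x
  have hx' : ϖ * r ∈ maximalIdeal R ^ (b + 1) := (Submodule.Quotient.mk_eq_zero _).1 hx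
  rw [maximalIdeal_pow_eq_span hϖ, Ideal.mem_span_singleton, pow_succ'] at hx'
  rw [Submodule.Quotient.mk_eq_zero, maximalIdeal_pow_eq_span hϖ, Ideal.mem_span_singleton]
  exact (mul_dvd_mul_iff_left hϖ.ne_zero).1 hx'

theorem range_mulUniformizer {ϖ : R} (hϖ : Irreducible ϖ) (b : ℕ) :
    LinearMap.range (mulUniformizer hϖ b) = LinearMap.ker (reduction R b) := by
  ext y
  constructor
  · rintro ⟨x, rfl⟩
    obtain ⟨r, rfl⟩ := Submodule.Quotient.mk_surjective _ x
    exact (Submodule.Quotient.mk_eq_zero _).2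
      (Ideal.mul_mem_right _ _ (hϖ.maximalIdeal_eq ▸ Ideal.mem_span_singleton_self ϖ))
  · intro hy
    obtain ⟨r, rfl⟩ := Submodule.Quotient.mk_surjective _ y
    have hr : r ∈ maximalIdeal R := (Submodule.Quotient.mk_eq_zero _).1 hy
    rw [hϖ.maximalIdeal_eq, Ideal.mem_span_singleton] at hr
    obtain ⟨c, rfl⟩ := hr
    exact ⟨Submodule.Quotient.mk c, rfl⟩

variable {P : Type*} [AddCommGroup P] [Module R P]

/-- Composition with the reduction map. -/
def homReduction (R : Type u) [CommRing R] [IsLocalRing R] (P : Type*) [AddCommGroup P]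
    [Module R P] (b : ℕ) :
    (P →ₗ[R] (R ⧸ maximalIdeal R ^ (b + 1))) →ₗ[R] (P →ₗ[R] ResidueField R) :=
  LinearMap.compRight R (reduction R b)

theorem homReduction_apply (b : ℕ) (f : P →ₗ[R] (R ⧸ maximalIdeal R ^ (b + 1))) (x : P) :
    homReduction R P b f x = reduction R b (f x) := rfl

/-- A functional that lifts to a longer cyclic module lifts to every shorter one. These images are
the nested subspaces used in counting surjections. -/
theorem range_homReduction_anti {b c : ℕ} (h : b ≤ c) :
    LinearMap.range (homReduction R P c) ≤ LinearMap.range (homReduction R P b) := by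
  rintro _ ⟨f, rfl⟩
  refine ⟨(Submodule.factor (Ideal.pow_le_pow_right (Nat.succ_le_succ h))).comp f, ?_⟩
  ext x
  obtain ⟨r, hr⟩ := Submodule.Quotient.mk_surjective _ (f x)
  rw [homReduction_apply, homReduction_apply, LinearMap.comp_apply, ← hr]
  rfl

/-- Multiplication by a uniformizer identifies R/𝔪^b with the kernel of R/𝔪^(b+1) → R/𝔪. -/
theorem card_ker_homReduction (b : ℕ) :
    Nat.card (LinearMap.ker (homReduction R P b)) = Nat.card (P →ₗ[R] (R ⧸ maximalIdeal R ^ b)) := by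
  obtain ⟨ϖ, hϖ⟩ := IsDiscreteValuationRing.exists_irreducible R
  symm
  refine Nat.card_congr (Equiv.ofBijective
    (fun g => ⟨(mulUniformizer hϖ b).comp g, ?_⟩) ⟨?_, ?_⟩)
  · rw [LinearMap.mem_ker]
    ext x
    have : mulUniformizer hϖ b (g x) ∈ LinearMap.ker (reduction R b) := by
      rw [← range_mulUniformizer hϖ]; exact ⟨_, rfl⟩
    exact this
  · intro g g' h
    ext x
    exact mulUniformizer_injective hϖ b (LinearMap.congr_fun (congrArg Subtype.val h) x)
  · rintro ⟨f, hf⟩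
    have hr (x : P) : f x ∈ LinearMap.range (mulUniformizer hϖ b) := by
      rw [range_mulUniformizer]; exact LinearMap.congr_fun hf x
    let e := LinearEquiv.ofInjective _ (mulUniformizer_injective hϖ b)
    refine ⟨e.symm.toLinearMap.comp (f.codRestrict _ hr), ?_⟩
    ext x
    have := e.apply_symm_apply ⟨f x, hr x⟩
    exact congrArg Subtype.val this

theorem card_range_homReduction_mul (b : ℕ) :
    Nat.card (LinearMap.range (homReduction R P b)) *
      Nat.card (P →ₗ[R] (R ⧸ maximalIdeal R ^ b)) =
      Nat.card (P →ₗ[R] (R ⧸ maximalIdeal R ^ (b + 1))) := by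
  rw [← card_ker_homReduction, ← Nat.card_congr (homReduction R P b).quotKerEquivRange.toEquiv,
    mul_comm, ← Submodule.card_eq_card_quotient_mul_card]

variable [Finite (ResidueField R)]

theorem card_residueField_pos (R : Type u) [CommRing R] [IsLocalRing R]
    [Finite (ResidueField R)] : 0 < Nat.card (ResidueField R) :=
  Nat.card_pos

theorem two_le_card_residueField (R : Type u) [CommRing R] [IsLocalRing R]
    [Finite (ResidueField R)] : 2 ≤ Nat.card (ResidueField R) :=
  Finite.one_lt_card

instance finite_quotient_maximalIdeal_pow (n : ℕ) : Finite (R ⧸ maximalIdeal R ^ n) :=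
  Nat.finite_of_card_ne_zero (by
    rw [card_quotient_maximalIdeal_pow]; exact (pow_pos (card_residueField_pos R) n).ne')

/-- An endomorphism of a finite module has kernel and cokernel of equal order, and the cokernel of
ϖ^n is R/(𝔪^b + 𝔪^n). -/
theorem card_torsionBy_pow {ϖ : R} (hϖ : Irreducible ϖ) (n b : ℕ) :
    Nat.card (Submodule.torsionBy R (R ⧸ maximalIdeal R ^ b) (ϖ ^ n)) =
      Nat.card (ResidueField R) ^ (min n b) := by
  have h1 := card_ker_eq_card_coker
    (LinearMap.lsmul R (R ⧸ maximalIdeal R ^ b) (ϖ ^ n))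
  have h2 : LinearMap.range (LinearMap.lsmul R (R ⧸ maximalIdeal R ^ b) (ϖ ^ n)) =
      Submodule.map (Submodule.mkQ (maximalIdeal R ^ b)) (maximalIdeal R ^ n) := by
    rw [maximalIdeal_pow_eq_span hϖ n]
    ext y
    constructor
    · rintro ⟨z, rfl⟩
      obtain ⟨r, rfl⟩ := Submodule.Quotient.mk_surjective _ z
      exact ⟨ϖ ^ n * r, Ideal.mul_mem_right _ _ (Ideal.mem_span_singleton_self _), rfl⟩
    · rintro ⟨r, hr, rfl⟩
      obtain ⟨c, rfl⟩ := Ideal.mem_span_singleton.1 hr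
      exact ⟨Submodule.Quotient.mk c, rfl⟩
  rw [h2, Nat.card_congr (Submodule.quotientQuotientEquivQuotientSup
    (maximalIdeal R ^ b) (maximalIdeal R ^ n)).toEquiv, maximalIdeal_pow_sup,
    card_quotient_maximalIdeal_pow, min_comm] at h1
  exact h1

theorem card_cyclic_hom (a b : ℕ) :
    Nat.card ((R ⧸ maximalIdeal R ^ a) →ₗ[R] (R ⧸ maximalIdeal R ^ b)) =
      Nat.card (ResidueField R) ^ (min a b) := by
  obtain ⟨ϖ, hϖ⟩ := IsDiscreteValuationRing.exists_irreducible R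
  rw [Nat.card_congr (cyclicHomEquiv (maximalIdeal_pow_eq_span hϖ a)), card_torsionBy_pow hϖ]

instance finite_linearMap {R P N : Type*} [Semiring R] [AddCommMonoid P] [Module R P]
    [AddCommMonoid N] [Module R N] [Finite P] [Finite N] : Finite (P →ₗ[R] N) :=
  Finite.of_injective (fun f => (f : P → N)) DFunLike.coe_injective

theorem card_pi_hom {ι : Type*} [Fintype ι] [DecidableEq ι] (a : ι → ℕ) (b : ℕ) :
    Nat.card (((i : ι) → R ⧸ maximalIdeal R ^ a i) →ₗ[R] (R ⧸ maximalIdeal R ^ b)) =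
      Nat.card (ResidueField R) ^ (∑ i, min (a i) b) := by
  rw [← Nat.card_congr (LinearMap.lsum R (fun i => R ⧸ maximalIdeal R ^ a i) R).toEquiv,
    Nat.card_pi, Finset.prod_congr rfl fun i _ => card_cyclic_hom (a i) b,
    Finset.prod_pow_eq_pow_sum]

end Cyclic

/-! ### Tuples with linearly independent images in nested subspaces. -/

section Counting

/-- The number of tuples with linearly independent images. -/
theorem card_linearIndependent_images {K V : Type*} [Field K] [Finite K] [AddCommGroup V]
    [Module K V] [Finite V] (n : ℕ) (G : Fin n → Type*) [∀ j, AddCommGroup (G j)]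
    [∀ j, Finite (G j)] (φ : ∀ j, G j →+ V)
    (W : Fin n → Submodule K V) (hW : ∀ j, (W j : Set V) = Set.range (φ j))
    (hmono : ∀ i j, i ≤ j → W i ≤ W j) :
    Nat.card {g : ∀ j, G j // LinearIndependent K fun j => φ j (g j)} =
      ∏ j, Nat.card (φ j).ker * (Nat.card (W j) - Nat.card K ^ (j : ℕ)) := by
  induction n with
  | zero =>
    have : Unique {g : ∀ j, G j // LinearIndependent K fun j => φ j (g j)} :=
      { default := ⟨fun j => j.elim0, linearIndependent_empty_type⟩
        uniq := fun g => Subtype.ext (funext fun j => j.elim0) }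
    simp
  | succ n ih =>
    have ih' := ih (fun j => G j.castSucc) (fun j => φ j.castSucc) (fun j => W j.castSucc)
      (fun j => hW _) (fun i j h => hmono _ _ h)
    rw [Fin.prod_univ_castSucc]
    simp only [Fin.val_castSucc, Fin.val_last]
    rw [← ih']
    let S := {g : ∀ j : Fin n, G j.castSucc // LinearIndependent K fun j => φ j.castSucc (g j)}
    -- The vectors are chosen one after another: a tuple is an independent tuple of length n
    -- together with a last entry whose image avoids its span.
    let E : {g : ∀ j, G j // LinearIndependent K fun j => φ j (g j)} ≃
        Σ g : S, {x : G (Fin.last n) // φ (Fin.last n) x ∉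
          Submodule.span K (Set.range fun j => φ j.castSucc (g.1 j))} :=
      { toFun := fun g => by
          have h : LinearIndependent K (Fin.snoc (fun j : Fin n => φ j.castSucc (g.1 j.castSucc))
              (φ (Fin.last n) (g.1 (Fin.last n))) : Fin (n + 1) → V) := by
            convert g.2 using 1
            ext j
            refine Fin.lastCases ?_ (fun i => ?_) j <;> simp
          rw [linearIndependent_finSnoc] at h
          exact ⟨⟨fun j => g.1 j.castSucc, h.1⟩, ⟨g.1 (Fin.last n), h.2⟩⟩
        invFun := fun g => ⟨Fin.snoc g.1.1 g.2.1, by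
          have h := linearIndependent_finSnoc.2 ⟨g.1.2, g.2.2⟩
          convert h using 1
          ext j
          refine Fin.lastCases ?_ (fun i => ?_) j <;> simp⟩
        left_inv := fun g => by
          ext j
          refine Fin.lastCases ?_ (fun i => ?_) j <;> simp
        right_inv := fun g => by
          refine Sigma.subtype_ext (Subtype.ext (funext fun j => ?_)) ?_ <;> simp }
    -- Since the subspaces increase, the span U of the earlier images lies in the last one. Each
    -- subspace of W has a preimage of order |ker φ| times its own order, and |U| = |K|^n, so the
    -- number of last entries does not depend on the earlier choice.
    have hfib (g : S) : Nat.card {x : G (Fin.last n) // φ (Fin.last n) x ∉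
          Submodule.span K (Set.range fun j => φ j.castSucc (g.1 j))} =
        Nat.card (φ (Fin.last n)).ker *
          (Nat.card (W (Fin.last n)) - Nat.card K ^ n) := by
      set U := Submodule.span K (Set.range fun j => φ j.castSucc (g.1 j)) with hU
      have hUW : U ≤ W (Fin.last n) := by
        rw [hU, Submodule.span_le]
        rintro _ ⟨j, rfl⟩
        refine hmono _ _ (Fin.le_last j.castSucc) ?_
        rw [← SetLike.mem_coe, hW]
        exact ⟨_, rfl⟩
      have hUcard : Nat.card U = Nat.card K ^ n := by
        rw [Module.natCard_eq_pow_finrank (K := K), hU, finrank_span_eq_card g.2, Fintype.card_fin]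
      have hpre (U' : Submodule K V) (hU' : U' ≤ W (Fin.last n)) :
          Nat.card {x // φ (Fin.last n) x ∈ U'} =
            Nat.card (φ (Fin.last n)).ker * Nat.card U' := by
        let ψ : (U'.toAddSubgroup.comap (φ (Fin.last n))) →+ U' :=
          ((φ (Fin.last n)).comp (AddSubgroup.subtype _)).codRestrict U'.toAddSubgroup
            (fun x => x.2)
        have hψ : Function.Surjective ψ := by
          rintro ⟨y, hy⟩
          have : y ∈ (W (Fin.last n) : Set V) := hU' hy
          rw [hW] at this
          obtain ⟨x, rfl⟩ := this
          exact ⟨⟨x, hy⟩, rfl⟩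
        have h1 := AddSubgroup.card_eq_card_quotient_mul_card_addSubgroup ψ.ker
        rw [Nat.card_congr (QuotientAddGroup.quotientKerEquivOfSurjective ψ hψ).toEquiv] at h1
        have h2 : Nat.card ψ.ker = Nat.card (φ (Fin.last n)).ker := by
          refine Nat.card_congr
            { toFun := fun x => ⟨x.1.1, by
                have := x.2
                rw [AddMonoidHom.mem_ker] at this ⊢
                exact congrArg Subtype.val this⟩
              invFun := fun x => ⟨⟨x.1, by
                change φ (Fin.last n) x.1 ∈ U'
                rw [(AddMonoidHom.mem_ker).1 x.2]; exact zero_mem _⟩, by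
                rw [AddMonoidHom.mem_ker]
                exact Subtype.ext ((AddMonoidHom.mem_ker).1 x.2)⟩
              left_inv := fun x => rfl
              right_inv := fun x => rfl }
        rw [h2, mul_comm] at h1
        exact h1
      have htot : Nat.card (G (Fin.last n)) =
          Nat.card (φ (Fin.last n)).ker * Nat.card (W (Fin.last n)) := by
        rw [← hpre _ le_rfl]
        refine Nat.card_congr (Equiv.subtypeUnivEquiv fun x => ?_).symm
        rw [← SetLike.mem_coe, hW]
        exact ⟨_, rfl⟩
      have hsum : Nat.card (G (Fin.last n)) =
          Nat.card {x // φ (Fin.last n) x ∈ U} + Nat.card {x // φ (Fin.last n) x ∉ U} := by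
        classical
        rw [← Nat.card_sum]
        exact Nat.card_congr (Equiv.sumCompl fun x => φ (Fin.last n) x ∈ U).symm
      rw [hpre U hUW, htot, hUcard] at hsum
      rw [Nat.mul_sub]
      omega
    have : Fintype S := Fintype.ofFinite S
    rw [Nat.card_congr E, Nat.card_sigma, Finset.sum_congr rfl fun g _ => hfib g,
      Finset.sum_const, Finset.card_univ, smul_eq_mul, ← Nat.card_eq_fintype_card]

end Counting


/-! ### Counting surjections -/

section Surjections

variable {R : Type u} [CommRing R] [IsDomain R] [IsDiscreteValuationRing R]
  {P : Type*} [AddCommGroup P] [Module R P]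

theorem mem_smul_top_of_reduction {n : ℕ} {b : Fin n → ℕ}
    {z : (j : Fin n) → R ⧸ maximalIdeal R ^ (b j + 1)} (hz : ∀ j, reduction R (b j) (z j) = 0) :
    z ∈ maximalIdeal R • (⊤ : Submodule R ((j : Fin n) → R ⧸ maximalIdeal R ^ (b j + 1))) := by
  classical
  rw [← Finset.univ_sum_single z]
  refine Submodule.sum_mem _ fun j _ => ?_
  have hj := hz j
  obtain ⟨r, hr⟩ := Submodule.Quotient.mk_surjective _ (z j)
  rw [← hr] at hj ⊢
  have hr' : r ∈ maximalIdeal R := (Submodule.Quotient.mk_eq_zero _).1 hj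
  have e : (Submodule.Quotient.mk r : R ⧸ maximalIdeal R ^ (b j + 1)) =
      r • Submodule.Quotient.mk 1 := by
    rw [← Submodule.Quotient.mk_smul, smul_eq_mul, mul_one]
  rw [e, Pi.single_smul]
  exact Submodule.smul_mem_smul hr' trivial

/-- A map to a product of cyclic modules is surjective if and only if the reductions of its
components are linearly independent. -/
theorem surjective_pi_iff {n : ℕ} {b : Fin n → ℕ}
    (f : (j : Fin n) → P →ₗ[R] (R ⧸ maximalIdeal R ^ (b j + 1))) :
    Function.Surjective (LinearMap.pi f) ↔
      LinearIndependent (ResidueField R) fun j => homReduction R P (b j) (f j) := by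
  classical
  constructor
  · intro h
    rw [Fintype.linearIndependent_iff]
    intro c hc i
    obtain ⟨x, hx⟩ := h (Pi.single i (Submodule.Quotient.mk 1))
    have h1 := LinearMap.congr_fun hc x
    rw [LinearMap.sum_apply, Finset.sum_eq_single i] at h1
    · have h2 : f i x = Submodule.Quotient.mk 1 := by
        have := congrFun hx i
        simpa using this
      rw [LinearMap.smul_apply, homReduction_apply, h2] at h1
      change c i * (1 : ResidueField R) = 0 at h1
      simpa using h1
    · intro j _ hj
      have h2 : f j x = 0 := by
        have := congrFun hx j
        simpa [hj] using this
      rw [LinearMap.smul_apply, homReduction_apply, h2, map_zero, smul_zero]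
    · simp
  · intro h
    -- The image modulo 𝔪 is a subspace over the residue field. If it were proper, a nonzero
    -- functional vanishing on it would give a linear dependence between the reductions.
    let U : Submodule (ResidueField R) (Fin n → ResidueField R) :=
      { carrier := Set.range fun x j => homReduction R P (b j) (f j) x
        add_mem' := by
          rintro _ _ ⟨x, rfl⟩ ⟨y, rfl⟩
          exact ⟨x + y, by ext j; simp⟩
        zero_mem' := ⟨0, by ext j; simp⟩
        smul_mem' := by
          rintro c _ ⟨x, rfl⟩
          obtain ⟨r, rfl⟩ := IsLocalRing.residue_surjective c
          refine ⟨r • x, ?_⟩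
          ext j
          dsimp only
          rw [map_smul, Pi.smul_apply, smul_eq_mul, Algebra.smul_def]
          rfl }
    have hU : U = ⊤ := by
      by_contra hne
      obtain ⟨g, hg, hgU⟩ := Submodule.exists_le_ker_of_lt_top U (lt_top_iff_ne_top.2 hne)
      apply hg
      have h0 := Fintype.linearIndependent_iff.1 h (fun j => g (Pi.single j 1)) (by
        ext x
        have hx : g (fun j => homReduction R P (b j) (f j) x) = 0 := hgU ⟨x, rfl⟩
        rw [LinearMap.pi_apply_eq_sum_univ] at hx
        rw [LinearMap.sum_apply, LinearMap.zero_apply, ← hx]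
        refine Finset.sum_congr rfl fun j _ => ?_
        rw [LinearMap.smul_apply, smul_eq_mul, smul_eq_mul, mul_comm]
        congr 2
        ext i
        simp [Pi.single_apply, eq_comm])
      refine LinearMap.pi_ext' fun j => ?_
      ext
      simpa using h0 j
    -- Surjectivity modulo 𝔪 lifts by Nakayama's lemma.
    rw [← LinearMap.range_eq_top, eq_top_iff]
    refine Submodule.le_of_le_smul_of_le_jacobson_bot (I := maximalIdeal R)
      (Module.Finite.fg_top) (IsLocalRing.maximalIdeal_le_jacobson _) ?_
    intro y _
    have hy : (fun j => reduction R (b j) (y j)) ∈ U := hU ▸ trivial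
    obtain ⟨x, hx⟩ := hy
    rw [← add_sub_cancel (LinearMap.pi f x) y]
    refine Submodule.add_mem_sup ⟨x, rfl⟩ (mem_smul_top_of_reduction fun j => ?_)
    rw [Pi.sub_apply, map_sub, sub_eq_zero]
    exact (congrFun hx j).symm

variable [Finite (ResidueField R)]

/-- By `surjective_pi_iff` a surjection is a tuple with independent reductions. Since the exponents
decrease, the subspaces of liftable functionals increase, as the count of independent tuples
requires. -/
theorem card_sur_pi [Finite P] {n : ℕ} {b : Fin n → ℕ} (hb : ∀ i j, i ≤ j → b j ≤ b i) :
    Nat.card {g : P →ₗ[R] ((j : Fin n) → R ⧸ maximalIdeal R ^ (b j + 1)) //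
        Function.Surjective g} =
      ∏ j, Nat.card (P →ₗ[R] (R ⧸ maximalIdeal R ^ (b j))) *
        (Nat.card (LinearMap.range (homReduction R P (b j))) -
          Nat.card (ResidueField R) ^ (j : ℕ)) := by
  let W (j : Fin n) : Submodule (ResidueField R) (P →ₗ[R] ResidueField R) :=
    { (LinearMap.range (homReduction R P (b j))).toAddSubmonoid with
      smul_mem' := by
        rintro c _ ⟨f, rfl⟩
        obtain ⟨r, rfl⟩ := IsLocalRing.residue_surjective c
        refine ⟨r • f, ?_⟩
        ext x
        rw [map_smul, LinearMap.smul_apply, LinearMap.smul_apply, Algebra.smul_def]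
        rfl }
  have h := card_linearIndependent_images (K := ResidueField R) n
    (fun j => P →ₗ[R] (R ⧸ maximalIdeal R ^ (b j + 1)))
    (fun j => (homReduction R P (b j)).toAddMonoidHom) W (fun j => rfl)
    (fun i j hij => range_homReduction_anti (hb i j hij))
  have e : {g : P →ₗ[R] ((j : Fin n) → R ⧸ maximalIdeal R ^ (b j + 1)) //
        Function.Surjective g} ≃
      {g : (j : Fin n) → P →ₗ[R] (R ⧸ maximalIdeal R ^ (b j + 1)) //
        LinearIndependent (ResidueField R) fun j =>
          (homReduction R P (b j)).toAddMonoidHom (g j)} :=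
    { toFun := fun g => ⟨fun j => (LinearMap.proj j).comp g.1, (surjective_pi_iff _).1 g.2⟩
      invFun := fun g => ⟨LinearMap.pi g.1, (surjective_pi_iff _).2 g.2⟩
      left_inv := fun g => rfl
      right_inv := fun g => rfl }
  rw [Nat.card_congr e, h]
  refine Finset.prod_congr rfl fun j _ => ?_
  rw [← card_ker_homReduction]
  rfl

end Surjections


/-! ### The modules attached to partitions -/

section Young

open Finset

theorem youngDiagram_ext_colLen {κ τ : YoungDiagram} (h : ∀ l, κ.colLen l = τ.colLen l) :
    κ = τ := by
  ext ⟨i, j⟩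
  rw [YoungDiagram.mem_cells, YoungDiagram.mem_cells, YoungDiagram.mem_iff_lt_colLen,
    YoungDiagram.mem_iff_lt_colLen, h]

theorem lt_colLen_iff_lt_rowLen (κ : YoungDiagram) (i l : ℕ) :
    i < κ.colLen l ↔ l < κ.rowLen i := by
  rw [← YoungDiagram.mem_iff_lt_colLen, YoungDiagram.mem_iff_lt_rowLen]

theorem colLen_eq_zero_iff (κ : YoungDiagram) (l : ℕ) : κ.colLen l = 0 ↔ κ.rowLen 0 ≤ l := by
  rw [← not_lt, ← lt_colLen_iff_lt_rowLen]; omega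

/-- Both sides count the cells in the first b columns. -/
theorem sum_range_min_rowLen (κ : YoungDiagram) (b : ℕ) :
    ∑ i ∈ range (κ.colLen 0), min (κ.rowLen i) b = ∑ l ∈ range b, κ.colLen l := by
  have h1 (i : ℕ) : min (κ.rowLen i) b = ∑ l ∈ range b, if l < κ.rowLen i then 1 else 0 := by
    rw [← sum_filter, sum_const, smul_eq_mul, mul_one]
    rw [show (range b).filter (fun l => l < κ.rowLen i) = range (min (κ.rowLen i) b) by
      ext l; simp; omega, card_range]
  simp only [h1]
  rw [sum_comm]
  refine sum_congr rfl fun l _ => ?_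
  rw [← sum_filter, sum_const, smul_eq_mul, mul_one]
  rw [show (range (κ.colLen 0)).filter (fun i => l < κ.rowLen i) = range (κ.colLen l) by
    ext i
    rw [mem_filter, mem_range, mem_range, ← lt_colLen_iff_lt_rowLen]
    have := κ.colLen_anti 0 l (Nat.zero_le _)
    omega, card_range]

/-- The contribution of one row to the number of surjections. -/
def rowWeight (q n m' m : ℕ) : ℝ :=
  (q : ℝ) ^ (n * m') * ∏ i ∈ Ico m' m, ((q ^ n - q ^ i : ℕ) : ℝ)

theorem rowWeight_nonneg (q n m' m : ℕ) : 0 ≤ rowWeight q n m' m :=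
  mul_nonneg (by positivity) (prod_nonneg fun _ _ => Nat.cast_nonneg _)

/-- The telescoping relation behind the moments: the power of q on the right cancels the one
produced by `sum_stepWeight`. -/
theorem rowWeight_mul_surCount (q n : ℕ) {m' m : ℕ} (h : m' ≤ m) :
    rowWeight q n m' m * surCount q n m' = (q : ℝ) ^ (n * m') * surCount q n m := by
  rw [rowWeight, surCount, surCount, ← prod_range_mul_prod_Ico _ h]
  ring

theorem prod_columns_eq_prod_rows (q : ℕ) (κ : ℕ → ℕ) (τ : YoungDiagram) {K : ℕ}
    (hK : τ.colLen K = 0) :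
    ∏ i ∈ range (τ.colLen 0), (q : ℝ) ^ (∑ l ∈ range (τ.rowLen i - 1), κ l) *
        ((q ^ (κ (τ.rowLen i - 1)) - q ^ i : ℕ) : ℝ) =
      ∏ l ∈ range K, rowWeight q (κ l) (τ.colLen (l + 1)) (τ.colLen l) := by
  -- Each cell (i, l) of τ receives a factor: q^(κ l) if its right neighbour is also in τ, and q^(κ
  -- l) - q^i if it ends its row. The two sides multiply these factors row by row and column by
  -- column.
  let g (i l : ℕ) : ℝ :=
    if i < τ.colLen (l + 1) then (q : ℝ) ^ (κ l) else ((q ^ (κ l) - q ^ i : ℕ) : ℝ)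
  have h1 : ∀ i ∈ range (τ.colLen 0), (q : ℝ) ^ (∑ l ∈ range (τ.rowLen i - 1), κ l) *
        ((q ^ (κ (τ.rowLen i - 1)) - q ^ i : ℕ) : ℝ) = ∏ l ∈ range (τ.rowLen i), g i l := by
    intro i hi
    have hpos : 0 < τ.rowLen i := (lt_colLen_iff_lt_rowLen _ _ _).1 (mem_range.1 hi)
    obtain ⟨b, hb⟩ : ∃ b, τ.rowLen i = b + 1 := ⟨τ.rowLen i - 1, by omega⟩
    rw [hb, Nat.add_sub_cancel, prod_range_succ, ← prod_pow_eq_pow_sum]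
    congr 1
    · refine prod_congr rfl fun l hl => ?_
      have := mem_range.1 hl
      exact (if_pos ((lt_colLen_iff_lt_rowLen _ _ _).2 (by omega))).symm
    · refine (if_neg fun h => ?_).symm
      have := (lt_colLen_iff_lt_rowLen _ _ _).1 h
      omega
  have h2 : ∀ l ∈ range K, rowWeight q (κ l) (τ.colLen (l + 1)) (τ.colLen l) =
      ∏ i ∈ range (τ.colLen l), g i l := by
    intro l _
    rw [rowWeight, ← prod_range_mul_prod_Ico _ (τ.colLen_anti l (l + 1) (Nat.le_succ l))]
    congr 1
    · rw [pow_mul, ← card_range (τ.colLen (l + 1)), ← prod_const, card_range]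
      exact prod_congr rfl fun i hi => (if_pos (mem_range.1 hi)).symm
    · exact prod_congr rfl fun i hi => (if_neg (by have := (mem_Ico.1 hi).1; omega)).symm
  rw [prod_congr rfl h1, prod_congr rfl h2]
  refine prod_comm' fun i l => ?_
  simp only [mem_range]
  rw [← lt_colLen_iff_lt_rowLen]
  constructor
  · rintro ⟨_, h⟩
    refine ⟨h, ?_⟩
    by_contra hl
    have := τ.colLen_anti K l (not_lt.1 hl)
    omega
  · rintro ⟨h, _⟩
    have := τ.colLen_anti 0 l (Nat.zero_le _)
    exact ⟨by omega, h⟩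

theorem rowWeight_self {q : ℕ} (hq : 2 ≤ q) {m' m : ℕ} (h : m' ≤ m) :
    rowWeight q m m' m = (q : ℝ) ^ (m ^ 2) * eta q (m - m') := by
  have hq0 : (q : ℝ) ≠ 0 := by positivity
  obtain ⟨d, rfl⟩ := Nat.exists_eq_add_of_le h
  have h0 := rowWeight_mul_surCount q (m' + d) h
  have h1 := surCount_add hq m' d
  have h2 := surCount_add hq (m' + d) 0
  rw [add_zero, eta_zero, div_one] at h2
  rw [h1, h2] at h0
  rw [Nat.add_sub_cancel_left]
  have e1 := eta_ne_zero hq (m' + d)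
  have e2 := eta_ne_zero hq d
  have e3 : (q : ℝ) ^ ((m' + d) * m') * eta q (m' + d) ≠ 0 := mul_ne_zero (by positivity) e1
  apply mul_right_cancel₀ (div_ne_zero e3 e2)
  rw [h0]
  field_simp
  ring

end Young

/-! ### Orders of Hom, Sur and Aut for the modules of partitions. -/

section PartModule

variable {R : Type u} [CommRing R] [IsDomain R] [IsDiscreteValuationRing R]
  [Finite (ResidueField R)]

instance finite_partModule (κ : YoungDiagram) : Finite (partModule R κ) := Pi.finite

theorem card_partModule_hom (κ : YoungDiagram) (b : ℕ) :
    Nat.card (partModule R κ →ₗ[R] (R ⧸ maximalIdeal R ^ b)) =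
      Nat.card (ResidueField R) ^ (∑ l ∈ Finset.range b, κ.colLen l) := by
  rw [card_pi_hom, Fin.sum_univ_eq_sum_range (fun i => min (κ.rowLen i) b),
    sum_range_min_rowLen]

theorem card_range_homReduction_partModule (κ : YoungDiagram) (b : ℕ) :
    Nat.card (LinearMap.range (homReduction R (partModule R κ) b)) =
      Nat.card (ResidueField R) ^ (κ.colLen b) := by
  have h := card_range_homReduction_mul (R := R) (P := partModule R κ) b
  rw [card_partModule_hom, card_partModule_hom, Finset.sum_range_succ, pow_add _ _ (κ.colLen b),
    mul_comm] at h
  exact Nat.eq_of_mul_eq_mul_left (pow_pos (card_residueField_pos R) _) h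

theorem card_sur_pi_of_pos {P : Type*} [AddCommGroup P] [Module R P] [Finite P] {n : ℕ}
    {c : Fin n → ℕ} (hc : ∀ j, 0 < c j) (hanti : ∀ i j, i ≤ j → c j ≤ c i) :
    Nat.card {g : P →ₗ[R] ((j : Fin n) → R ⧸ maximalIdeal R ^ (c j)) //
        Function.Surjective g} =
      ∏ j, Nat.card (P →ₗ[R] (R ⧸ maximalIdeal R ^ (c j - 1))) *
        (Nat.card (LinearMap.range (homReduction R P (c j - 1))) -
          Nat.card (ResidueField R) ^ (j : ℕ)) := by
  obtain ⟨b, rfl⟩ : ∃ b : Fin n → ℕ, c = fun j => b j + 1 :=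
    ⟨fun j => c j - 1, funext fun j => by have := hc j; dsimp only; omega⟩
  exact card_sur_pi fun i j h => by have := hanti i j h; dsimp only at this; omega

/-- The number of surjections between two modules attached to partitions. -/
theorem card_sur_partModule (κ τ : YoungDiagram) {K : ℕ} (hK : τ.colLen K = 0) :
    (Nat.card (Sur R (partModule R κ) (partModule R τ)) : ℝ) =
      ∏ l ∈ Finset.range K,
        rowWeight (Nat.card (ResidueField R)) (κ.colLen l) (τ.colLen (l + 1)) (τ.colLen l) := by
  rw [← prod_columns_eq_prod_rows _ _ _ hK]
  refine (congrArg Nat.cast (card_sur_pi_of_pos (fun j => ?_)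
    (fun i j h => τ.rowLen_anti _ _ h))).trans ?_
  · exact (lt_colLen_iff_lt_rowLen _ _ _).1 j.2
  · rw [← Fin.prod_univ_eq_prod_range (fun i =>
      (Nat.card (ResidueField R) : ℝ) ^ (∑ l ∈ Finset.range (τ.rowLen i - 1), κ.colLen l) *
        ((Nat.card (ResidueField R) ^ (κ.colLen (τ.rowLen i - 1)) -
          Nat.card (ResidueField R) ^ i : ℕ) : ℝ)), Nat.cast_prod]
    refine Finset.prod_congr rfl fun j _ => ?_
    rw [card_partModule_hom, card_range_homReduction_partModule]
    rw [Nat.cast_mul, Nat.cast_pow]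

omit [IsDomain R] [IsDiscreteValuationRing R] [Finite (ResidueField R)] in
theorem card_sur_self (N : Type u) [AddCommGroup N] [Module R N] [Finite N] :
    Nat.card (Sur R N N) = Nat.card (N ≃ₗ[R] N) :=
  Nat.card_congr
    { toFun := fun g => LinearEquiv.ofBijective g.1
        ⟨Finite.injective_iff_surjective.2 g.2, g.2⟩
      invFun := fun e => ⟨e.toLinearMap, e.surjective⟩
      left_inv := fun g => rfl
      right_inv := fun e => by ext; rfl }

theorem card_aut_partModule (κ : YoungDiagram) {K : ℕ} (hK : κ.colLen K = 0) :
    (Nat.card (partModule R κ ≃ₗ[R] partModule R κ) : ℝ) =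
      ∏ l ∈ Finset.range K, (Nat.card (ResidueField R) : ℝ) ^ (κ.colLen l ^ 2) *
        eta (Nat.card (ResidueField R)) (κ.colLen l - κ.colLen (l + 1)) := by
  rw [← card_sur_self, card_sur_partModule κ κ hK]
  exact Finset.prod_congr rfl fun l _ =>
    rowWeight_self (two_le_card_residueField R) (κ.colLen_anti _ _ (Nat.le_succ l))

omit [Finite (ResidueField R)] in
theorem card_partModule (κ : YoungDiagram) {K : ℕ} (hK : κ.colLen K = 0) :
    Nat.card (partModule R κ) =
      Nat.card (ResidueField R) ^ (∑ l ∈ Finset.range K, κ.colLen l) := by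
  rw [Nat.card_pi, Finset.prod_congr rfl fun i _ => card_quotient_maximalIdeal_pow _,
    Finset.prod_pow_eq_pow_sum, Fin.sum_univ_eq_sum_range (fun i => κ.rowLen i),
    ← sum_range_min_rowLen]
  congr 1
  refine Finset.sum_congr rfl fun i _ => (min_eq_left ?_).symm
  exact (κ.rowLen_anti 0 i (Nat.zero_le _)).trans ((colLen_eq_zero_iff _ _).1 hK)

/-! ### Classification -/

-- The decomposition into prime power cyclic modules comes with unordered and possibly zero
-- exponents. Dropping the zeros and sorting turns it into a Young diagram.
omit [Finite (ResidueField R)] in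
theorem exists_partModule_equiv (N : Type u) [AddCommGroup N] [Module R N] [Finite N] :
    ∃ κ : YoungDiagram, Nonempty (N ≃ₗ[R] partModule R κ) := by
  classical
  obtain ⟨ϖ, hϖ⟩ := IsDiscreteValuationRing.exists_irreducible R
  -- By finiteness two powers of ϖ agree on x, say ϖ^m x = ϖ^n x with m < n. As 1 - ϖ^(n-m) is a
  -- unit, ϖ^m x = 0.
  have htors : Module.IsTorsion' N (Submonoid.powers ϖ) := by
    intro x
    have hfin : ¬ Function.Injective (fun n : ℕ => ϖ ^ n • x) := not_injective_infinite_finite _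
    simp only [Function.Injective, not_forall] at hfin
    obtain ⟨m, n, hmn, hne⟩ := hfin
    wlog h : m < n generalizing m n
    · exact this n m hmn.symm (Ne.symm hne) (lt_of_le_of_ne (not_lt.1 h) (Ne.symm hne))
    obtain ⟨d, rfl⟩ := Nat.exists_eq_add_of_lt h
    have hu : IsUnit (1 - ϖ ^ (d + 1)) := by
      apply IsLocalRing.isUnit_one_sub_self_of_mem_nonunits
      rw [← mem_maximalIdeal, hϖ.maximalIdeal_eq, Ideal.mem_span_singleton]
      exact dvd_pow_self _ (by simp)
    refine ⟨⟨ϖ ^ m, m, rfl⟩, ?_⟩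
    change ϖ ^ m • x = 0
    have h2 : (1 - ϖ ^ (d + 1)) • (ϖ ^ m • x) = 0 := by
      rw [sub_smul, one_smul, smul_smul, ← pow_add, sub_eq_zero]
      rw [hmn]
      congr 2; ring
    obtain ⟨v, hv⟩ := hu
    have h4 := congrArg (fun y => (↑v⁻¹ : R) • y) h2
    simpa [← hv, smul_smul] using h4
  obtain ⟨d, k, ⟨e⟩⟩ := Module.torsion_by_prime_power_decomposition hϖ htors
  let S := {i : Fin d // 0 < k i}
  let n := Fintype.card S
  let e0 : Fin n ≃ S := (Fintype.equivFin S).symm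
  let k' : Fin n → ℕᵒᵈ := fun j => OrderDual.toDual (k (e0 j).1)
  let σ : Fin n → S := e0 ∘ Tuple.sort k'
  have hσ : Function.Bijective σ := e0.bijective.comp (Tuple.sort k').bijective
  have hanti : Antitone fun j => k (σ j).1 := fun i j hij => Tuple.monotone_sort k' hij
  let w : List ℕ := List.ofFn fun j => k (σ j).1
  have hw : w.SortedGE := (List.sortedGE_ofFn_iff).2 hanti
  have hpos : ∀ x ∈ w, 0 < x := by
    intro x hx
    obtain ⟨j, rfl⟩ := (List.mem_ofFn' _ _).1 hx
    exact (σ j).2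
  let κ := YoungDiagram.ofRowLens w hw
  have hlen : κ.colLen 0 = n := by
    rw [← YoungDiagram.length_rowLens, YoungDiagram.rowLens_length_ofRowLens hpos,
      List.length_ofFn]
  have hrow (j : Fin n) : κ.rowLen j = k (σ j).1 := by
    have := YoungDiagram.rowLen_ofRowLens (hw := hw) ⟨j, by rw [List.length_ofFn]; exact j.2⟩
    rw [show κ.rowLen j = _ from this]
    simp [w]
  refine ⟨κ, ⟨?_⟩⟩
  have hI (i : Fin d) : Ideal.span {ϖ ^ k i} = maximalIdeal R ^ (k i) :=
    (maximalIdeal_pow_eq_span hϖ _).symm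
  let f : ((i : Fin d) → R ⧸ Ideal.span {ϖ ^ k i}) →ₗ[R] partModule R κ :=
    LinearMap.pi fun j => (Submodule.quotEquivOfEq (Ideal.span {ϖ ^ k (σ (Fin.cast hlen j)).1})
      (maximalIdeal R ^ (κ.rowLen j)) (by
        rw [hI, ← hrow]; rfl)).toLinearMap ∘ₗ LinearMap.proj _
  have hf : Function.Bijective f := by
    constructor
    · rw [injective_iff_map_eq_zero]
      intro x hx
      ext i
      by_cases hi : 0 < k i
      · obtain ⟨j, hj⟩ := hσ.2 ⟨i, hi⟩
        have h1 := congrFun hx (Fin.cast hlen.symm j)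
        have h2 : x (σ j).1 = 0 := by
          apply (Submodule.quotEquivOfEq (Ideal.span {ϖ ^ k (σ j).1})
            (maximalIdeal R ^ (κ.rowLen j)) (by rw [hI, ← hrow])).map_eq_zero_iff.1
          exact h1
        rw [hj] at h2
        exact h2
      · have : Subsingleton (R ⧸ Ideal.span {ϖ ^ k i}) := by
          rw [Submodule.Quotient.subsingleton_iff, show k i = 0 by omega, pow_zero,
            Ideal.span_singleton_one]
        exact Subsingleton.elim _ _
    · intro y
      -- Prescribing z through every j that σ sends to s avoids transporting elements along the
      -- inverse of σ.
      have hex (s : S) : ∃ z : R ⧸ Ideal.span {ϖ ^ k s.1}, ∀ j, ∀ h : σ (Fin.cast hlen j) = s,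
          (Submodule.quotEquivOfEq (Ideal.span {ϖ ^ k s.1}) (maximalIdeal R ^ (κ.rowLen j))
            (by rw [hI, ← h, ← hrow]; rfl)) z = y j := by
        obtain ⟨j, rfl⟩ := hσ.2 s
        refine ⟨(Submodule.quotEquivOfEq (Ideal.span {ϖ ^ k (σ j).1})
          (maximalIdeal R ^ (κ.rowLen j)) (by rw [hI, ← hrow])).symm (y (Fin.cast hlen.symm j)), ?_⟩
        intro j' h
        obtain rfl : j' = Fin.cast hlen.symm j := by
          have := hσ.1 h
          rw [← this]; rfl
        exact LinearEquiv.apply_symm_apply _ _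
      choose z hz using hex
      refine ⟨fun i => if h : 0 < k i then z ⟨i, h⟩ else 0, ?_⟩
      ext j
      have h1 := hz _ j rfl
      rw [← h1]
      simp only [f, LinearMap.pi_apply, LinearMap.comp_apply, LinearMap.proj_apply]
      rw [dif_pos (σ (Fin.cast hlen j)).2]
      rfl
  exact (e.trans (DirectSum.linearEquivFunOnFintype R (Fin d)
    fun i => R ⧸ Ideal.span {ϖ ^ k i})).trans (LinearEquiv.ofBijective f hf)

end PartModule


/-! ### Truncations of modules -/

section Truncation

open Finset

variable {R : Type u} [CommRing R] [IsDomain R] [IsDiscreteValuationRing R]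

theorem card_hom_congr {R X Y M : Type*} [CommRing R] [AddCommGroup X] [Module R X]
    [AddCommGroup Y] [Module R Y] [AddCommGroup M] [Module R M] (e : X ≃ₗ[R] Y) :
    Nat.card (X →ₗ[R] M) = Nat.card (Y →ₗ[R] M) :=
  Nat.card_congr (e.arrowCongr (LinearEquiv.refl R M)).toEquiv

theorem pow_smul_top_quotient (b k : ℕ) (h : b ≤ k) :
    maximalIdeal R ^ k • (⊤ : Submodule R (R ⧸ maximalIdeal R ^ b)) = ⊥ := by
  rw [eq_bot_iff, Submodule.smul_le]
  intro r hr x _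
  obtain ⟨y, rfl⟩ := Submodule.Quotient.mk_surjective _ x
  rw [Submodule.mem_bot, ← Submodule.Quotient.mk_smul, Submodule.Quotient.mk_eq_zero]
  exact Ideal.mul_mem_right _ _ (Ideal.pow_le_pow_right h hr)

theorem card_trunc_hom {X M : Type*} [AddCommGroup X] [Module R X] [AddCommGroup M] [Module R M]
    (k : ℕ) (hM : maximalIdeal R ^ k • (⊤ : Submodule R M) = ⊥) :
    Nat.card ((X ⧸ maximalIdeal R ^ k • (⊤ : Submodule R X)) →ₗ[R] M) =
      Nat.card (X →ₗ[R] M) := by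
  refine Nat.card_congr
    { toFun := fun f => f.comp (Submodule.mkQ _)
      invFun := fun f => Submodule.liftQ _ f ?_
      left_inv := fun f => by ext; rfl
      right_inv := fun f => by ext; rfl }
  refine Submodule.smul_le.2 fun r hr x _ => ?_
  have h : r • f x ∈ maximalIdeal R ^ k • (⊤ : Submodule R M) :=
    Submodule.smul_mem_smul hr trivial
  rwa [hM, Submodule.mem_bot, ← map_smul] at h

theorem smul_top_trunc (k : ℕ) (X : Type*) [AddCommGroup X] [Module R X] :
    maximalIdeal R ^ k •
      (⊤ : Submodule R (X ⧸ maximalIdeal R ^ k • (⊤ : Submodule R X))) = ⊥ := by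
  have h := Submodule.map_smul'' (maximalIdeal R ^ k) (⊤ : Submodule R X)
    (Submodule.mkQ (maximalIdeal R ^ k • (⊤ : Submodule R X)))
  rw [Submodule.map_top, Submodule.range_mkQ, Submodule.mkQ_map_self] at h
  exact h.symm

theorem pow_smul_top_partModule {κ : YoungDiagram} {k : ℕ} :
    maximalIdeal R ^ k • (⊤ : Submodule R (partModule R κ)) = ⊥ ↔ κ.colLen k = 0 := by
  rw [colLen_eq_zero_iff]
  constructor
  · intro h
    by_contra hk
    have hpos : 0 < κ.colLen 0 := (lt_colLen_iff_lt_rowLen _ _ _).2 (by omega)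
    have h1 : Submodule.map (LinearMap.proj (R := R)
        (φ := fun i : Fin (κ.colLen 0) => R ⧸ maximalIdeal R ^ (κ.rowLen i)) ⟨0, hpos⟩)
        (maximalIdeal R ^ k • ⊤) = ⊥ := by rw [h, Submodule.map_bot]
    rw [Submodule.map_smul'', Submodule.map_top, LinearMap.range_eq_top.2
      (LinearMap.proj_surjective _)] at h1
    have h2 : maximalIdeal R ^ k ≤ maximalIdeal R ^ (κ.rowLen 0) := by
      intro r hr
      have h3 : r • (Submodule.Quotient.mk 1 : R ⧸ maximalIdeal R ^ (κ.rowLen 0)) ∈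
          (⊥ : Submodule R (R ⧸ maximalIdeal R ^ (κ.rowLen 0))) :=
        h1 ▸ Submodule.smul_mem_smul hr trivial
      rw [Submodule.mem_bot, ← Submodule.Quotient.mk_smul, Submodule.Quotient.mk_eq_zero,
        smul_eq_mul, mul_one] at h3
      exact h3
    have h4 := Ideal.pow_right_strictAnti (maximalIdeal R)
      (IsDiscreteValuationRing.not_a_field R) (maximalIdeal.isMaximal R).ne_top (not_le.1 hk)
    exact absurd h2 (not_le_of_gt h4)
  · intro h
    rw [eq_bot_iff, Submodule.smul_le]
    intro r hr x _
    rw [Submodule.mem_bot]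
    ext i
    have h1 : r • x i ∈
        maximalIdeal R ^ k • (⊤ : Submodule R (R ⧸ maximalIdeal R ^ (κ.rowLen i))) :=
      Submodule.smul_mem_smul hr trivial
    rw [pow_smul_top_quotient _ _ ((κ.rowLen_anti 0 i (Nat.zero_le _)).trans h),
      Submodule.mem_bot] at h1
    exact h1

theorem smul_top_eq_bot_congr {R X Y : Type*} [CommRing R] [AddCommGroup X] [Module R X]
    [AddCommGroup Y] [Module R Y] (e : X ≃ₗ[R] Y) {I : Ideal R} (h : I • (⊤ : Submodule R X) = ⊥) :
    I • (⊤ : Submodule R Y) = ⊥ := by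
  have h1 := congrArg (Submodule.map e.toLinearMap) h
  rwa [Submodule.map_smul'', Submodule.map_top, LinearEquiv.range, Submodule.map_bot] at h1

variable [Finite (ResidueField R)]

theorem eq_of_sum_range_eq {f g : ℕ → ℕ} {k : ℕ}
    (h : ∀ b ≤ k, ∑ l ∈ range b, f l = ∑ l ∈ range b, g l) : ∀ l < k, f l = g l := by
  intro l hl
  have h1 := h (l + 1) hl
  rw [sum_range_succ, sum_range_succ, h l hl.le] at h1
  omega

/-- The orders of Hom into R/𝔪^b are powers of q whose exponents are the partial sums of the column
lengths, so they determine the columns. This is the source of uniqueness of types. -/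
theorem colLen_eq_of_card_hom {κ τ : YoungDiagram} {k : ℕ}
    (h : ∀ b ≤ k, Nat.card (partModule R κ →ₗ[R] (R ⧸ maximalIdeal R ^ b)) =
      Nat.card (partModule R τ →ₗ[R] (R ⧸ maximalIdeal R ^ b))) :
    ∀ l < k, κ.colLen l = τ.colLen l := by
  refine eq_of_sum_range_eq fun b hb => ?_
  have := h b hb
  rw [card_partModule_hom, card_partModule_hom] at this
  exact Nat.pow_right_injective (two_le_card_residueField R) this

theorem eq_of_partModule_equiv {κ τ : YoungDiagram}
    (e : partModule R κ ≃ₗ[R] partModule R τ) : κ = τ :=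
  youngDiagram_ext_colLen fun l =>
    colLen_eq_of_card_hom (R := R) (k := l + 1) (fun _ _ => card_hom_congr e) l (Nat.lt_succ_self l)

theorem finite_trunc (k : ℕ) (X : Type*) [AddCommGroup X] [Module R X] [Module.Finite R X] :
    Finite (X ⧸ maximalIdeal R ^ k • (⊤ : Submodule R X)) := by
  have : Module.Finite (R ⧸ maximalIdeal R ^ k)
      (X ⧸ maximalIdeal R ^ k • (⊤ : Submodule R X)) :=
    Module.Finite.of_restrictScalars_finite R _ _
  exact Module.finite_of_finite (R ⧸ maximalIdeal R ^ k)

theorem exists_trunc_equiv (k : ℕ) (X : Type u) [AddCommGroup X] [Module R X] [Module.Finite R X] :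
    ∃ κ : YoungDiagram, κ.colLen k = 0 ∧ Nonempty (Trunc R k X ≃ₗ[R] partModule R κ) := by
  have := finite_trunc (R := R) k X
  obtain ⟨κ, ⟨e⟩⟩ := exists_partModule_equiv (R := R) (Trunc R k X)
  exact ⟨κ, pow_smul_top_partModule.1 (smul_top_eq_bot_congr e (smul_top_trunc k X)), ⟨e⟩⟩

/-- Maps into R/𝔪^b with b ≤ k factor through the truncation, and a diagram with at most k columns
is determined by the orders of these Hom groups. Membership in a level set thus becomes numerical.
-/
theorem nonempty_trunc_equiv_iff (k : ℕ) (X : Type u) [AddCommGroup X] [Module R X]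
    [Module.Finite R X] {τ : YoungDiagram} (hτ : τ.colLen k = 0) :
    Nonempty (Trunc R k X ≃ₗ[R] partModule R τ) ↔
      ∀ b ≤ k, Nat.card (X →ₗ[R] (R ⧸ maximalIdeal R ^ b)) =
        Nat.card (partModule R τ →ₗ[R] (R ⧸ maximalIdeal R ^ b)) := by
  constructor
  · rintro ⟨e⟩ b hb
    rw [← card_hom_congr e, card_trunc_hom k (pow_smul_top_quotient b k hb)]
  · intro h
    obtain ⟨κ, hκ, ⟨e⟩⟩ := exists_trunc_equiv (R := R) k X
    suffices hκτ : κ = τ by subst hκτ; exact ⟨e⟩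
    have h1 := colLen_eq_of_card_hom (R := R) (κ := κ) (τ := τ) (k := k) (fun b hb => by
      rw [← h b hb, ← card_hom_congr e, card_trunc_hom k (pow_smul_top_quotient b k hb)])
    refine youngDiagram_ext_colLen fun l => ?_
    rcases lt_or_ge l k with hl | hl
    · exact h1 l hl
    · have := κ.colLen_anti k l hl
      have := τ.colLen_anti k l hl
      omega

theorem nonempty_trunc_partModule_equiv_iff (k : ℕ) {κ τ : YoungDiagram} (hτ : τ.colLen k = 0) :
    Nonempty (Trunc R k (partModule R κ) ≃ₗ[R] partModule R τ) ↔
      ∀ l < k, κ.colLen l = τ.colLen l := by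
  rw [nonempty_trunc_equiv_iff k _ hτ]
  refine ⟨colLen_eq_of_card_hom, fun h b hb => ?_⟩
  rw [card_partModule_hom, card_partModule_hom]
  congr 1
  exact sum_congr rfl fun l hl => h l ((mem_range.1 hl).trans_le hb)

/-! ### Points and level sets in the space of isomorphism classes -/

/-- The isomorphism class of the module of type `κ`. -/
def partClass (R : Type u) [CommRing R] [IsLocalRing R] (κ : YoungDiagram) : FGIsoClass R :=
  FGIsoClass.mk R (partModule R κ)

theorem FGIsoClass.mk_eq_iff {R : Type u} [CommRing R] {X : FGIsoClass R} {N : Type u}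
    [AddCommGroup N] [Module R N] [Module.Finite R N] :
    X = FGIsoClass.mk R N ↔ Nonempty (X.rep ≃ₗ[R] N) := by
  constructor
  · rintro rfl
    exact FGIsoClass.nonempty_rep_mk_equiv R N
  · rintro ⟨e⟩
    rw [← Quotient.out_eq X]
    exact Quotient.sound (s := isoSetoid R) ⟨e⟩

omit [Finite (ResidueField R)] in
theorem eq_partClass_iff {X : FGIsoClass R} {κ : YoungDiagram} :
    X = partClass R κ ↔ Nonempty (X.rep ≃ₗ[R] partModule R κ) :=
  FGIsoClass.mk_eq_iff

theorem partClass_rep_equiv (R : Type u) [CommRing R] [IsLocalRing R] (κ : YoungDiagram) :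
    Nonempty ((partClass R κ).rep ≃ₗ[R] partModule R κ) :=
  FGIsoClass.nonempty_rep_mk_equiv R _

theorem partClass_injective : Function.Injective (partClass R) := by
  intro κ τ h
  obtain ⟨e⟩ := partClass_rep_equiv R κ
  obtain ⟨e'⟩ := eq_partClass_iff.1 h
  exact eq_of_partModule_equiv (e.symm.trans e')

theorem finite_rep_iff {X : FGIsoClass R} : Finite X.rep ↔ ∃ κ, X = partClass R κ := by
  constructor
  · intro h
    obtain ⟨κ, e⟩ := exists_partModule_equiv (R := R) X.rep
    exact ⟨κ, eq_partClass_iff.2 e⟩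
  · rintro ⟨κ, h⟩
    obtain ⟨e⟩ := eq_partClass_iff.1 h
    exact Finite.of_equiv _ e.symm.toEquiv

theorem mem_levelSet_iff {k : ℕ} {X : FGIsoClass R} {τ : YoungDiagram} (hτ : τ.colLen k = 0) :
    X ∈ levelSet R k (partModule R τ) ↔
      ∀ b ≤ k, Nat.card (X.rep →ₗ[R] (R ⧸ maximalIdeal R ^ b)) =
        Nat.card (partModule R τ →ₗ[R] (R ⧸ maximalIdeal R ^ b)) :=
  nonempty_trunc_equiv_iff k X.rep hτ

theorem partClass_mem_levelSet_iff {k : ℕ} {κ τ : YoungDiagram} (hτ : τ.colLen k = 0) :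
    partClass R κ ∈ levelSet R k (partModule R τ) ↔ ∀ l < k, κ.colLen l = τ.colLen l := by
  obtain ⟨e⟩ := partClass_rep_equiv R κ
  rw [mem_levelSet_iff hτ, ← nonempty_trunc_partModule_equiv_iff (R := R) k hτ,
    nonempty_trunc_equiv_iff k _ hτ]
  simp only [card_hom_congr e]

theorem exists_mem_levelSet (k : ℕ) (X : FGIsoClass R) :
    ∃ τ : YoungDiagram, τ.colLen k = 0 ∧ X ∈ levelSet R k (partModule R τ) :=
  exists_trunc_equiv k X.rep

theorem isFiniteOfLevel_partClass_iff {k : ℕ} {κ : YoungDiagram} :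
    IsFiniteOfLevel R k (partClass R κ).rep ↔ κ.colLen k = 0 := by
  obtain ⟨e⟩ := partClass_rep_equiv R κ
  rw [← pow_smul_top_partModule (R := R)]
  exact ⟨fun h => smul_top_eq_bot_congr e h.2,
    fun h => ⟨Finite.of_equiv _ e.symm.toEquiv, smul_top_eq_bot_congr e.symm h⟩⟩

theorem levelSet_congr {R : Type u} [CommRing R] [IsLocalRing R] {k : ℕ} {N N' : Type u}
    [AddCommGroup N] [Module R N] [AddCommGroup N'] [Module R N'] (e : N ≃ₗ[R] N') :
    levelSet R k N = levelSet R k N' := by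
  ext X
  exact ⟨fun ⟨f⟩ => ⟨f.trans e⟩, fun ⟨f⟩ => ⟨f.trans e.symm⟩⟩

theorem isOpen_levelSet {k : ℕ} {τ : YoungDiagram} (hτ : τ.colLen k = 0) :
    IsOpen (levelSet R k (partModule R τ)) := by
  obtain ⟨e⟩ := partClass_rep_equiv R τ
  exact TopologicalSpace.isOpen_generateFrom_of_mem
    ⟨k, partClass R τ, isFiniteOfLevel_partClass_iff.2 hτ, (levelSet_congr e).symm⟩

theorem measurableSet_levelSet {k : ℕ} {τ : YoungDiagram} (hτ : τ.colLen k = 0) :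
    MeasurableSet (levelSet R k (partModule R τ)) :=
  (isOpen_levelSet hτ).measurableSet

-- If 𝔪^k kills X/𝔪^(k+1)X, then 𝔪^k X ≤ 𝔪 · 𝔪^k X. Nakayama's lemma gives 𝔪^k X = 0, so truncation
-- loses nothing.
omit [Finite (ResidueField R)] in
theorem nonempty_equiv_of_trunc_equiv {X N : Type u} [AddCommGroup X] [Module R X]
    [Module.Finite R X] [AddCommGroup N] [Module R N] {k : ℕ} (e : Trunc R (k + 1) X ≃ₗ[R] N)
    (hN : maximalIdeal R ^ k • (⊤ : Submodule R N) = ⊥) : Nonempty (X ≃ₗ[R] N) := by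
  have h1 : maximalIdeal R ^ k • (⊤ : Submodule R (Trunc R (k + 1) X)) = ⊥ :=
    smul_top_eq_bot_congr e.symm hN
  have h2 := Submodule.map_smul'' (maximalIdeal R ^ k) (⊤ : Submodule R X)
    (Submodule.mkQ (maximalIdeal R ^ (k + 1) • (⊤ : Submodule R X)))
  rw [Submodule.map_top, Submodule.range_mkQ, h1, ← LinearMap.le_ker_iff_map,
    Submodule.ker_mkQ, pow_succ', Submodule.mul_smul] at h2
  have hfg : (maximalIdeal R ^ k • (⊤ : Submodule R X)).FG := IsNoetherian.noetherian _
  have h3 := Submodule.eq_bot_of_le_smul_of_le_jacobson_bot (maximalIdeal R) _ hfg h2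
    (IsLocalRing.maximalIdeal_le_jacobson _)
  have h4 : maximalIdeal R ^ (k + 1) • (⊤ : Submodule R X) = ⊥ := by
    rw [pow_succ', Submodule.mul_smul, h3, Submodule.smul_bot]
  exact ⟨(Submodule.quotEquivOfEqBot _ h4).symm.trans e⟩

/-- A finite module with `𝔪 ^ (k - 1) N = 0` is determined by its truncation at level `k`. -/
theorem levelSet_eq_singleton {k : ℕ} {τ : YoungDiagram} (hτ : τ.colLen k = 0) :
    levelSet R (k + 1) (partModule R τ) = {partClass R τ} := by
  have hτ' : τ.colLen (k + 1) = 0 := by have := τ.colLen_anti k (k + 1) (Nat.le_succ k); omega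
  ext X
  rw [Set.mem_singleton_iff]
  constructor
  · rintro ⟨e⟩
    exact eq_partClass_iff.2 (nonempty_equiv_of_trunc_equiv e (pow_smul_top_partModule.2 hτ))
  · rintro rfl
    exact (partClass_mem_levelSet_iff hτ').2 fun _ _ => rfl

theorem exists_colLen_eq_zero (κ : YoungDiagram) : ∃ k, κ.colLen k = 0 :=
  ⟨κ.rowLen 0, (colLen_eq_zero_iff _ _).2 le_rfl⟩

theorem measurableSet_singleton_partClass (κ : YoungDiagram) :
    MeasurableSet {partClass R κ} := by
  obtain ⟨k, hk⟩ := exists_colLen_eq_zero κ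
  rw [← levelSet_eq_singleton hk]
  exact measurableSet_levelSet (by have := κ.colLen_anti k (k + 1) (Nat.le_succ k); omega)

/-! ### Countability of types and measurability. -/

instance : Countable YoungDiagram :=
  Function.Injective.countable (f := YoungDiagram.cells) fun _ _ h => YoungDiagram.ext h

theorem finite_classes_eq : {X : FGIsoClass R | Finite X.rep} = Set.range (partClass R) := by
  ext X
  rw [Set.mem_ofPred_eq, finite_rep_iff]
  exact ⟨fun ⟨κ, h⟩ => ⟨κ, h.symm⟩, fun ⟨κ, h⟩ => ⟨κ, h.symm⟩⟩

theorem measurableSet_finite_classes : MeasurableSet {X : FGIsoClass R | Finite X.rep} := by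
  rw [finite_classes_eq, ← Set.iUnion_singleton_eq_range]
  exact MeasurableSet.iUnion fun κ => measurableSet_singleton_partClass κ

/-- A function which only depends on truncations at one level is measurable. -/
theorem measurable_of_levelSet {α : Type*} [MeasurableSpace α] {f : FGIsoClass R → α} (k : ℕ)
    (hf : ∀ (τ : YoungDiagram) (X Y : FGIsoClass R), τ.colLen k = 0 →
      X ∈ levelSet R k (partModule R τ) → Y ∈ levelSet R k (partModule R τ) → f X = f Y) :
    Measurable f := by
  intro S _
  have h : f ⁻¹' S = ⋃ τ : {τ : YoungDiagram // τ.colLen k = 0 ∧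
      ∃ X ∈ levelSet R k (partModule R τ), f X ∈ S}, levelSet R k (partModule R τ.1) := by
    ext X
    rw [Set.mem_iUnion]
    constructor
    · intro hX
      obtain ⟨τ, hτ, hXτ⟩ := exists_mem_levelSet k X
      exact ⟨⟨τ, hτ, X, hXτ, hX⟩, hXτ⟩
    · rintro ⟨⟨τ, hτ, Y, hY, hYS⟩, hX⟩
      rw [Set.mem_preimage, hf τ X Y hτ hX hY]
      exact hYS
  rw [h]
  exact MeasurableSet.iUnion fun τ => measurableSet_levelSet τ.2.1

end Truncation


/-! ### The distribution of the row lengths -/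

section Weights

open Finset Classical

variable {q : ℕ} {r : ℕ∞} {s ε : ℝ}

/-- The weight of the step from row `j - 1` of length `n` to row `j` of length `m`. -/
def stepWeight (q : ℕ) (r : ℕ∞) (s ε : ℝ) (j n m : ℕ) : ℝ :=
  -- Rows are counted from zero, so row j here is part j + 1 of the partition.
  if ((j + 1 : ℕ) : ℕ∞) ≤ r then torsionStep q (s - ε) n m else freeStep q ((q : ℝ) ^ (-s)) n m

/-- The contribution of row `j` of length `m` to the moment. -/
def rowMoment (q : ℕ) (r : ℕ∞) (s ε : ℝ) (j m : ℕ) : ℝ :=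
  if ((j + 1 : ℕ) : ℕ∞) ≤ r then
    (q : ℝ) ^ (m.choose 2) * ((q : ℝ) * (q : ℝ) ^ (-(s - ε + 1))) ^ m
  else ((q : ℝ) ^ (-s)) ^ m

/-- The probability that the rows `0, …, k` have lengths `l 0, …, l k`. -/
def levelWeight (q : ℕ) (r : ℕ∞) (s ε : ℝ) (k : ℕ) (l : ℕ → ℕ) : ℝ :=
  firstWeight q (s - ε) (l 0) * ∏ j ∈ range k, stepWeight q r s ε (j + 1) (l j) (l (j + 1))

theorem rpow_neg_le_one (hq : 2 ≤ q) (hs : 0 ≤ s) : (q : ℝ) ^ (-s) ≤ 1 :=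
  Real.rpow_le_one_of_one_le_of_nonpos (by exact_mod_cast (by omega : 1 ≤ q)) (by linarith)

theorem mul_rpow_neg_add_one (hq : 2 ≤ q) (t : ℝ) :
    (q : ℝ) * (q : ℝ) ^ (-(t + 1)) = (q : ℝ) ^ (-t) := by
  have hq0 : (0 : ℝ) < q := by positivity
  conv_lhs => rw [← Real.rpow_one (q : ℝ), ← Real.rpow_mul hq0.le, one_mul]
  rw [← Real.rpow_add hq0]; congr 1; ring

theorem torsionStep_nonneg (hq : 2 ≤ q) {t : ℝ} (ht : 0 ≤ t) (n m : ℕ) :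
    0 ≤ torsionStep q t n m := by
  have := (Pf_pos hq ht (n - m)).le
  have := (eta_pos hq n).le
  have := (eta_pos hq m).le
  have := (eta_pos hq (n - m)).le
  unfold torsionStep; positivity

theorem freeStep_nonneg (hq : 2 ≤ q) {v : ℝ} (hv : 0 ≤ v) (hv1 : v ≤ 1) (n m : ℕ) :
    0 ≤ freeStep q v n m := by
  have := (eta_pos hq n).le
  have := (eta_pos hq m).le
  have := (eta_pos hq (n - m)).le
  have : 0 ≤ ∏ i ∈ Ico m n, (1 - v * ((q : ℝ)⁻¹) ^ (i + 1)) := by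
    refine prod_nonneg fun i _ => sub_nonneg.2 ?_
    have := (inv_natCast_pow_lt_one hq i).le
    exact mul_le_one₀ hv1 (by positivity) this
  unfold freeStep; positivity

theorem stepWeight_nonneg (hq : 2 ≤ q) (hs : 0 ≤ s) (hsε : 0 ≤ s - ε) (j n m : ℕ) :
    0 ≤ stepWeight q r s ε j n m := by
  unfold stepWeight
  split_ifs
  · exact torsionStep_nonneg hq hsε n m
  · exact freeStep_nonneg hq (by positivity) (rpow_neg_le_one hq hs) n m

theorem firstWeight_nonneg (hq : 2 ≤ q) {t : ℝ} (ht : 0 ≤ t) (m : ℕ) : 0 ≤ firstWeight q t m := by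
  have := (tprod_inv_one_add_pos hq (u := (q : ℝ) ^ (-(t + 1))) (by positivity)
    (rpow_neg_add_one_lt_one hq ht)).le
  have := (eta_pos hq m).le
  unfold firstWeight; positivity

theorem levelWeight_nonneg (hq : 2 ≤ q) (hs : 0 ≤ s) (hsε : 0 ≤ s - ε) (k : ℕ) (l : ℕ → ℕ) :
    0 ≤ levelWeight q r s ε k l :=
  mul_nonneg (firstWeight_nonneg hq hsε _) (prod_nonneg fun _ _ => stepWeight_nonneg hq hs hsε _ _ _)

theorem rowMoment_nonneg (j m : ℕ) : 0 ≤ rowMoment q r s ε j m := by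
  unfold rowMoment; split_ifs <;> positivity

@[simp] theorem rowMoment_zero (j : ℕ) : rowMoment q r s ε j 0 = 1 := by simp [rowMoment]

/-- With the factor q^(-n) of `sum_stepWeight` at μ = 1, this makes q^(λ_j) - 1 contract along the
chain. -/
theorem rowMoment_one_le (hq : 2 ≤ q) (hs : 0 ≤ s) (hsε : 0 ≤ s - ε) (j : ℕ) :
    rowMoment q r s ε j 1 ≤ 1 := by
  unfold rowMoment
  split_ifs
  · rw [mul_rpow_neg_add_one hq]
    simpa using rpow_neg_le_one hq hsε
  · simpa using rpow_neg_le_one hq hs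

theorem stepWeight_zero_zero (j : ℕ) : stepWeight q r s ε j 0 0 = 1 := by
  unfold stepWeight
  split_ifs
  · simp [torsionStep, Pf]
  · simp [freeStep]

theorem sum_stepWeight (hq : 2 ≤ q) (j n μ : ℕ) :
    ∑ m ∈ range (n + 1), stepWeight q r s ε j n m * surCount q m μ =
      rowMoment q r s ε j μ * ((q : ℝ)⁻¹) ^ (n * μ) * surCount q n μ := by
  unfold stepWeight rowMoment
  split_ifs
  · exact sum_torsionStep hq _ n μ
  · exact sum_freeStep hq _ n μ

theorem hasSum_firstWeight_rowMoment (hq : 2 ≤ q) (hsε : 0 ≤ s - ε) (hr : 1 ≤ r) (μ : ℕ) :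
    HasSum (fun m => firstWeight q (s - ε) m * surCount q m μ) (rowMoment q r s ε 0 μ) := by
  rw [rowMoment, if_pos (by simpa using hr)]
  exact hasSum_firstWeight hq hsε μ

theorem levelWeight_update (k m : ℕ) (l : ℕ → ℕ) :
    levelWeight q r s ε (k + 1) (Function.update l (k + 1) m) =
      levelWeight q r s ε k l * stepWeight q r s ε (k + 1) (l k) m := by
  unfold levelWeight
  rw [prod_range_succ, Function.update_self, Function.update_of_ne (by omega),
    Function.update_of_ne (by omega), ← mul_assoc]
  congr 2
  refine prod_congr rfl fun j hj => ?_
  have := mem_range.1 hj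
  rw [Function.update_of_ne (by omega), Function.update_of_ne (by omega)]

theorem levelWeight_congr {k : ℕ} {l l' : ℕ → ℕ} (h : ∀ j < k + 1, l j = l' j) :
    levelWeight q r s ε k l = levelWeight q r s ε k l' := by
  unfold levelWeight
  rw [h 0 (by omega)]
  congr 1
  refine prod_congr rfl fun j hj => ?_
  have := mem_range.1 hj
  rw [h j (by omega), h (j + 1) (by omega)]

/-- The weight of a partition, given by the lengths of the columns of a Young diagram. -/
def pointWeight (q : ℕ) (r : ℕ∞) (s ε : ℝ) (κ : YoungDiagram) : ℝ :=
  levelWeight q r s ε (κ.rowLen 0) κ.colLen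

/-- Once the chain is at 0 each further step has weight one, so the weight no longer depends on the
level. -/
theorem levelWeight_eq_pointWeight {κ : YoungDiagram} {k : ℕ} (hk : κ.colLen k = 0) :
    levelWeight q r s ε k κ.colLen = pointWeight q r s ε κ := by
  have h0 := (colLen_eq_zero_iff _ _).1 hk
  obtain ⟨d, rfl⟩ := Nat.exists_eq_add_of_le h0
  rw [pointWeight, levelWeight, prod_range_add, levelWeight, ← mul_assoc]
  rw [prod_eq_one (s := range d), mul_one]
  intro j _
  rw [(colLen_eq_zero_iff _ _).2 (by omega : κ.rowLen 0 ≤ κ.rowLen 0 + j),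
    (colLen_eq_zero_iff _ _).2 (by omega : κ.rowLen 0 ≤ κ.rowLen 0 + j + 1),
    stepWeight_zero_zero]

/-! ### Sums over partitions with prescribed first rows -/

/-- The diagrams whose first `k` columns have the given lengths. -/
def Agree (k : ℕ) (l : ℕ → ℕ) (κ : YoungDiagram) : Prop := ∀ j < k, κ.colLen j = l j

theorem agree_update_iff {k m : ℕ} {l : ℕ → ℕ} {κ : YoungDiagram} :
    Agree (k + 1) (Function.update l k m) κ ↔ Agree k l κ ∧ κ.colLen k = m := by
  constructor
  · intro h
    refine ⟨fun j hj => ?_, ?_⟩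
    · rw [h j (by omega), Function.update_of_ne hj.ne]
    · rw [h k (by omega), Function.update_self]
  · rintro ⟨h, rfl⟩ j hj
    rcases Nat.lt_succ_iff_lt_or_eq.1 hj with hj | rfl
    · rw [h j hj, Function.update_of_ne hj.ne]
    · rw [Function.update_self]

theorem ite_agree_eq_tsum (k : ℕ) (l : ℕ → ℕ) (κ : YoungDiagram) (x : ℝ≥0∞) :
    (if Agree k l κ then x else 0) =
      ∑' m, if Agree (k + 1) (Function.update l k m) κ then x else 0 := by
  simp only [agree_update_iff]
  rw [tsum_eq_single (κ.colLen k) (fun m hm => if_neg fun h => hm h.2.symm)]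
  simp

theorem ite_agree_eq_sum (k : ℕ) (l : ℕ → ℕ) (κ : YoungDiagram) (x : ℝ≥0∞) :
    (if Agree (k + 1) l κ then x else 0) =
      ∑ m ∈ range (l k + 1),
        if Agree (k + 2) (Function.update l (k + 1) m) κ then x else 0 := by
  rw [ite_agree_eq_tsum, tsum_eq_sum]
  intro m hm
  refine if_neg fun h => ?_
  rw [agree_update_iff] at h
  have h1 := h.1 k (by omega)
  have h2 := κ.colLen_anti k (k + 1) (by omega)
  rw [mem_range] at hm
  omega

/-- The sum of `g` over all diagrams whose first `k` columns have the given lengths. -/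
def fiberSum (g : YoungDiagram → ℝ≥0∞) (k : ℕ) (l : ℕ → ℕ) : ℝ≥0∞ :=
  ∑' κ, if Agree k l κ then g κ else 0

theorem fiberSum_eq_tsum (g : YoungDiagram → ℝ≥0∞) (k : ℕ) (l : ℕ → ℕ) :
    fiberSum g k l = ∑' m, fiberSum g (k + 1) (Function.update l k m) := by
  unfold fiberSum
  rw [ENNReal.tsum_comm]
  exact tsum_congr fun κ => ite_agree_eq_tsum k l κ _

theorem fiberSum_eq_sum (g : YoungDiagram → ℝ≥0∞) (k : ℕ) (l : ℕ → ℕ) :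
    fiberSum g (k + 1) l =
      ∑ m ∈ range (l k + 1), fiberSum g (k + 2) (Function.update l (k + 1) m) := by
  unfold fiberSum
  rw [← Summable.tsum_finsetSum fun _ _ => ENNReal.summable]
  exact tsum_congr fun κ => ite_agree_eq_sum k l κ _

/-- The diagram with column lengths `l 0 ≥ … ≥ l k`. -/
def diagramOfCols (l : ℕ → ℕ) (k : ℕ) (h : ∀ j < k, l (j + 1) ≤ l j) : YoungDiagram where
  cells := (range (l 0) ×ˢ range (k + 1)).filter fun c => c.1 < l c.2
  isLowerSet := by
    have hanti : ∀ j i, i ≤ j → j ≤ k → l j ≤ l i := by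
      intro j
      induction j with
      | zero => intro i hi _; rw [Nat.le_zero.1 hi]
      | succ j ih =>
        intro i hi hj
        rcases Nat.lt_or_ge i (j + 1) with h1 | h1
        · exact (h j (by omega)).trans (ih i (by omega) (by omega))
        · rw [show i = j + 1 by omega]
    rintro ⟨a, b⟩ ⟨a', b'⟩ ⟨h1, h2⟩ hab
    simp only [coe_filter, mem_product, mem_range, Set.mem_ofPred_eq] at hab ⊢
    have h3 := hanti b b' h2 (by omega)
    dsimp only at h1 h2
    have h4 := hanti b' 0 (Nat.zero_le _) (by omega)
    omega

theorem colLen_diagramOfCols {l : ℕ → ℕ} {k : ℕ} (h : ∀ j < k, l (j + 1) ≤ l j) {j : ℕ}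
    (hj : j < k + 1) : (diagramOfCols l k h).colLen j = l j := by
  have hanti : l j ≤ l 0 := by
    induction j with
    | zero => rfl
    | succ j ih => exact (h j (by omega)).trans (ih (by omega))
  have key (i : ℕ) : i < (diagramOfCols l k h).colLen j ↔ i < l j := by
    rw [← YoungDiagram.mem_iff_lt_colLen, ← YoungDiagram.mem_cells, diagramOfCols]
    simp only [mem_filter, mem_product, mem_range]
    omega
  have h1 := key (l j)
  have h2 := key ((diagramOfCols l k h).colLen j)
  omega

theorem valid_update {k m : ℕ} {l : ℕ → ℕ} (h : ∀ j < k, l (j + 1) ≤ l j) (hm : m ≤ l k) :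
    ∀ j < k + 1, Function.update l (k + 1) m (j + 1) ≤ Function.update l (k + 1) m j := by
  intro j hj
  rcases Nat.lt_succ_iff_lt_or_eq.1 hj with hj | rfl
  · rw [Function.update_of_ne (by omega), Function.update_of_ne (by omega)]
    exact h j hj
  · rw [Function.update_self, Function.update_of_ne (by omega)]
    exact hm

/-- The case μ = 0 of the kernel identity: the weights at consecutive levels are consistent. -/
theorem sum_levelWeight_update (hq : 2 ≤ q) (k : ℕ) (l : ℕ → ℕ) :
    ∑ m ∈ range (l k + 1), levelWeight q r s ε (k + 1) (Function.update l (k + 1) m) =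
      levelWeight q r s ε k l := by
  have h := sum_stepWeight (r := r) (s := s) (ε := ε) hq (k + 1) (l k) 0
  simp only [surCount_zero, mul_one, rowMoment_zero, mul_zero, pow_zero] at h
  simp only [levelWeight_update]
  rw [← mul_sum, h, mul_one]

/-- A finite set of diagrams has bounded width, and the induction runs over the number n of columns
still free. For n = 0 at most one diagram in the set agrees with l; otherwise both sides are split
along the next column. -/
theorem sum_pointWeight_le (hq : 2 ≤ q) (hs : 0 ≤ s) (hsε : 0 ≤ s - ε) (n : ℕ) :
    ∀ (k : ℕ) (l : ℕ → ℕ) (S : Finset YoungDiagram), (∀ κ ∈ S, κ.colLen (k + n) = 0) →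
      ∑ κ ∈ S, (if Agree (k + 1) l κ then ENNReal.ofReal (pointWeight q r s ε κ) else 0) ≤
        ENNReal.ofReal (levelWeight q r s ε k l) := by
  induction n with
  | zero =>
    intro k l S hS
    by_cases hex : ∃ κ ∈ S, Agree (k + 1) l κ
    · obtain ⟨κ, hκS, hκ⟩ := hex
      rw [sum_eq_single_of_mem κ hκS, if_pos hκ, levelWeight_congr fun j hj => (hκ j hj).symm,
        levelWeight_eq_pointWeight (by simpa using hS κ hκS)]
      intro τ hτ hne
      refine if_neg fun h => hne (youngDiagram_ext_colLen fun j => ?_)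
      rcases Nat.lt_or_ge j (k + 1) with hj | hj
      · rw [h j hj, hκ j hj]
      · have h1 := hS τ hτ
        have h2 := hS κ hκS
        have := τ.colLen_anti k j (by omega)
        have := κ.colLen_anti k j (by omega)
        simp only [add_zero] at h1 h2
        omega
    · push Not at hex
      rw [sum_eq_zero fun κ hκ => if_neg (hex κ hκ)]
      exact zero_le
  | succ n ih =>
    intro k l S hS
    rw [sum_congr rfl fun κ _ => ite_agree_eq_sum k l κ _, sum_comm,
      ← sum_levelWeight_update hq k l,
      ENNReal.ofReal_sum_of_nonneg fun m _ => levelWeight_nonneg hq hs hsε _ _]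
    exact sum_le_sum fun m _ => ih (k + 1) _ S fun κ hκ => by
      rw [← hS κ hκ]; congr 1; omega

/-- The last term bounds the mass that has not died out after n more steps. For n = 0 either l k =
0, and the diagram with these columns carries all the mass, or q^(l k) - 1 ≥ 1. Each further step
gains a factor 1/q by the case μ = 1 of the kernel identity. -/
theorem levelWeight_le_fiberSum (hq : 2 ≤ q) (hs : 0 ≤ s) (hsε : 0 ≤ s - ε) (n : ℕ) :
    ∀ (k : ℕ) (l : ℕ → ℕ), (∀ j < k, l (j + 1) ≤ l j) →
      ENNReal.ofReal (levelWeight q r s ε k l) ≤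
        fiberSum (fun κ => ENNReal.ofReal (pointWeight q r s ε κ)) (k + 1) l +
        ENNReal.ofReal (levelWeight q r s ε k l * ((q : ℝ)⁻¹) ^ n * surCount q (l k) 1) := by
  have ha := inv_natCast_pos hq
  induction n with
  | zero =>
    intro k l hl
    rcases Nat.eq_zero_or_pos (l k) with h0 | h0
    · refine le_add_right ?_
      have hcol : Agree (k + 1) l (diagramOfCols l k hl) := fun j hj => colLen_diagramOfCols hl hj
      have h1 : (diagramOfCols l k hl).colLen k = 0 := by rw [hcol k (by omega), h0]
      have h2 := ENNReal.le_tsum (f := fun κ => if Agree (k + 1) l κ then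
        ENNReal.ofReal (pointWeight q r s ε κ) else 0) (diagramOfCols l k hl)
      rw [if_pos hcol, ← levelWeight_eq_pointWeight h1, levelWeight_congr hcol] at h2
      exact h2
    · refine le_add_left (ENNReal.ofReal_le_ofReal ?_)
      have h1 : (2 : ℝ) ≤ (q : ℝ) ^ l k := by
        have h3 : 2 ≤ q ^ l k := hq.trans (Nat.le_self_pow h0.ne' q)
        exact_mod_cast h3
      have h2 : 1 ≤ surCount q (l k) 1 := by
        rw [surCount, prod_range_one, Nat.cast_sub (Nat.pow_le_pow_right (by omega) (by omega))]
        push_cast; linarith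
      rw [pow_zero, mul_one]
      exact le_mul_of_one_le_right (levelWeight_nonneg hq hs hsε _ _) h2
  | succ n ih =>
    intro k l hl
    have hnn (m : ℕ) : 0 ≤ levelWeight q r s ε (k + 1) (Function.update l (k + 1) m) *
        ((q : ℝ)⁻¹) ^ n * surCount q m 1 :=
      mul_nonneg (mul_nonneg (levelWeight_nonneg hq hs hsε _ _) (by positivity))
        (surCount_nonneg _ _ _)
    rw [fiberSum_eq_sum]
    conv_lhs => rw [← sum_levelWeight_update hq k l,
      ENNReal.ofReal_sum_of_nonneg fun m _ => levelWeight_nonneg hq hs hsε _ _]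
    refine (sum_le_sum fun m hm => ih (k + 1) (Function.update l (k + 1) m)
      (valid_update hl (by have := mem_range.1 hm; omega))).trans ?_
    rw [sum_add_distrib]
    simp only [Function.update_self]
    rw [← ENNReal.ofReal_sum_of_nonneg fun m _ => hnn m]
    gcongr
    have h := sum_stepWeight (r := r) (s := s) (ε := ε) hq (k + 1) (l k) 1
    have e : ∑ m ∈ range (l k + 1), levelWeight q r s ε (k + 1) (Function.update l (k + 1) m) *
        ((q : ℝ)⁻¹) ^ n * surCount q m 1 =
        levelWeight q r s ε k l * ((q : ℝ)⁻¹) ^ n *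
          (rowMoment q r s ε (k + 1) 1 * ((q : ℝ)⁻¹) ^ (l k * 1) * surCount q (l k) 1) := by
      rw [← h, mul_sum]
      refine sum_congr rfl fun m _ => ?_
      rw [levelWeight_update]; ring
    have h2 : rowMoment q r s ε (k + 1) 1 * ((q : ℝ)⁻¹) ^ (l k * 1) * surCount q (l k) 1 ≤
        (q : ℝ)⁻¹ * surCount q (l k) 1 := by
      rcases Nat.eq_zero_or_pos (l k) with h0 | h0
      · rw [h0, surCount_of_lt (by omega), mul_zero, mul_zero]
      · refine mul_le_mul_of_nonneg_right ?_ (surCount_nonneg _ _ _)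
        have h3 : ((q : ℝ)⁻¹) ^ (l k * 1) ≤ (q : ℝ)⁻¹ :=
          pow_le_of_le_one ha.le (inv_natCast_lt_one hq).le (by omega)
        calc _ ≤ 1 * (q : ℝ)⁻¹ := mul_le_mul (rowMoment_one_le hq hs hsε _) h3 (by positivity)
              zero_le_one
          _ = _ := one_mul _
    rw [e, pow_succ]
    calc _ ≤ levelWeight q r s ε k l * ((q : ℝ)⁻¹) ^ n * ((q : ℝ)⁻¹ * surCount q (l k) 1) :=
          mul_le_mul_of_nonneg_left h2
            (mul_nonneg (levelWeight_nonneg hq hs hsε _ _) (by positivity))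
      _ = _ := by ring

/-- The upper bound holds for finite partial sums, and in the lower bound the error tends to zero.
Thus the finite modules carry the full mass of each level set. -/
theorem fiberSum_pointWeight (hq : 2 ≤ q) (hs : 0 ≤ s) (hsε : 0 ≤ s - ε) {k : ℕ} {l : ℕ → ℕ}
    (hl : ∀ j < k, l (j + 1) ≤ l j) :
    fiberSum (fun κ => ENNReal.ofReal (pointWeight q r s ε κ)) (k + 1) l =
      ENNReal.ofReal (levelWeight q r s ε k l) := by
  apply le_antisymm
  · rw [fiberSum, ENNReal.tsum_eq_iSup_sum]
    refine iSup_le fun S => ?_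
    obtain ⟨n, hn⟩ : ∃ n, ∀ κ ∈ S, κ.rowLen 0 ≤ n :=
      ⟨S.sup fun κ => κ.rowLen 0, fun κ hκ => le_sup (f := fun κ : YoungDiagram => κ.rowLen 0) hκ⟩
    exact sum_pointWeight_le hq hs hsε n k l S fun κ hκ =>
      (colLen_eq_zero_iff _ _).2 ((hn κ hκ).trans (by omega))
  · have hlim : Filter.Tendsto (fun n : ℕ =>
        fiberSum (fun κ => ENNReal.ofReal (pointWeight q r s ε κ)) (k + 1) l +
        ENNReal.ofReal (levelWeight q r s ε k l * ((q : ℝ)⁻¹) ^ n * surCount q (l k) 1))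
        Filter.atTop (nhds (fiberSum (fun κ => ENNReal.ofReal (pointWeight q r s ε κ)) (k + 1) l +
          ENNReal.ofReal (levelWeight q r s ε k l * 0 * surCount q (l k) 1))) :=
      (ENNReal.tendsto_ofReal (((tendsto_pow_atTop_nhds_zero_of_lt_one
        (inv_natCast_pos hq).le (inv_natCast_lt_one hq)).const_mul _).mul_const _)).const_add _
    rw [mul_zero, zero_mul, ENNReal.ofReal_zero, add_zero] at hlim
    exact ge_of_tendsto' hlim fun n => levelWeight_le_fiberSum hq hs hsε n k l hl

/-! ### Moments -/

/-- Summation over the rows below row k. The sum over row k + 1 turns Sur(m, τ (k+1)) into its row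
moment times q^(-l_k τ_(k+1)) Sur(l k, τ (k+1)). By `rowWeight_mul_surCount` the weight of row k
then becomes Sur(l k, τ k), which restores the shape of the statement one row higher. -/
theorem fiberSum_moment (hq : 2 ≤ q) (hs : 0 ≤ s) (hsε : 0 ≤ s - ε) {K : ℕ} {τ : ℕ → ℕ}
    (hτ : ∀ j, τ (j + 1) ≤ τ j) (hK : τ (K + 1) = 0) (n : ℕ) :
    ∀ (k : ℕ) (l : ℕ → ℕ), k + n = K → (∀ j < k, l (j + 1) ≤ l j) →
      fiberSum (fun κ => ENNReal.ofReal (pointWeight q r s ε κ) *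
        ENNReal.ofReal (∏ j ∈ range (K + 1), rowWeight q (κ.colLen j) (τ (j + 1)) (τ j)))
        (k + 1) l =
      ENNReal.ofReal (levelWeight q r s ε k l *
        (∏ j ∈ range k, rowWeight q (l j) (τ (j + 1)) (τ j)) * surCount q (l k) (τ k) *
        ∏ j ∈ Ico (k + 1) (K + 1), rowMoment q r s ε j (τ j)) := by
  have hnn (k : ℕ) (l : ℕ → ℕ) : 0 ≤ levelWeight q r s ε k l *
        (∏ j ∈ range k, rowWeight q (l j) (τ (j + 1)) (τ j)) * surCount q (l k) (τ k) *
        ∏ j ∈ Ico (k + 1) (K + 1), rowMoment q r s ε j (τ j) :=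
    mul_nonneg (mul_nonneg (mul_nonneg (levelWeight_nonneg hq hs hsε _ _)
      (prod_nonneg fun _ _ => rowWeight_nonneg _ _ _ _)) (surCount_nonneg _ _ _))
      (prod_nonneg fun _ _ => rowMoment_nonneg _ _)
  induction n with
  | zero =>
    intro k l hk hl
    obtain rfl : k = K := by omega
    have h1 : fiberSum (fun κ => ENNReal.ofReal (pointWeight q r s ε κ) *
        ENNReal.ofReal (∏ j ∈ range (k + 1), rowWeight q (κ.colLen j) (τ (j + 1)) (τ j)))
        (k + 1) l = fiberSum (fun κ => ENNReal.ofReal (pointWeight q r s ε κ)) (k + 1) l *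
        ENNReal.ofReal (∏ j ∈ range (k + 1), rowWeight q (l j) (τ (j + 1)) (τ j)) := by
      unfold fiberSum
      rw [← ENNReal.tsum_mul_right]
      refine tsum_congr fun κ => ?_
      split_ifs with h
      · have e : ∏ j ∈ range (k + 1), rowWeight q (κ.colLen j) (τ (j + 1)) (τ j) =
            ∏ j ∈ range (k + 1), rowWeight q (l j) (τ (j + 1)) (τ j) :=
          prod_congr rfl fun j hj => by rw [h j (mem_range.1 hj)]
        exact congrArg (ENNReal.ofReal (pointWeight q r s ε κ) * ENNReal.ofReal ·) e
      · rw [zero_mul]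
    rw [h1, fiberSum_pointWeight hq hs hsε hl,
      ← ENNReal.ofReal_mul (levelWeight_nonneg hq hs hsε _ _), prod_range_succ, Ico_self,
      prod_empty, mul_one, hK, mul_assoc]
    -- The bottom row has nothing below it, so its weight is a full number of surjections; this
    -- starts the telescoping.
    have e : rowWeight q (l k) 0 (τ k) = surCount q (l k) (τ k) := by
      rw [rowWeight, surCount, mul_zero, pow_zero, one_mul, range_eq_Ico]
    rw [e]
  | succ n ih =>
    intro k l hk hl
    rw [fiberSum_eq_sum, sum_congr rfl fun m hm => ih (k + 1) (Function.update l (k + 1) m)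
      (by omega) (valid_update hl (by have := mem_range.1 hm; omega)),
      ← ENNReal.ofReal_sum_of_nonneg fun m _ => hnn _ _]
    congr 1
    have hstep := sum_stepWeight (r := r) (s := s) (ε := ε) hq (k + 1) (l k) (τ (k + 1))
    have hrow := rowWeight_mul_surCount q (l k) (hτ k)
    rw [prod_eq_prod_Ico_succ_bot (by omega : k + 1 < K + 1)]
    have e : ∀ m, levelWeight q r s ε (k + 1) (Function.update l (k + 1) m) *
        (∏ j ∈ range (k + 1), rowWeight q (Function.update l (k + 1) m j) (τ (j + 1)) (τ j)) *
        surCount q (Function.update l (k + 1) m (k + 1)) (τ (k + 1)) *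
        ∏ j ∈ Ico (k + 1 + 1) (K + 1), rowMoment q r s ε j (τ j) =
        levelWeight q r s ε k l * (∏ j ∈ range k, rowWeight q (l j) (τ (j + 1)) (τ j)) *
        rowWeight q (l k) (τ (k + 1)) (τ k) *
        (∏ j ∈ Ico (k + 1 + 1) (K + 1), rowMoment q r s ε j (τ j)) *
        (stepWeight q r s ε (k + 1) (l k) m * surCount q m (τ (k + 1))) := by
      intro m
      rw [levelWeight_update, Function.update_self, prod_range_succ,
        Function.update_of_ne (by omega), prod_congr rfl fun j hj => by
          rw [Function.update_of_ne (by have := mem_range.1 hj; omega)]]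
      ring
    simp only [e]
    rw [← mul_sum, hstep]
    have hq0 : (q : ℝ) ≠ 0 := by positivity
    have hcan : (q : ℝ) ^ (l k * τ (k + 1)) * ((q : ℝ)⁻¹) ^ (l k * τ (k + 1)) = 1 := by
      rw [← mul_pow, mul_inv_cancel₀ hq0, one_pow]
    generalize ∏ j ∈ Ico (k + 1 + 1) (K + 1), rowMoment q r s ε j (τ j) = A
    generalize ∏ j ∈ range k, rowWeight q (l j) (τ (j + 1)) (τ j) = B
    calc _ = levelWeight q r s ε k l * B * A * rowMoment q r s ε (k + 1) (τ (k + 1)) *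
          ((q : ℝ)⁻¹) ^ (l k * τ (k + 1)) *
          (rowWeight q (l k) (τ (k + 1)) (τ k) * surCount q (l k) (τ (k + 1))) := by ring
      _ = levelWeight q r s ε k l * B * A * rowMoment q r s ε (k + 1) (τ (k + 1)) *
          ((q : ℝ) ^ (l k * τ (k + 1)) * ((q : ℝ)⁻¹) ^ (l k * τ (k + 1))) *
          surCount q (l k) (τ k) := by rw [hrow]; ring
      _ = _ := by rw [hcan]; ring

theorem tsum_moment (hq : 2 ≤ q) (hs : 0 ≤ s) (hsε : 0 ≤ s - ε) (hr : 1 ≤ r) {K : ℕ} {τ : ℕ → ℕ}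
    (hτ : ∀ j, τ (j + 1) ≤ τ j) (hK : τ (K + 1) = 0) :
    ∑' κ : YoungDiagram, ENNReal.ofReal (pointWeight q r s ε κ) *
        ENNReal.ofReal (∏ j ∈ range (K + 1), rowWeight q (κ.colLen j) (τ (j + 1)) (τ j)) =
      ENNReal.ofReal (∏ j ∈ range (K + 1), rowMoment q r s ε j (τ j)) := by
  have h0 := fiberSum_eq_tsum (fun κ => ENNReal.ofReal (pointWeight q r s ε κ) *
    ENNReal.ofReal (∏ j ∈ range (K + 1), rowWeight q (κ.colLen j) (τ (j + 1)) (τ j))) 0 (fun _ => 0)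
  have h1 : fiberSum (fun κ => ENNReal.ofReal (pointWeight q r s ε κ) *
    ENNReal.ofReal (∏ j ∈ range (K + 1), rowWeight q (κ.colLen j) (τ (j + 1)) (τ j))) 0
      (fun _ => 0) = ∑' κ : YoungDiagram, ENNReal.ofReal (pointWeight q r s ε κ) *
        ENNReal.ofReal (∏ j ∈ range (K + 1), rowWeight q (κ.colLen j) (τ (j + 1)) (τ j)) := by
    unfold fiberSum
    exact tsum_congr fun κ => if_pos fun j hj => absurd hj (by omega)
  rw [← h1, h0]
  have hsum := (hasSum_firstWeight_rowMoment (r := r) hq hsε hr (τ 0)).mul_right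
    (∏ j ∈ Ico 1 (K + 1), rowMoment q r s ε j (τ j))
  have hnn (m : ℕ) : 0 ≤ firstWeight q (s - ε) m * surCount q m (τ 0) *
      ∏ j ∈ Ico 1 (K + 1), rowMoment q r s ε j (τ j) :=
    mul_nonneg (mul_nonneg (firstWeight_nonneg hq hsε _) (surCount_nonneg _ _ _))
      (prod_nonneg fun _ _ => rowMoment_nonneg _ _)
  rw [prod_range_eq_mul_Ico _ (by omega), ← hsum.tsum_eq,
    ENNReal.ofReal_tsum_of_nonneg hnn hsum.summable]
  refine tsum_congr fun m => ?_
  rw [fiberSum_moment hq hs hsε hτ hK K 0 _ (by omega) (fun j hj => absurd hj (by omega))]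
  simp [levelWeight]

end Weights


/-! ### The explicit formula -/

section Formula

open Finset Classical

variable {q : ℕ} {r : ℕ∞} {s ε : ℝ}

theorem prod_Icc_one_eq (f : ℕ → ℝ) (k : ℕ) :
    ∏ j ∈ Icc 1 k, f j = ∏ j ∈ range k, f (j + 1) := by
  induction k with
  | zero => simp
  | succ k ih => rw [prod_Icc_succ_top (by omega), ih, prod_range_succ]

theorem prod_Icc_two_eq (f : ℕ → ℝ) (k : ℕ) :
    ∏ j ∈ Icc 2 (k + 1), f j = ∏ j ∈ range k, f (j + 2) := by
  induction k with
  | zero => simp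
  | succ k ih => rw [prod_Icc_succ_top (by omega), ih, prod_range_succ]

theorem minLevel_of_le {k : ℕ} (h : (k : ℕ∞) ≤ r) : minLevel k r = k := by
  rw [minLevel, min_eq_left h, ENat.toNat_natCast]

theorem minLevel_of_ge {k r' : ℕ} (h : r' ≤ k) : minLevel k (r' : ℕ∞) = r' := by
  rw [minLevel, min_eq_right (by exact_mod_cast h), ENat.toNat_natCast]

theorem rowMoment_eq_rpow (hq : 2 ≤ q) (j m : ℕ) :
    rowMoment q r s ε j m = (q : ℝ) ^
      ((if ((j + 1 : ℕ) : ℕ∞) ≤ r then (m.choose 2 : ℝ) + ε * m else 0) - s * m) := by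
  have hq0 : (0 : ℝ) < q := by positivity
  unfold rowMoment
  split_ifs
  · rw [mul_rpow_neg_add_one hq, ← Real.rpow_natCast, ← Real.rpow_natCast, ← Real.rpow_mul hq0.le,
      ← Real.rpow_add hq0]
    congr 1; ring
  · rw [← Real.rpow_natCast, ← Real.rpow_mul hq0.le]
    congr 1; ring

theorem choose_two_cast (m : ℕ) : ((m ^ 2 : ℕ) : ℝ) = 2 * (m.choose 2 : ℝ) + m := by
  rw [sq_eq_choose_two]; push_cast; ring

/-- The exponent is the moment minus the power of q in the order of the automorphism group, since m²
= 2 (m choose 2) + m. The second sum corrects the rows beyond r, where the moment lacks (m choose 2)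
+ ε m. -/
theorem rpow_level_exponent (hq : 2 ≤ q) (k : ℕ) (p : ℕ → ℕ) :
    (q : ℝ) ^ ((∑ j ∈ Icc 1 k, (-((p j).choose 2 : ℝ) - (s - ε + 1) * (p j : ℝ))) +
      ∑ j ∈ (Icc 1 k).filter (fun j : ℕ => r + 1 ≤ (j : ℕ∞)),
        (-((p j).choose 2 : ℝ) - ε * (p j : ℝ))) =
      ∏ j ∈ range k, (rowMoment q r s ε j (p (j + 1)) / (q : ℝ) ^ (p (j + 1) ^ 2)) := by
  have hq0 : (0 : ℝ) < q := by positivity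
  rw [sum_filter, ← sum_add_distrib, Real.rpow_sum_of_pos hq0, prod_Icc_one_eq]
  refine prod_congr rfl fun i _ => ?_
  rw [rowMoment_eq_rpow hq, ← Real.rpow_natCast, ← Real.rpow_sub hq0,
    choose_two_cast]
  congr 1
  have hiff : r + 1 ≤ ((i + 1 : ℕ) : ℕ∞) ↔ ¬ ((i + 1 : ℕ) : ℕ∞) ≤ r := by
    rw [not_le]
    induction r using ENat.recTopCoe with
    | top => simp
    | coe r' => norm_cast
  by_cases h : ((i + 1 : ℕ) : ℕ∞) ≤ r
  · rw [if_pos h, if_neg (by rw [hiff]; exact not_not.2 h)]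
    ring
  · rw [if_neg h, if_pos (hiff.2 h)]
    ring

/-- The part of `stepWeight` which is not explained by moments and automorphisms. -/
def stepFactor (q : ℕ) (r : ℕ∞) (s ε : ℝ) (j n m : ℕ) : ℝ :=
  if ((j + 1 : ℕ) : ℕ∞) ≤ r then Pf q (s - ε) (n - m)
  else ∏ i ∈ Ico m n, (1 - (q : ℝ) ^ (-s) * ((q : ℝ)⁻¹) ^ (i + 1))

theorem stepWeight_eq (hq : 2 ≤ q) (j n m : ℕ) :
    stepWeight q r s ε j n m = rowMoment q r s ε j m / (q : ℝ) ^ (m ^ 2) *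
      (eta q n / (eta q (n - m) * eta q m)) * stepFactor q r s ε j n m := by
  have hq0 : (q : ℝ) ≠ 0 := by positivity
  unfold stepWeight rowMoment stepFactor
  split_ifs
  · rw [torsionStep, sq_eq_choose_two m]
    simp only [pow_add, mul_pow, inv_pow]
    field_simp
  · rw [freeStep]
    simp only [inv_pow]
    field_simp

theorem rpow_sub_natCast_eq (hq : 2 ≤ q) (i : ℕ) : (q : ℝ) ^ (-s + ε - 1 - (i : ℝ)) =
    (q : ℝ) ^ (-(s - ε + 1)) * ((q : ℝ)⁻¹) ^ i := by
  have hq0 : (0 : ℝ) < q := by positivity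
  rw [inv_pow, ← Real.rpow_natCast, ← Real.rpow_neg hq0.le, ← Real.rpow_add hq0]
  congr 1; ring

theorem firstWeight_eq (hq : 2 ≤ q) (hr : 1 ≤ r) (m : ℕ) :
    firstWeight q (s - ε) m = (∏' i : ℕ, (1 + (q : ℝ) ^ (-s + ε - 1 - (i : ℝ)))⁻¹) *
      (rowMoment q r s ε 0 m / (q : ℝ) ^ (m ^ 2)) / eta q m := by
  have hq0 : (0 : ℝ) < q := by positivity
  have hq1 : (q : ℝ) ≠ 0 := hq0.ne'
  rw [firstWeight, rowMoment, if_pos (by simpa using hr)]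
  simp only [rpow_sub_natCast_eq hq, sq_eq_choose_two m, pow_add, mul_pow, inv_pow]
  field_simp

/-- The factors η(l j) of consecutive steps cancel; only the differences and the last η(l k)
survive. -/
theorem levelWeight_eq (hq : 2 ≤ q) (hr : 1 ≤ r) (k : ℕ) (l : ℕ → ℕ) :
    levelWeight q r s ε k l =
      (∏ j ∈ range (k + 1), (rowMoment q r s ε j (l j) / (q : ℝ) ^ (l j ^ 2))) /
        ((∏ j ∈ range k, eta q (l j - l (j + 1))) * eta q (l k)) *
      ((∏' i : ℕ, (1 + (q : ℝ) ^ (-s + ε - 1 - (i : ℝ)))⁻¹) *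
        ∏ j ∈ range k, stepFactor q r s ε (j + 1) (l j) (l (j + 1))) := by
  induction k with
  | zero =>
    rw [levelWeight, firstWeight_eq hq hr]
    simp
    ring
  | succ k ih =>
    have h : levelWeight q r s ε (k + 1) l =
        levelWeight q r s ε k l * stepWeight q r s ε (k + 1) (l k) (l (k + 1)) := by
      rw [levelWeight, prod_range_succ, ← mul_assoc, levelWeight]
    rw [h, ih, stepWeight_eq hq, prod_range_succ _ (k + 1)]
    rw [prod_range_succ (fun j => eta q (l j - l (j + 1))) k,
      prod_range_succ (fun j => stepFactor q r s ε (j + 1) (l j) (l (j + 1))) k]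
    have h1 := eta_ne_zero hq (l k)
    have h2 := eta_ne_zero hq (l (k + 1))
    have h3 := eta_ne_zero hq (l k - l (k + 1))
    have h4 : ∏ j ∈ range k, eta q (l j - l (j + 1)) ≠ 0 :=
      prod_ne_zero_iff.2 fun j _ => eta_ne_zero hq _
    field_simp

/-- Steps up to row r give the factors Pf. Beyond r the factors run over the adjacent intervals from
p (j+1) + 1 to p j, which join to a single interval ending at p r. -/
theorem prod_stepFactor (hq : 2 ≤ q) (hr : 1 ≤ r) (k : ℕ) {p : ℕ → ℕ}
    (hp : ∀ j, 1 ≤ j → p (j + 1) ≤ p j) :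
    ∏ j ∈ range k, stepFactor q r s ε (j + 1) (p (j + 1)) (p (j + 2)) =
      (∏ j ∈ Icc 2 (minLevel (k + 1) r), Pf q (s - ε) (p (j - 1) - p j)) *
      ∏ i ∈ Icc (p (k + 1) + 1) (p (minLevel (k + 1) r)), (1 - (q : ℝ) ^ (-s - (i : ℝ))) := by
  have hq0 : (0 : ℝ) < q := by positivity
  induction k with
  | zero => simp [minLevel_of_le (r := r) (k := 1) (by simpa using hr)]
  | succ k ih =>
    rw [prod_range_succ, ih]
    by_cases h : ((k + 1 + 1 : ℕ) : ℕ∞) ≤ r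
    · have h' : ((k + 1 : ℕ) : ℕ∞) ≤ r := le_trans (by norm_cast; omega) h
      rw [minLevel_of_le h, minLevel_of_le h', stepFactor, if_pos h, prod_Icc_two_eq _ (k + 1),
        prod_Icc_two_eq _ k, prod_range_succ]
      simp
    · obtain ⟨r', rfl⟩ : ∃ r' : ℕ, r = r' :=
        (ENat.ne_top_iff_exists.1 (ne_top_of_lt (not_le.1 h))).imp fun _ h => h.symm
      have h1 : r' ≤ k + 1 := by
        have := not_le.1 h
        norm_cast at this; omega
      have hr' : 1 ≤ r' := by exact_mod_cast hr
      rw [minLevel_of_ge h1, minLevel_of_ge (by omega), stepFactor, if_neg h, mul_assoc]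
      congr 1
      have e : ∏ i ∈ Ico (p (k + 2)) (p (k + 1)), (1 - (q : ℝ) ^ (-s) * ((q : ℝ)⁻¹) ^ (i + 1)) =
          ∏ i ∈ Ico (p (k + 2) + 1) (p (k + 1) + 1), (1 - (q : ℝ) ^ (-s - (i : ℝ))) := by
        rw [← prod_Ico_add' (fun i : ℕ => (1 - (q : ℝ) ^ (-s - (i : ℝ))))]
        refine prod_congr rfl fun i _ => ?_
        rw [inv_pow, ← Real.rpow_natCast, ← Real.rpow_neg hq0.le, ← Real.rpow_add hq0]
        rfl
      have hle : p (k + 1) ≤ p r' := by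
        obtain ⟨d, hd⟩ := Nat.exists_eq_add_of_le h1
        rw [hd]
        clear * - hp hr'
        induction d with
        | zero => rfl
        | succ d ih => exact (hp (r' + d) (by omega)).trans ih
      have hle2 : p (k + 2) ≤ p (k + 1) := hp (k + 1) (by omega)
      rw [e, ← Ico_succ_right_eq_Icc, ← Ico_succ_right_eq_Icc, mul_comm]
      exact prod_Ico_consecutive _ (by omega) (Nat.succ_le_succ hle)

theorem levelFormula_eq (hq : 2 ≤ q) (k : ℕ) (lam : YoungDiagram) :
    levelFormula q r s ε k lam =
      (∏ j ∈ range k, (rowMoment q r s ε j (lam.rowLen j) / (q : ℝ) ^ (lam.rowLen j ^ 2))) /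
        (∏ j ∈ range k, eta q (lam.rowLen j - lam.rowLen (j + 1))) *
      levelFactor q r s ε k lam := by
  unfold levelFormula
  rw [rpow_level_exponent hq]
  rw [prod_Icc_two_eq]
  rfl

theorem levelFormula_eq_levelWeight (hq : 2 ≤ q) (hr : 1 ≤ r) {k : ℕ} {lam : YoungDiagram}
    (h : lam.rowLen (k + 1) = 0) :
    levelFormula q r s ε (k + 1) lam = levelWeight q r s ε k lam.rowLen := by
  rw [levelFormula_eq hq, levelWeight_eq hq hr, prod_range_succ (fun j => eta q _), h, Nat.sub_zero]
  congr 1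
  rw [levelFactor, mul_assoc]
  congr 1
  exact (prod_stepFactor hq hr k (p := part lam) fun j hj =>
    lam.rowLen_anti _ _ (by omega)).symm

theorem rowLen_eq_zero_iff (lam : YoungDiagram) (k : ℕ) : lam.rowLen k = 0 ↔ lam.colLen 0 ≤ k := by
  have := lt_colLen_iff_lt_rowLen lam k 0
  omega

theorem card_eq_sum_rowLen (lam : YoungDiagram) {K : ℕ} (hK : lam.rowLen K = 0) :
    lam.card = ∑ j ∈ range K, lam.rowLen j := by
  rw [YoungDiagram.card, card_eq_sum_card_fiberwise (f := Prod.fst) (t := range K)]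
  · exact sum_congr rfl fun j _ => (lam.rowLen_eq_card).symm
  · rintro ⟨i, j⟩ hc
    have h1 := YoungDiagram.mem_iff_lt_rowLen.1 ((YoungDiagram.mem_cells _).1 hc)
    rw [coe_range, Set.mem_Iio]
    by_contra h
    have := lam.rowLen_anti K i (not_lt.1 h)
    omega

theorem rpow_momentExponent (hq : 2 ≤ q) {K : ℕ} (rho : YoungDiagram) (hK : rho.rowLen K = 0) :
    (q : ℝ) ^ momentExponent r s ε rho = ∏ j ∈ range K, rowMoment q r s ε j (rho.rowLen j) := by
  have hq0 : (0 : ℝ) < q := by positivity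
  have hc := (rowLen_eq_zero_iff _ _).1 hK
  have h0 : rho.rowLen (rho.colLen 0) = 0 := (rowLen_eq_zero_iff _ _).2 le_rfl
  have e : ∏ j ∈ range K, rowMoment q r s ε j (rho.rowLen j) =
      ∏ j ∈ range (rho.colLen 0), rowMoment q r s ε j (rho.rowLen j) := by
    refine (prod_subset (range_subset_range.2 hc) fun j _ hj => ?_).symm
    rw [(rowLen_eq_zero_iff _ _).2 (by simpa using hj), rowMoment_zero]
  rw [e, momentExponent, card_eq_sum_rowLen rho h0, sum_filter, Real.rpow_sub hq0,
    Real.rpow_sum_of_pos hq0, prod_Icc_one_eq, Nat.cast_sum, mul_sum, Real.rpow_sum_of_pos hq0,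
    ← prod_div_distrib]
  refine prod_congr rfl fun j _ => ?_
  rw [rowMoment_eq_rpow hq, Real.rpow_sub hq0]
  rfl

end Formula


/-! ### Exterior squares of sums of cyclic modules -/

section ExteriorSquare

variable {R : Type*} [CommRing R]

/-- The alternating map `v ↦ α (v 0) * β (v 1) - α (v 1) * β (v 0)`. -/
def wedgeFunctional {M A : Type*} [AddCommGroup M] [Module R M] [CommRing A] [Algebra R A]
    (α β : M →ₗ[R] A) : M [⋀^Fin 2]→ₗ[R] A where
  toFun v := α (v 0) * β (v 1) - α (v 1) * β (v 0)
  map_update_add' := by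
    intro _ v i x y
    fin_cases i <;> simp [Function.update] <;> ring
  map_update_smul' := by
    intro _ v i c x
    fin_cases i <;> simp [Function.update, smul_sub]
  map_eq_zero_of_eq' := by
    intro v i j h hij
    fin_cases i <;> fin_cases j <;> simp_all

variable {n : ℕ} (I : Fin n → Ideal R)

/-- The pairs `i < j` of indices. -/
abbrev IndexPair (n : ℕ) : Type := {z : Fin n × Fin n // z.1 < z.2}

theorem span_range_single_one :
    Submodule.span R (Set.range fun i => (Pi.single i 1 : (i : Fin n) → R ⧸ I i)) = ⊤ := by
  rw [eq_top_iff]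
  intro x _
  rw [← Finset.univ_sum_single x]
  refine Submodule.sum_mem _ fun i _ => ?_
  obtain ⟨r, hr⟩ := Ideal.Quotient.mk_surjective (x i)
  have : Pi.single i (x i) = r • (Pi.single i 1 : (i : Fin n) → R ⧸ I i) := by
    rw [← Pi.single_smul, ← hr, Algebra.smul_def, mul_one]; rfl
  rw [this]
  exact Submodule.smul_mem _ _ (Submodule.subset_span ⟨i, rfl⟩)

variable (hI : Monotone I)

/-- The coordinates of the exterior square of `⨁ R / I i`. -/
def wedgeCoord : ⋀[R]^2 ((i : Fin n) → R ⧸ I i) →ₗ[R] ((z : IndexPair n) → R ⧸ I z.1.2) :=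
  LinearMap.pi fun z => exteriorPower.alternatingMapLinearEquiv (wedgeFunctional
    -- For i < j the wedge of e_i and e_j is killed by the larger ideal I j, so both coordinates are
    -- read in R/I j.
    ((Ideal.Quotient.factorₐ R (hI z.2.le)).toLinearMap.comp (LinearMap.proj z.1.1))
    (LinearMap.proj z.1.2))

/-- The map from the sum of cyclic modules that sends generators to the wedges `e_i ∧ e_j`. -/
def wedgeGen : ((z : IndexPair n) → R ⧸ I z.1.2) →ₗ[R] ⋀[R]^2 ((i : Fin n) → R ⧸ I i) :=
  LinearMap.lsum R _ R fun z => Submodule.liftQ (I z.1.2)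
    (LinearMap.toSpanSingleton R _ (exteriorPower.ιMulti R 2
      ![Pi.single z.1.1 1, Pi.single z.1.2 1])) (by
    intro r hr
    rw [LinearMap.mem_ker, LinearMap.toSpanSingleton_apply]
    have h : r • (Pi.single z.1.2 1 : (i : Fin n) → R ⧸ I i) = 0 := by
      rw [← Pi.single_smul, Algebra.smul_def, mul_one, Ideal.Quotient.algebraMap_eq,
        Ideal.Quotient.eq_zero_iff_mem.2 hr, Pi.single_zero]
    have h2 := (exteriorPower.ιMulti R 2).map_update_smul
      ![(Pi.single z.1.1 1 : (i : Fin n) → R ⧸ I i), Pi.single z.1.2 1] 1 r (Pi.single z.1.2 1)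
    rw [h] at h2
    have h3 : Function.update ![(Pi.single z.1.1 1 : (i : Fin n) → R ⧸ I i), Pi.single z.1.2 1] 1
        (Pi.single z.1.2 1) = ![Pi.single z.1.1 1, Pi.single z.1.2 1] := by
      ext i : 1; fin_cases i <;> simp
    rw [h3] at h2
    rw [← h2]
    exact AlternatingMap.map_coord_zero _ (1 : Fin 2) (by simp))

theorem wedgeGen_single (z : IndexPair n) :
    wedgeGen I (Pi.single z 1) =
      exteriorPower.ιMulti R 2 ![Pi.single z.1.1 1, Pi.single z.1.2 1] := by
  rw [wedgeGen, LinearMap.lsum_piSingle]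
  exact one_smul R _

/-- A 2 × 2 minor of two basis vectors vanishes for any other pair of indices. The crossed product
could survive only if i' = j and j' = i, which contradicts i < j and i' < j'. -/
theorem wedgeCoord_ιMulti_single (z : IndexPair n) :
    wedgeCoord I hI (exteriorPower.ιMulti R 2 ![Pi.single z.1.1 1, Pi.single z.1.2 1]) =
      Pi.single z 1 := by
  obtain ⟨⟨i, j⟩, hij⟩ := z
  ext ⟨⟨i', j'⟩, hij'⟩
  simp only [wedgeCoord, LinearMap.pi_apply, exteriorPower.alternatingMapLinearEquiv_apply_ιMulti,
    wedgeFunctional, AlternatingMap.coe_mk, MultilinearMap.coe_mk, LinearMap.comp_apply,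
    LinearMap.proj_apply, Matrix.cons_val_zero, Matrix.cons_val_one, AlgHom.toLinearMap_apply]
  dsimp only at hij hij'
  by_cases h : i' = i ∧ j' = j
  · obtain ⟨rfl, rfl⟩ := h
    simp [Pi.single_eq_of_ne hij.ne', Pi.single_eq_of_ne hij.ne]
  · have hne : (⟨(i', j'), hij'⟩ : IndexPair n) ≠ ⟨(i, j), hij⟩ := fun e => h (by simpa using e)
    rw [Pi.single_eq_of_ne hne]
    have h1 : (Pi.single j 1 : (i : Fin n) → R ⧸ I i) i' = 0 ∨
        (Pi.single i 1 : (i : Fin n) → R ⧸ I i) j' = 0 := by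
      by_cases hj : i' = j
      · right
        exact Pi.single_eq_of_ne
          (by rintro rfl; subst hj; exact absurd (hij.trans hij') (lt_irrefl _)) _
      · left; exact Pi.single_eq_of_ne hj _
    have h2 : (Pi.single i 1 : (i : Fin n) → R ⧸ I i) i' = 0 ∨
        (Pi.single j 1 : (i : Fin n) → R ⧸ I i) j' = 0 := by
      by_cases hi : i' = i
      · right
        exact Pi.single_eq_of_ne (fun hj => h ⟨hi, hj⟩) _
      · left; exact Pi.single_eq_of_ne hi _
    rcases h1 with h1 | h1 <;> rcases h2 with h2 | h2 <;> simp [h1, h2]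

theorem wedgeGen_surjective : Function.Surjective (wedgeGen I) := by
  rw [← LinearMap.range_eq_top, eq_top_iff,
    ← exteriorPower.ιMulti_family_span_of_span R (n := 2) (span_range_single_one I),
    Submodule.span_le]
  rintro _ ⟨s, rfl⟩
  have hlt : Set.powersetCard.ofFinEmbEquiv.symm s 0 < Set.powersetCard.ofFinEmbEquiv.symm s 1 :=
    (Set.powersetCard.ofFinEmbEquiv.symm s).strictMono (by decide)
  refine ⟨Pi.single ⟨(_, _), hlt⟩ 1, ?_⟩
  rw [wedgeGen_single, exteriorPower.ιMulti_family]
  congr 1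
  ext i : 1
  fin_cases i <;> rfl

/-- The exterior square of a sum of cyclic modules `⨁ R / I i` with `I` increasing. -/
def wedgeEquiv : ((z : IndexPair n) → R ⧸ I z.1.2) ≃ₗ[R] ⋀[R]^2 ((i : Fin n) → R ⧸ I i) :=
  LinearEquiv.ofBijective (wedgeGen I) ⟨by
    -- The coordinate map is a left inverse, as is checked on generators.
    refine Function.LeftInverse.injective (g := wedgeCoord I hI) fun x => ?_
    rw [← LinearMap.comp_apply]
    conv_rhs => rw [← LinearMap.id_apply (R := R) x]
    congr 1
    refine LinearMap.pi_ext' fun z => ?_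
    refine Submodule.linearMap_qext _ (LinearMap.ext_ring ?_)
    simp only [LinearMap.comp_apply, Submodule.mkQ_apply, LinearMap.id_comp,
      LinearMap.coe_single]
    have : (Submodule.Quotient.mk 1 : R ⧸ I z.1.2) = 1 := rfl
    rw [this, wedgeGen_single, wedgeCoord_ιMulti_single], wedgeGen_surjective I⟩

end ExteriorSquare

/-! ### The prescribed moments of the modules `N_λ` -/

section MomentValue

theorem torsionPow_le_comap {R : Type u} [CommRing R] (p : ℕ) (r : ℕ∞) {M N : Type u}
    [AddCommGroup M] [Module R M] [AddCommGroup N] [Module R N] (f : M →ₗ[R] N) :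
    torsionPow R p r M ≤ (torsionPow R p r N).comap f := by
  refine iSup₂_le fun n hn x hx => ?_
  have h : f x ∈ Submodule.torsionBy R N ((p : R) ^ n) := by
    rw [Submodule.mem_torsionBy_iff] at hx ⊢
    rw [← map_smul, hx, map_zero]
  exact Submodule.mem_iSup_of_mem n (Submodule.mem_iSup_of_mem hn h)

theorem card_torsionPow_congr {R : Type u} [CommRing R] (p : ℕ) (r : ℕ∞) {M N : Type u}
    [AddCommGroup M] [Module R M] [AddCommGroup N] [Module R N] (e : M ≃ₗ[R] N) :
    Nat.card (torsionPow R p r M) = Nat.card (torsionPow R p r N) :=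
  Nat.card_congr <| e.toEquiv.subtypeEquiv fun x =>
    ⟨fun hx => torsionPow_le_comap p r e.toLinearMap hx, fun hx => by
      have := torsionPow_le_comap p r e.symm.toLinearMap hx
      simpa using this⟩

/-- The linear equivalence of exterior squares induced by a linear equivalence. -/
def exteriorSquareCongr {R : Type u} [CommRing R] {M N : Type u}
    [AddCommGroup M] [Module R M] [AddCommGroup N] [Module R N] (e : M ≃ₗ[R] N) :
    ⋀[R]^2 M ≃ₗ[R] ⋀[R]^2 N :=
  LinearEquiv.ofLinearMap (exteriorPower.map 2 e.toLinearMap)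
    (exteriorPower.map 2 e.symm.toLinearMap)
    (by rw [← exteriorPower.map_comp]; simp) (by rw [← exteriorPower.map_comp]; simp)

theorem momentValue_congr {R : Type u} [CommRing R] (p : ℕ) (r : ℕ∞) (s ε : ℝ) {M N : Type u}
    [AddCommGroup M] [Module R M] [AddCommGroup N] [Module R N] (e : M ≃ₗ[R] N) :
    momentValue R p r s ε M = momentValue R p r s ε N := by
  rw [momentValue, card_torsionPow_congr p r (exteriorSquareCongr e), card_torsionPow_congr p r e,
    Nat.card_congr e.toEquiv, momentValue]

/-- When p^K kills the module, the supremum is attained at min(K, r). This treats finite r and r = ∞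
together. -/
theorem torsionPow_eq_torsionBy {R : Type u} [CommRing R] (p : ℕ) (r : ℕ∞) {M : Type u}
    [AddCommGroup M] [Module R M] {K : ℕ} (hK : ∀ x : M, (p : R) ^ K • x = 0) :
    torsionPow R p r M = Submodule.torsionBy R M ((p : R) ^ minLevel K r) := by
  have hle : ((minLevel K r : ℕ) : ℕ∞) ≤ r := by
    rw [minLevel, ENat.natCast_toNat (by simp)]; exact min_le_right _ _
  refine le_antisymm (iSup₂_le fun n hn => ?_) (le_iSup₂_of_le _ hle le_rfl)
  rcases le_total n K with h | h
  · refine Submodule.torsionBy_le_torsionBy_of_dvd _ _ (pow_dvd_pow _ ?_)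
    rw [← Nat.cast_le (α := ℕ∞), minLevel, ENat.natCast_toNat (by simp)]
    exact le_min (by exact_mod_cast h) hn
  · rw [minLevel_of_le ((by exact_mod_cast h : (K : ℕ∞) ≤ n).trans hn)]
    intro x _
    exact (Submodule.mem_torsionBy_iff _ _).2 (hK x)

/-- Give each cell in row i the weight i; a column of length c contributes 0 + … + (c - 1). -/
theorem sum_range_mul_min_rowLen (κ : YoungDiagram) (b : ℕ) :
    ∑ i ∈ Finset.range (κ.colLen 0), i * min (κ.rowLen i) b =
      ∑ l ∈ Finset.range b, (κ.colLen l).choose 2 := by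
  have h1 (i : ℕ) : i * min (κ.rowLen i) b =
      ∑ l ∈ Finset.range b, if i < κ.colLen l then i else 0 := by
    simp only [lt_colLen_iff_lt_rowLen]
    rw [← Finset.sum_filter, Finset.sum_const, smul_eq_mul, mul_comm]
    congr 1
    rw [← Finset.card_range (min _ _)]
    congr 1
    ext l; simp [and_comm]
  rw [Finset.sum_congr rfl fun i _ => h1 i, Finset.sum_comm]
  refine Finset.sum_congr rfl fun l _ => ?_
  rw [← Finset.sum_filter]
  have : (Finset.range (κ.colLen 0)).filter (fun i => i < κ.colLen l) =
      Finset.range (κ.colLen l) := by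
    ext i
    have := κ.colLen_anti 0 l (Nat.zero_le _)
    simp only [Finset.mem_filter, Finset.mem_range]; omega
  rw [this, Finset.sum_range_id, Nat.choose_two_right]

theorem sum_indexPair {n : ℕ} (f : ℕ → ℕ) :
    ∑ z : IndexPair n, f z.1.2 = ∑ j ∈ Finset.range n, j * f j := by
  rw [← Fin.sum_univ_eq_sum_range (fun j => j * f j),
    ← Finset.sum_subtype (p := fun z : Fin n × Fin n => z.1 < z.2)
      (Finset.univ.filter fun z : Fin n × Fin n => z.1 < z.2) (by simp) (fun z => f z.2),
    Finset.sum_filter, Fintype.sum_prod_type_right]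
  refine Finset.sum_congr rfl fun j _ => ?_
  dsimp only
  rw [← Finset.sum_filter, Finset.sum_const, smul_eq_mul]
  congr 1
  conv_rhs => rw [← Fin.card_Iio j]
  congr 1
  ext i; simp

variable {R : Type u} [CommRing R] [IsDomain R] [IsDiscreteValuationRing R]
  [Finite (ResidueField R)]

theorem card_torsionBy_pi {ι : Type} [Fintype ι] {ϖ : R} (hϖ : Irreducible ϖ) (n : ℕ)
    (a : ι → ℕ) :
    Nat.card (Submodule.torsionBy R ((i : ι) → R ⧸ maximalIdeal R ^ a i) (ϖ ^ n)) =
      Nat.card (ResidueField R) ^ ∑ i, min n (a i) := by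
  let e : Submodule.torsionBy R ((i : ι) → R ⧸ maximalIdeal R ^ a i) (ϖ ^ n) ≃
      ((i : ι) → Submodule.torsionBy R (R ⧸ maximalIdeal R ^ a i) (ϖ ^ n)) :=
    (Equiv.subtypeEquivRight fun x => by
      rw [Submodule.mem_torsionBy_iff, funext_iff]; rfl).trans
      (Equiv.subtypePiEquivPi (p := fun i (y : R ⧸ maximalIdeal R ^ a i) => ϖ ^ n • y = 0))
  rw [Nat.card_congr e, Nat.card_pi, Finset.prod_congr rfl fun i _ => card_torsionBy_pow hϖ n (a i),
    Finset.prod_pow_eq_pow_sum]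

omit [Finite (ResidueField R)] in
theorem pow_smul_pi_eq_zero {ι : Type} {ϖ : R} (hϖ : Irreducible ϖ) {K : ℕ}
    {a : ι → ℕ} (ha : ∀ i, a i ≤ K) (x : (i : ι) → R ⧸ maximalIdeal R ^ a i) :
    ϖ ^ K • x = 0 := by
  ext i
  obtain ⟨y, hy⟩ := Ideal.Quotient.mk_surjective (x i)
  rw [Pi.smul_apply, Pi.zero_apply, ← hy, Algebra.smul_def, Ideal.Quotient.algebraMap_eq, ← map_mul,
    Ideal.Quotient.eq_zero_iff_mem, maximalIdeal_pow_eq_span hϖ, Ideal.mem_span_singleton]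
  exact (pow_dvd_pow _ (ha i)).mul_right _

theorem card_torsionPow_pi {ι : Type} [Fintype ι] {p : ℕ} (hp : Irreducible (p : R)) (r : ℕ∞)
    {K : ℕ} {a : ι → ℕ} (ha : ∀ i, a i ≤ K) :
    Nat.card (torsionPow R p r ((i : ι) → R ⧸ maximalIdeal R ^ a i)) =
      Nat.card (ResidueField R) ^ ∑ i, min (minLevel K r) (a i) := by
  rw [torsionPow_eq_torsionBy p r (pow_smul_pi_eq_zero hp ha), card_torsionBy_pi hp]

/-- The exterior square is the sum of R/𝔪^(κ_j) over pairs i < j, so each exponent κ_j occurs j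
times, counting from zero. Torsion of exponent r retains the first r columns, and the exponent of q
becomes a sum over columns. -/
theorem momentValue_partModule {p : ℕ} (hp : Irreducible (p : R)) (r : ℕ∞) (s ε : ℝ)
    (κ : YoungDiagram) {K : ℕ} (hK : κ.colLen K = 0) :
    momentValue R p r s ε (partModule R κ) =
      ∏ l ∈ Finset.range K, rowMoment (Nat.card (ResidueField R)) r s ε l (κ.colLen l) := by
  classical
  have hle (i : ℕ) : κ.rowLen i ≤ K :=
    (κ.rowLen_anti 0 i (Nat.zero_le _)).trans ((colLen_eq_zero_iff _ _).1 hK)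
  have hmono : Monotone fun i : Fin (κ.colLen 0) => maximalIdeal R ^ κ.rowLen i :=
    fun i j hij => Ideal.pow_le_pow_right (κ.rowLen_anti _ _ hij)
  have hq := two_le_card_residueField R
  have hq0 : (0 : ℝ) < Nat.card (ResidueField R) := by positivity
  set q := Nat.card (ResidueField R) with hqdef
  rw [momentValue, card_partModule κ hK,
    card_torsionPow_pi hp r (a := fun i : Fin (κ.colLen 0) => κ.rowLen i) (fun i => hle i),
    ← card_torsionPow_congr p r (wedgeEquiv _ hmono),
    card_torsionPow_pi hp r (a := fun z : IndexPair (κ.colLen 0) => κ.rowLen z.1.2)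
      (fun z => hle z.1.2), ← hqdef,
    sum_indexPair fun j => min (minLevel K r) (κ.rowLen j),
    Fin.sum_univ_eq_sum_range (fun j => min (minLevel K r) (κ.rowLen j))]
  simp only [min_comm (minLevel K r)]
  rw [sum_range_mul_min_rowLen, sum_range_min_rowLen]
  push_cast
  rw [Finset.prod_congr rfl fun l _ => rowMoment_eq_rpow hq l _, ← Real.rpow_sum_of_pos hq0,
    Finset.sum_sub_distrib, ← Finset.sum_filter]
  have hfil : (Finset.range K).filter (fun l : ℕ => ((l + 1 : ℕ) : ℕ∞) ≤ r) =
      Finset.range (minLevel K r) := by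
    ext l
    rw [Finset.mem_filter, Finset.mem_range, Finset.mem_range, minLevel, ← Nat.succ_le_iff,
      ← Nat.succ_le_iff (n := ENat.toNat _), ← Nat.cast_le (α := ℕ∞), ← Nat.cast_le (α := ℕ∞),
      ENat.natCast_toNat (by simp), le_min_iff]
  rw [hfil, ← Real.rpow_natCast, ← Real.rpow_natCast, ← Real.rpow_natCast, ← Real.rpow_mul hq0.le,
    ← Real.rpow_mul hq0.le, ← Real.rpow_add hq0, ← Real.rpow_add hq0, Finset.sum_add_distrib,
    ← Finset.mul_sum, ← Finset.mul_sum]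
  congr 1
  push_cast
  ring

end MomentValue

/-! ### Bounds for the Möbius sums -/

section Moebius

theorem card_eq_card_quotient_mul_card_submodule {R M : Type*} [CommRing R] [AddCommGroup M]
    [Module R M] (K : Submodule R M) : Nat.card M = Nat.card (M ⧸ K) * Nat.card K :=
  AddSubgroup.card_eq_card_quotient_mul_card_addSubgroup K.toAddSubgroup

theorem card_eq_card_mul_card_ker {R M N : Type*} [CommRing R] [AddCommGroup M]
    [Module R M] [AddCommGroup N] [Module R N] (f : M →ₗ[R] N) (hf : Function.Surjective f) :
    Nat.card M = Nat.card N * Nat.card (LinearMap.ker f) := by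
  rw [card_eq_card_quotient_mul_card_submodule (LinearMap.ker f),
    Nat.card_congr (f.quotKerEquivOfSurjective hf).toEquiv]

theorem card_hom_pi {R V ι : Type*} [CommRing R] [AddCommGroup V] [Module R V] [Fintype ι]
    (W : Type*) [AddCommGroup W] [Module R W] :
    Nat.card (V →ₗ[R] (ι → W)) = Nat.card (V →ₗ[R] W) ^ Fintype.card ι := by
  have e : (V →ₗ[R] (ι → W)) ≃ (ι → V →ₗ[R] W) :=
    { toFun := fun f i => (LinearMap.proj i).comp f
      invFun := LinearMap.pi
      left_inv := fun f => rfl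
      right_inv := fun f => rfl }
  rw [Nat.card_congr e, Nat.card_fun, Nat.card_eq_fintype_card (α := ι)]

/-- Two surjections with the same kernel differ by an automorphism of the target. -/
theorem surSetoid_of_ker_eq {R : Type u} [CommRing R] {P N : Type u} [AddCommGroup P]
    [Module R P] [AddCommGroup N] [Module R N] (g g' : Sur R P N)
    (h : LinearMap.ker g.1 = LinearMap.ker g'.1) : surSetoid R P N g g' := by
  refine ⟨(g.1.quotKerEquivOfSurjective g.2).symm.trans ((Submodule.quotEquivOfEq _ _ h).trans
    (g'.1.quotKerEquivOfSurjective g'.2)), ?_⟩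
  ext x
  simp only [LinearMap.comp_apply, LinearEquiv.coe_coe, LinearEquiv.trans_apply]
  have : (g.1.quotKerEquivOfSurjective g.2).symm (g.1 x) = Submodule.Quotient.mk x := by
    rw [LinearEquiv.symm_apply_eq]; rfl
  rw [this]; rfl

section Local

variable {R : Type u} [CommRing R] [IsLocalRing R]

theorem kerMoebius_eq {P : Type u} [AddCommGroup P] [Module R P] {K : Submodule R P}
    (hK : kerMoebius R K ≠ 0) : ∃ e : ℕ, Nonempty (K ≃ₗ[R] (Fin e → ResidueField R)) ∧
      |kerMoebius R K| = (Nat.card (ResidueField R) : ℝ) ^ e.choose 2 := by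
  unfold kerMoebius at hK ⊢
  split_ifs at hK ⊢ with h
  · refine ⟨h.choose, h.choose_spec, ?_⟩
    rw [abs_mul, abs_pow, abs_neg, abs_one, one_pow, one_mul, abs_of_nonneg (by positivity)]
  · exact absurd rfl hK

theorem smul_residueField_eq_zero {ϖ : R} (hϖ : ϖ ∈ maximalIdeal R) (y : ResidueField R) :
    ϖ • y = 0 := by
  rw [Algebra.smul_def]
  have : algebraMap R (ResidueField R) ϖ = 0 := (residue_eq_zero_iff ϖ).2 hϖ
  rw [this, zero_mul]

theorem moebius_mk {P N : Type u} [AddCommGroup P] [Module R P] [AddCommGroup N] [Module R N]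
    (g : Sur R P N) : moebius R P N (Quotient.mk _ g) = kerMoebius R (LinearMap.ker g.1) := rfl

end Local

variable {R : Type u} [CommRing R] [IsDomain R] [IsDiscreteValuationRing R]

theorem le_torsionBy_of_kerMoebius_ne_zero {ϖ : R} (hϖ : Irreducible ϖ) {P : Type u}
    [AddCommGroup P] [Module R P] {K : Submodule R P} (hK : kerMoebius R K ≠ 0) :
    K ≤ Submodule.torsionBy R P ϖ := by
  obtain ⟨e, ⟨f⟩, -⟩ := kerMoebius_eq hK
  intro x hx
  rw [Submodule.mem_torsionBy_iff]
  have h : f (ϖ • ⟨x, hx⟩) = 0 := by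
    rw [map_smul]
    ext i
    exact smul_residueField_eq_zero (hϖ.maximalIdeal_eq ▸ Ideal.mem_span_singleton_self ϖ) _
  rw [LinearEquiv.map_eq_zero_iff] at h
  exact congrArg Subtype.val h

variable [Finite (ResidueField R)]

theorem nonempty_equiv_fun_of_smul_top {V : Type u} [AddCommGroup V] [Module R V] [Finite V]
    (hV : maximalIdeal R ^ 1 • (⊤ : Submodule R V) = ⊥) {n : ℕ}
    (hn : Nat.card V = Nat.card (ResidueField R) ^ n) :
    Nonempty (V ≃ₗ[R] (Fin n → R ⧸ maximalIdeal R ^ 1)) := by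
  obtain ⟨κ, ⟨e⟩⟩ := exists_partModule_equiv (R := R) V
  have h1 : κ.colLen 1 = 0 := pow_smul_top_partModule.1 (smul_top_eq_bot_congr e hV)
  rw [Nat.card_congr e.toEquiv, card_partModule κ h1, Finset.sum_range_one] at hn
  obtain rfl := Nat.pow_right_injective (two_le_card_residueField R) hn
  have hrow (i : Fin (κ.colLen 0)) : κ.rowLen i = 1 := by
    have h2 := (κ.rowLen_anti 0 i (Nat.zero_le _)).trans ((colLen_eq_zero_iff _ _).1 h1)
    have h3 := (lt_colLen_iff_lt_rowLen κ i 0).1 i.2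
    omega
  exact ⟨e.trans (LinearEquiv.piCongrRight fun i =>
    Submodule.quotEquivOfEq _ _ (by rw [hrow i]))⟩

theorem card_hom_of_smul_top {V : Type u} [AddCommGroup V] [Module R V] [Finite V]
    (hV : maximalIdeal R ^ 1 • (⊤ : Submodule R V) = ⊥) {n : ℕ}
    (hn : Nat.card V = Nat.card (ResidueField R) ^ n) (c : ℕ) :
    Nat.card (V →ₗ[R] (Fin c → R ⧸ maximalIdeal R ^ 1)) = Nat.card (ResidueField R) ^ (n * c) := by
  obtain ⟨e⟩ := nonempty_equiv_fun_of_smul_top hV hn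
  rw [card_hom_pi, card_hom_congr e, card_pi_hom (fun _ : Fin n => 1) 1]
  simp [pow_mul]

omit [Finite (ResidueField R)] in
theorem smul_top_torsionBy {ϖ : R} (hϖ : Irreducible ϖ) (P : Type u) [AddCommGroup P]
    [Module R P] :
    maximalIdeal R ^ 1 • (⊤ : Submodule R (Submodule.torsionBy R P ϖ)) = ⊥ := by
  rw [pow_one, eq_bot_iff, Submodule.smul_le]
  intro r hr x _
  rw [hϖ.maximalIdeal_eq] at hr
  obtain ⟨c, rfl⟩ := Ideal.mem_span_singleton.1 hr
  rw [Submodule.mem_bot, mul_comm, mul_smul]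
  have : ϖ • x = 0 := Subtype.ext ((Submodule.mem_torsionBy_iff _ _).1 x.2)
  rw [this, smul_zero]

/-- The number of submodules of order `q ^ e` in a semisimple module `V` of order `q ^ n` is at
most `q ^ (n * (n - e))`. -/
theorem card_submodules_le {V : Type u} [AddCommGroup V] [Module R V] [Finite V]
    (hV : maximalIdeal R ^ 1 • (⊤ : Submodule R V) = ⊥) {n e : ℕ}
    (hn : Nat.card V = Nat.card (ResidueField R) ^ n) (he : e ≤ n) :
    Nat.card {K : Submodule R V // Nat.card K = Nat.card (ResidueField R) ^ e} ≤
      Nat.card (ResidueField R) ^ (n * (n - e)) := by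
  have hq := two_le_card_residueField R
  rw [← card_hom_of_smul_top hV hn (n - e)]
  have key (K : {K : Submodule R V // Nat.card K = Nat.card (ResidueField R) ^ e}) :
      Nonempty ((V ⧸ K.1) ≃ₗ[R] (Fin (n - e) → R ⧸ maximalIdeal R ^ 1)) := by
    have : Finite (V ⧸ K.1) := Finite.of_surjective _ (Submodule.mkQ_surjective K.1)
    refine nonempty_equiv_fun_of_smul_top ?_ ?_
    · have h1 := Submodule.map_smul'' (maximalIdeal R ^ 1) (⊤ : Submodule R V) K.1.mkQ
      rw [Submodule.map_top, Submodule.range_mkQ, hV, Submodule.map_bot] at h1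
      exact h1.symm
    · have h1 := card_eq_card_quotient_mul_card_submodule K.1
      rw [K.2, hn, ← Nat.sub_add_cancel he, pow_add] at h1
      exact (Nat.eq_of_mul_eq_mul_right (by positivity) h1).symm
  -- A submodule K is recovered as the kernel of V → V/K ≅ 𝔽_q^(n-e), so submodules inject into
  -- homomorphisms.
  refine Nat.card_le_card_of_injective
    (fun K => (key K).some.toLinearMap.comp K.1.mkQ) fun K K' h => ?_
  have h1 := congrArg LinearMap.ker h
  simpa [LinearMap.ker_comp, LinearEquiv.ker, Submodule.comap_bot, Submodule.ker_mkQ,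
    Subtype.ext_iff] using h1

/-- A class with nonzero Möbius value has a semisimple kernel, which lies in the ϖ-torsion; its
order q^e is forced by |P| = |N| q^e. As classes are determined by their kernels, it suffices to
count submodules of order q^e in the ϖ-torsion. -/
theorem abs_moebiusHat_le {ϖ : R} (hϖ : Irreducible ϖ) (N P : Type u) [AddCommGroup P]
    [Module R P] [AddCommGroup N] [Module R N] [Finite P] [Finite N] {n S L : ℕ}
    (hn : Nat.card (Submodule.torsionBy R P ϖ) = Nat.card (ResidueField R) ^ n)
    (hS : Nat.card P = Nat.card (ResidueField R) ^ S)
    (hL : Nat.card N = Nat.card (ResidueField R) ^ L) (h0 : moebiusHat R N P ≠ 0) :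
    ∃ e ≤ n, S = L + e ∧ |moebiusHat R N P| ≤
      (Nat.card (ResidueField R) : ℝ) ^ (n * (n - e) + e.choose 2) := by
  classical
  have hq := two_le_card_residueField R
  set q := Nat.card (ResidueField R) with hqdef
  set V := Submodule.torsionBy R P ϖ with hVdef
  have hfin : Finite (Quotient (surSetoid R P N)) := inferInstance
  have := Fintype.ofFinite (Quotient (surSetoid R P N))
  have hker (g : Quotient (surSetoid R P N)) (hg : moebius R P N g ≠ 0) :
      LinearMap.ker g.out.1 ≤ V ∧ ∃ e ≤ n, S = L + e ∧
        Nat.card (LinearMap.ker g.out.1) = q ^ e ∧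
        |moebius R P N g| = (q : ℝ) ^ e.choose 2 := by
    rw [← Quotient.out_eq g, moebius_mk] at hg
    have hle := le_torsionBy_of_kerMoebius_ne_zero hϖ hg
    obtain ⟨e, ⟨f⟩, habs⟩ := kerMoebius_eq hg
    have hcard : Nat.card (LinearMap.ker g.out.1) = q ^ e := by
      rw [Nat.card_congr f.toEquiv, Nat.card_fun, Nat.card_eq_fintype_card (α := Fin e),
        Fintype.card_fin]
    have h1 := card_eq_card_mul_card_ker _ g.out.2
    rw [hS, hL, hcard, ← pow_add] at h1
    refine ⟨hle, e, ?_, Nat.pow_right_injective hq h1, hcard, ?_⟩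
    · rw [← Nat.pow_le_pow_iff_right (by omega : 1 < q), ← hcard, ← hn]
      exact Nat.card_le_card_of_injective _ (Submodule.inclusion_injective hle)
    · conv_lhs => rw [← Quotient.out_eq g, moebius_mk]
      exact habs
  obtain ⟨g₀, hg₀⟩ : ∃ g, moebius R P N g ≠ 0 := by
    by_contra! h
    exact h0 (by rw [moebiusHat, finsum_congr h, finsum_zero])
  obtain ⟨-, e, hen, hSe, -, -⟩ := hker g₀ hg₀
  refine ⟨e, hen, hSe, ?_⟩
  have hker' (g : Quotient (surSetoid R P N)) (hg : moebius R P N g ≠ 0) :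
      LinearMap.ker g.out.1 ≤ V ∧ Nat.card (LinearMap.ker g.out.1) = q ^ e ∧
        |moebius R P N g| = (q : ℝ) ^ e.choose 2 := by
    obtain ⟨h1, e', -, h2, h3, h4⟩ := hker g hg
    obtain rfl : e' = e := by omega
    exact ⟨h1, h3, h4⟩
  have hcount : Nat.card {g : Quotient (surSetoid R P N) // moebius R P N g ≠ 0} ≤
      q ^ (n * (n - e)) := by
    refine le_trans ?_ (card_submodules_le (smul_top_torsionBy hϖ P) hn hen)
    refine Nat.card_le_card_of_injective (fun g => ⟨(LinearMap.ker g.1.out.1).submoduleOf V, ?_⟩) ?_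
    · rw [← (hker' g.1 g.2).2.1]
      exact Nat.card_congr (Submodule.submoduleOfEquivOfLe (hker' g.1 g.2).1).toEquiv
    · intro g g' h
      have h1 := congrArg (Submodule.map V.subtype) (congrArg Subtype.val h)
      simp only [Submodule.submoduleOf, Submodule.map_comap_subtype] at h1
      rw [inf_eq_right.2 (hker' g.1 g.2).1, inf_eq_right.2 (hker' g'.1 g'.2).1] at h1
      have h2 := Quotient.sound (s := surSetoid R P N) (surSetoid_of_ker_eq _ _ h1)
      rw [Quotient.out_eq, Quotient.out_eq] at h2
      exact Subtype.ext h2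
  rw [moebiusHat, finsum_eq_sum_of_fintype]
  calc |∑ g, moebius R P N g| ≤ ∑ g, |moebius R P N g| := Finset.abs_sum_le_sum_abs _ _
    _ = ∑ g ∈ Finset.univ.filter (fun g => moebius R P N g ≠ 0), |moebius R P N g| := by
        rw [Finset.sum_filter]
        refine Finset.sum_congr rfl fun g _ => ?_
        by_cases h : moebius R P N g = 0 <;> simp [h]
    _ = ∑ g ∈ Finset.univ.filter (fun g => moebius R P N g ≠ 0), (q : ℝ) ^ e.choose 2 :=
        Finset.sum_congr rfl fun g hg => (hker' g (Finset.mem_filter.1 hg).2).2.2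
    _ = (Nat.card {g : Quotient (surSetoid R P N) // moebius R P N g ≠ 0} : ℝ) *
          (q : ℝ) ^ e.choose 2 := by
        rw [Finset.sum_const, nsmul_eq_mul, Nat.card_eq_fintype_card, Fintype.card_subtype]
    _ ≤ (q : ℝ) ^ (n * (n - e)) * (q : ℝ) ^ e.choose 2 := by
        gcongr
        exact_mod_cast hcount
    _ = _ := by rw [pow_add]

end Moebius

/-! ### Well-behavedness -/

section WellBehaved

variable {q : ℕ} {r : ℕ∞} {s ε : ℝ}

theorem rowMoment_le (hq : 2 ≤ q) (hs : 0 ≤ s) (hsε : 0 ≤ s - ε) (j m : ℕ) :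
    rowMoment q r s ε j m ≤ (q : ℝ) ^ m.choose 2 := by
  have hq1 : (1 : ℝ) ≤ q := by exact_mod_cast (by omega : 1 ≤ q)
  unfold rowMoment
  split_ifs
  · rw [mul_rpow_neg_add_one hq]
    exact mul_le_of_le_one_right (by positivity)
      (pow_le_one₀ (by positivity) (rpow_neg_le_one hq hsε))
  · exact (pow_le_one₀ (by positivity) (rpow_neg_le_one hq hs)).trans (one_le_pow₀ hq1)

theorem rowMoment_div_le (hq : 2 ≤ q) (hs : 0 ≤ s) (hsε : 0 ≤ s - ε) (j m : ℕ) :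
    rowMoment q r s ε j m / (q : ℝ) ^ (m ^ 2) ≤ (q : ℝ) ^ m.choose 2 / (q : ℝ) ^ (m ^ 2) := by
  have := rowMoment_le (r := r) hq hs hsε j m
  gcongr

theorem pow_choose_two_div_le_one (hq : 2 ≤ q) (m : ℕ) :
    (q : ℝ) ^ m.choose 2 / (q : ℝ) ^ (m ^ 2) ≤ 1 := by
  have hq1 : (1 : ℝ) ≤ q := by exact_mod_cast (by omega : 1 ≤ q)
  rw [div_le_one (by positivity)]
  refine pow_le_pow_right₀ hq1 ?_
  rw [sq_eq_choose_two]; omega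

/-- With n = c + e, the terms on the left come from the number of kernels, the Möbius value, the
first row of the moment, and the desired decay q^(-n). The n² from the automorphisms absorbs all but
an excess that depends on c only. -/
theorem exponent_bound (c e : ℕ) :
    (c + e) * c + e.choose 2 + (c + e).choose 2 + (c + e) = (c + e) ^ 2 + (c + 1).choose 2 := by
  have h0 : (c + 1).choose 2 = c + c.choose 2 := by
    rw [Nat.choose_succ_succ' c 1, Nat.choose_one_right]
  have h1 := sq_eq_choose_two (c + e)
  have h2 := sq_eq_choose_two c
  have h3 := sq_eq_choose_two e
  linarith

variable {R : Type u} [CommRing R] [IsDomain R] [IsDiscreteValuationRing R]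
  [Finite (ResidueField R)]

/-- The order of the group of automorphisms of `partModule R κ`, bounded from below. -/
theorem le_card_aut_partModule (κ : YoungDiagram) {K : ℕ} (hK : κ.colLen K = 0) :
    (1 / 4 : ℝ) ^ K * ∏ l ∈ Finset.range K, (Nat.card (ResidueField R) : ℝ) ^ (κ.colLen l ^ 2) ≤
      Nat.card (partModule R κ ≃ₗ[R] partModule R κ) := by
  rw [card_aut_partModule κ hK, Finset.prod_mul_distrib, mul_comm]
  gcongr
  rw [← Finset.card_range K, ← Finset.prod_const, Finset.card_range]
  exact Finset.prod_le_prod (fun _ _ => by norm_num)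
    fun l _ => quarter_le_eta (two_le_card_residueField R) _

/-- Each η is at least 1/4, and every row below the first contributes a ratio of at most one, so
only the first row is kept. -/
theorem momentValue_div_card_aut_le {p : ℕ} (hp : Irreducible (p : R)) (r : ℕ∞) (hs : 0 ≤ s)
    (hsε : 0 ≤ s - ε) (κ : YoungDiagram) {K : ℕ} (hK : κ.colLen (K + 1) = 0) :
    momentValue R p r s ε (partModule R κ) /
        (Nat.card (partModule R κ ≃ₗ[R] partModule R κ) : ℝ) ≤
      4 ^ (K + 1) * ((Nat.card (ResidueField R) : ℝ) ^ (κ.colLen 0).choose 2 /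
        (Nat.card (ResidueField R) : ℝ) ^ (κ.colLen 0 ^ 2)) := by
  have hq := two_le_card_residueField R
  have hq0 : (0 : ℝ) < Nat.card (ResidueField R) := by positivity
  have h1 := le_card_aut_partModule (R := R) κ hK
  rw [momentValue_partModule hp r s ε κ hK]
  set q := Nat.card (ResidueField R) with hqdef
  have hnn : 0 ≤ ∏ l ∈ Finset.range (K + 1), rowMoment q r s ε l (κ.colLen l) :=
    Finset.prod_nonneg fun _ _ => rowMoment_nonneg _ _
  refine (div_le_div_of_nonneg_left hnn (by positivity) h1).trans ?_
  rw [mul_comm ((1 / 4 : ℝ) ^ (K + 1)), ← div_div, ← Finset.prod_div_distrib,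
    div_eq_mul_inv _ ((1 / 4 : ℝ) ^ (K + 1)),
    ← inv_pow, one_div, inv_inv, mul_comm]
  gcongr
  rw [Finset.prod_range_succ']
  refine (mul_le_mul_of_nonneg_right (Finset.prod_le_one (fun i _ => ?_) fun i _ => ?_) ?_).trans
    ((one_mul _).le.trans (rowMoment_div_le hq hs hsε _ _))
  · exact div_nonneg (rowMoment_nonneg _ _) (by positivity)
  · exact (rowMoment_div_le hq hs hsε _ _).trans (pow_choose_two_div_le_one hq _)
  · exact div_nonneg (rowMoment_nonneg _ _) (by positivity)

theorem momentValue_nonneg {R : Type u} [CommRing R] (p : ℕ) (r : ℕ∞) (s ε : ℝ) (N : Type u)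
    [AddCommGroup N] [Module R N] : 0 ≤ momentValue R p r s ε N := by
  unfold momentValue; positivity

theorem card_torsionBy_partModule {ϖ : R} (hϖ : Irreducible ϖ) (κ : YoungDiagram) :
    Nat.card (Submodule.torsionBy R (partModule R κ) ϖ) =
      Nat.card (ResidueField R) ^ κ.colLen 0 := by
  have h := card_torsionBy_pi hϖ 1 (fun i : Fin (κ.colLen 0) => κ.rowLen i)
  rw [pow_one, Fin.sum_univ_eq_sum_range (fun i => min 1 (κ.rowLen i))] at h
  simp only [min_comm 1] at h
  rw [sum_range_min_rowLen, Finset.sum_range_one] at h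
  exact h

theorem card_torsionBy_congr {R : Type u} [CommRing R] (a : R) {M N : Type u} [AddCommGroup M]
    [Module R M] [AddCommGroup N] [Module R N] (e : M ≃ₗ[R] N) :
    Nat.card (Submodule.torsionBy R M a) = Nat.card (Submodule.torsionBy R N a) :=
  Nat.card_congr <| e.toEquiv.subtypeEquiv fun x => by
    rw [Submodule.mem_torsionBy_iff, Submodule.mem_torsionBy_iff]
    change _ ↔ a • e x = 0
    rw [← map_smul, LinearEquiv.map_eq_zero_iff]

theorem card_aut_congr {R : Type u} [CommRing R] {M N : Type u} [AddCommGroup M]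
    [Module R M] [AddCommGroup N] [Module R N] (e : M ≃ₗ[R] N) :
    Nat.card (M ≃ₗ[R] M) = Nat.card (N ≃ₗ[R] N) :=
  Nat.card_congr
    { toFun := fun f => (e.symm.trans f).trans e
      invFun := fun f => (e.trans f).trans e.symm
      left_inv := fun f => by ext; simp
      right_inv := fun f => by ext; simp }

/-- The terms of the series of well-behavedness decay geometrically in the rank of `P`. -/
theorem abs_moebiusHat_term_le {p : ℕ} (hp : Irreducible (p : R)) (r : ℕ∞) (hs : 0 ≤ s)
    (hsε : 0 ≤ s - ε) (N P : Type u) [AddCommGroup P] [Module R P] [AddCommGroup N] [Module R N]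
    [Finite N] {L : ℕ} (hL : Nat.card N = Nat.card (ResidueField R) ^ L)
    {κ : YoungDiagram} (e : P ≃ₗ[R] partModule R κ) {K : ℕ} (hK : κ.colLen (K + 1) = 0)
    (h0 : moebiusHat R N P ≠ 0) :
    ∑ j ∈ Finset.range K, κ.colLen (j + 1) ≤ L ∧
    |moebiusHat R N P / (Nat.card (P ≃ₗ[R] P) : ℝ) * momentValue R p r s ε P| ≤
      4 ^ (K + 1) * (Nat.card (ResidueField R) : ℝ) ^ (L + 1).choose 2 *
        ((Nat.card (ResidueField R) : ℝ)⁻¹) ^ κ.colLen 0 := by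
  have : Finite P := Finite.of_equiv _ e.symm.toEquiv
  have hq := two_le_card_residueField R
  have hq0 : (0 : ℝ) < Nat.card (ResidueField R) := by positivity
  have hq1 : (1 : ℝ) ≤ Nat.card (ResidueField R) := by exact_mod_cast (by omega)
  have hn := (card_torsionBy_congr (p : R) e).trans (card_torsionBy_partModule hp κ)
  have hS := (Nat.card_congr e.toEquiv).trans (card_partModule κ hK)
  obtain ⟨d, hd, hSd, hle⟩ := abs_moebiusHat_le hp N P hn hS hL h0
  have hM := momentValue_div_card_aut_le hp r hs hsε κ hK
  rw [← momentValue_congr p r s ε e, ← card_aut_congr e] at hM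
  rw [Finset.sum_range_succ'] at hSd
  set q := Nat.card (ResidueField R) with hqdef
  refine ⟨by omega, ?_⟩
  rw [abs_mul, abs_div, Nat.abs_cast, abs_of_nonneg (momentValue_nonneg p r s ε P),
    div_mul_eq_mul_div, mul_div_assoc]
  refine (mul_le_mul hle hM (div_nonneg (momentValue_nonneg p r s ε P) (by positivity))
    (by positivity)).trans ?_
  -- Here c is the rank of P minus the length d of the kernel. As P has length L + d, at least its
  -- rank, c ≤ L, so the excess is bounded in terms of N.
  obtain ⟨c, hc⟩ := Nat.exists_eq_add_of_le' hd
  have hcL : c ≤ L := by omega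
  rw [hc, Nat.add_sub_cancel, mul_left_comm, mul_assoc]
  refine mul_le_mul_of_nonneg_left ?_ (by positivity)
  rw [mul_div_assoc', ← pow_add, inv_pow, ← div_eq_mul_inv,
    div_le_div_iff₀ (by positivity) (by positivity), ← pow_add, ← pow_add]
  refine pow_le_pow_right₀ hq1 ?_
  have h1 := exponent_bound c d
  have h2 := Nat.choose_le_choose 2 (Nat.succ_le_succ hcL)
  simp only [Nat.succ_eq_add_one] at h2
  omega

theorem wellBehaved_momentValue {p : ℕ} (hp : Irreducible (p : R)) (r : ℕ∞) (hs : 0 ≤ s)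
    (hsε : 0 ≤ s - ε) : WellBehaved R (fun X => momentValue R p r s ε X.rep) := by
  classical
  intro k N hN
  have hfin := hN.1
  have hq := two_le_card_residueField R
  obtain ⟨τ, ⟨eN⟩⟩ := exists_partModule_equiv (R := R) N.rep
  obtain ⟨K', hK'⟩ := exists_colLen_eq_zero τ
  obtain ⟨L, hL⟩ : ∃ L, Nat.card N.rep = Nat.card (ResidueField R) ^ L :=
    ⟨_, (Nat.card_congr eN.toEquiv).trans (card_partModule τ hK')⟩
  have hex (P : {P : FGIsoClass R // IsFiniteOfLevel R k P.rep}) :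
      ∃ κ : YoungDiagram, P.1 = partClass R κ := by
    have := P.2.1
    exact finite_rep_iff.1 this
  choose κ hκ using hex
  have hκinj : Function.Injective κ := fun P P' h => Subtype.ext (by rw [hκ P, hκ P', h])
  have hκk (P) (j : ℕ) : (κ P).colLen (k + j) = 0 := by
    have h1 : (κ P).colLen k = 0 := isFiniteOfLevel_partClass_iff.1 (hκ P ▸ P.2)
    have := (κ P).colLen_anti k (k + j) (Nat.le_add_right _ _)
    omega
  set f : {P : FGIsoClass R // IsFiniteOfLevel R k P.rep} → ℝ := fun P =>
    |moebiusHat R N.rep P.1.rep / (Nat.card (P.1.rep ≃ₗ[R] P.1.rep) : ℝ) *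
      momentValue R p r s ε P.1.rep| with hf
  set T : Set {P : FGIsoClass R // IsFiniteOfLevel R k P.rep} :=
    {P | ∑ j ∈ Finset.range k, (κ P).colLen (j + 1) ≤ L} with hT
  have hterm (P) (h0 : moebiusHat R N.rep P.1.rep ≠ 0) :=
    abs_moebiusHat_term_le hp r hs hsε N.rep P.1.rep hL
      (eq_partClass_iff.1 (hκ P)).some (hκk P 1) h0
  have hsupp : Function.support f ⊆ T := by
    intro P hP
    refine (hterm P fun h => hP ?_).1
    simp [hf, h]
  rw [← Set.indicator_eq_self.2 hsupp, ← summable_subtype_iff_indicator]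
  -- In a nonzero term all columns except the first have total length at most L. The relevant
  -- diagrams embed into ℕ times a finite set, where the geometric bound in the first coordinate is
  -- summable.
  let φ (P : T) : ℕ × (Fin k → Fin (L + 1)) :=
    ((κ P.1).colLen 0, fun j => ⟨(κ P.1).colLen (j + 1), Nat.lt_succ_of_le
      ((Finset.single_le_sum (f := fun j => (κ P.1).colLen (j + 1)) (fun _ _ => Nat.zero_le _)
        (Finset.mem_range.2 j.2)).trans P.2)⟩)
  have hφ : Function.Injective φ := by
    intro P P' h
    refine Subtype.ext (hκinj (youngDiagram_ext_colLen fun l => ?_))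
    rcases l with _ | l
    · exact congrArg Prod.fst h
    · by_cases hl : l < k
      · exact congrArg Fin.val (congrFun (congrArg Prod.snd h) ⟨l, hl⟩)
      · obtain ⟨d, hd⟩ := Nat.exists_eq_add_of_le (by omega : k ≤ l + 1)
        rw [hd, hκk, hκk]
  have hsum : Summable fun x : ℕ × (Fin k → Fin (L + 1)) =>
      4 ^ (k + 1) * (Nat.card (ResidueField R) : ℝ) ^ (L + 1).choose 2 *
        ((Nat.card (ResidueField R) : ℝ)⁻¹) ^ x.1 := by
    refine Summable.mul_left _ ?_
    have h1 : Summable fun n : ℕ => ((Nat.card (ResidueField R) : ℝ)⁻¹) ^ n :=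
      summable_geometric_of_lt_one (by positivity) (inv_natCast_lt_one hq)
    simpa using h1.mul_of_nonneg (Summable.of_finite (f := fun _ : Fin k → Fin (L + 1) => (1 : ℝ)))
      (fun n => by positivity) (fun _ => zero_le_one)
  refine Summable.of_nonneg_of_le (fun P => abs_nonneg _) (fun P => ?_) (hsum.comp_injective hφ)
  by_cases h0 : moebiusHat R N.rep P.1.1.rep = 0
  · simp only [Function.comp_apply, hf, h0, zero_div, zero_mul, abs_zero]
    positivity
  · exact (hterm P.1 h0).2

end WellBehaved

/-! ### The measure -/

section Law

open MeasureTheory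

variable {R : Type u} [CommRing R] [IsDomain R] [IsDiscreteValuationRing R]
  [Finite (ResidueField R)]

/-- The measure with mass `pointWeight q r s ε κ` at the class of `partModule R κ`. -/
def law (R : Type u) [CommRing R] [IsLocalRing R] (q : ℕ) (r : ℕ∞) (s ε : ℝ) :
    Measure (FGIsoClass R) :=
  Measure.sum fun κ : YoungDiagram =>
    ENNReal.ofReal (pointWeight q r s ε κ) • Measure.dirac (partClass R κ)

/-- A measure concentrated on the finite modules is determined by its values on these. -/
theorem measure_eq_tsum {ν : Measure (FGIsoClass R)} (h : ν {X | ¬ Finite X.rep} = 0)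
    {S : Set (FGIsoClass R)} (hS : MeasurableSet S) :
    ν S = ∑' κ, ν (S ∩ {partClass R κ}) := by
  have hdiff : ν (S \ {X | Finite X.rep}) = 0 := measure_mono_null (fun X hX => hX.2) h
  rw [← measure_inter_add_sdiff S measurableSet_finite_classes, hdiff, add_zero, finite_classes_eq,
    ← Set.iUnion_singleton_eq_range, Set.inter_iUnion]
  refine measure_iUnion (fun κ τ hκτ => ?_) fun κ =>
    hS.inter (measurableSet_singleton_partClass κ)
  refine Set.disjoint_left.2 fun X hX hX' => hκτ (partClass_injective (R := R) ?_)
  exact hX.2.symm.trans hX'.2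

theorem measure_ext_of_singleton {ν ν' : Measure (FGIsoClass R)}
    (h : ν {X | ¬ Finite X.rep} = 0) (h' : ν' {X | ¬ Finite X.rep} = 0)
    (hs : ∀ κ, ν' {partClass R κ} = ν {partClass R κ}) : ν' = ν := by
  refine Measure.ext fun S hS => ?_
  rw [measure_eq_tsum h hS, measure_eq_tsum h' hS]
  refine tsum_congr fun κ => ?_
  by_cases hκ : partClass R κ ∈ S
  · rw [Set.inter_eq_right.2 (Set.singleton_subset_iff.2 hκ), hs]
  · rw [Set.inter_singleton_eq_empty.2 hκ, measure_empty, measure_empty]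

theorem measure_univ_eq_tsum_levelSet (ν : Measure (FGIsoClass R)) (k : ℕ) :
    ν Set.univ =
      ∑' τ : {τ : YoungDiagram // τ.colLen k = 0}, ν (levelSet R k (partModule R τ.1)) := by
  have h : (Set.univ : Set (FGIsoClass R)) =
      ⋃ τ : {τ : YoungDiagram // τ.colLen k = 0}, levelSet R k (partModule R τ.1) := by
    symm
    rw [Set.eq_univ_iff_forall]
    intro X
    obtain ⟨τ, hτ, hX⟩ := exists_mem_levelSet k X
    exact Set.mem_iUnion.2 ⟨⟨τ, hτ⟩, hX⟩
  rw [h, measure_iUnion _ fun τ => measurableSet_levelSet τ.2]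
  intro τ τ' hne
  refine Set.disjoint_left.2 fun X ⟨f⟩ ⟨f'⟩ => hne (Subtype.ext ?_)
  exact eq_of_partModule_equiv (f.symm.trans f')

omit [Finite (ResidueField R)] in
theorem lintegral_law {q : ℕ} {r : ℕ∞} {s ε : ℝ} {f : FGIsoClass R → ℝ≥0∞} (hf : Measurable f) :
    ∫⁻ X, f X ∂(law R q r s ε) =
      ∑' κ, ENNReal.ofReal (pointWeight q r s ε κ) * f (partClass R κ) := by
  rw [law, lintegral_sum_measure]
  refine tsum_congr fun κ => ?_
  rw [lintegral_smul_measure, lintegral_dirac' _ hf, smul_eq_mul]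

omit [Finite (ResidueField R)] in
theorem law_apply {q : ℕ} {r : ℕ∞} {s ε : ℝ} {S : Set (FGIsoClass R)} (hS : MeasurableSet S) :
    law R q r s ε S =
      ∑' κ, ENNReal.ofReal (pointWeight q r s ε κ) * S.indicator 1 (partClass R κ) := by
  rw [← lintegral_law (measurable_one.indicator hS), lintegral_indicator_one hS]

theorem law_not_finite (q : ℕ) (r : ℕ∞) (s ε : ℝ) :
    law R q r s ε {X | ¬ Finite X.rep} = 0 := by
  have h : {X : FGIsoClass R | ¬ Finite X.rep} = {X | Finite X.rep}ᶜ := rfl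
  rw [h, law_apply measurableSet_finite_classes.compl, ENNReal.tsum_eq_zero]
  intro κ
  rw [Set.indicator_of_notMem, mul_zero]
  exact fun h => h (finite_rep_iff.2 ⟨κ, rfl⟩)

theorem law_levelSet {q : ℕ} (hq : 2 ≤ q) (r : ℕ∞) {s ε : ℝ} (hs : 0 ≤ s) (hsε : 0 ≤ s - ε)
    {k : ℕ} {τ : YoungDiagram} (hτ : τ.colLen (k + 1) = 0) :
    law R q r s ε (levelSet R (k + 1) (partModule R τ)) =
      ENNReal.ofReal (levelWeight q r s ε k τ.colLen) := by
  classical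
  rw [law_apply (measurableSet_levelSet hτ),
    ← fiberSum_pointWeight hq hs hsε fun j _ => τ.colLen_anti j (j + 1) (Nat.le_succ j), fiberSum]
  refine tsum_congr fun κ => ?_
  rw [Set.indicator_apply, partClass_mem_levelSet_iff hτ, Agree, Pi.one_apply, mul_ite, mul_one,
    mul_zero]

-- The total mass is the moment of the zero module.
omit [Finite (ResidueField R)] in
theorem law_univ {q : ℕ} (hq : 2 ≤ q) {r : ℕ∞} (hr : 1 ≤ r) {s ε : ℝ} (hs : 0 ≤ s)
    (hsε : 0 ≤ s - ε) : law R q r s ε Set.univ = 1 := by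
  have h := tsum_moment hq hs hsε hr (K := 0) (τ := fun _ => 0) (fun _ => le_rfl) rfl
  simp only [zero_add, Finset.prod_range_one, rowMoment_zero, ENNReal.ofReal_one] at h
  rw [law_apply MeasurableSet.univ, ← h]
  refine tsum_congr fun κ => ?_
  simp [rowWeight]

theorem hasLevelFormula_law {q : ℕ} (hq : 2 ≤ q) {r : ℕ∞} (hr : 1 ≤ r) {s ε : ℝ} (hs : 0 ≤ s)
    (hsε : 0 ≤ s - ε) : HasLevelFormula R (law R q r s ε) q r s ε := by
  intro k lam hk hlam
  obtain ⟨k, rfl⟩ := Nat.exists_eq_add_of_le' hk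
  have h : lam.rowLen (k + 1) = 0 := hlam
  rw [law_levelSet hq r hs hsε (by rw [YoungDiagram.colLen_transpose, h]),
    levelFormula_eq_levelWeight hq hr h]
  congr 2
  funext j
  exact lam.colLen_transpose j

omit [Finite (ResidueField R)] in
theorem HasLevelFormula.levelSet_eq {q : ℕ} {r : ℕ∞} {s ε : ℝ} {ν ν' : Measure (FGIsoClass R)}
    (h : HasLevelFormula R ν q r s ε) (h' : HasLevelFormula R ν' q r s ε) {k : ℕ}
    {τ : YoungDiagram} (hτ : τ.colLen (k + 1) = 0) :
    ν' (levelSet R (k + 1) (partModule R τ)) = ν (levelSet R (k + 1) (partModule R τ)) := by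
  have h0 : part τ.transpose (k + 2) = 0 := by
    rw [part]; exact (τ.rowLen_transpose (k + 1)).trans hτ
  have h1 := h (k + 1) τ.transpose (by omega) h0
  have h2 := h' (k + 1) τ.transpose (by omega) h0
  rw [YoungDiagram.transpose_transpose] at h1 h2
  rw [h1, h2]

/-- Singletons of finite classes are level sets, so ν has the right atoms there; the partition into
level sets at level 1 gives total mass one. The atoms of `law` already exhaust this mass, so ν
vanishes on infinite modules. -/
theorem HasLevelFormula.eq_law {q : ℕ} (hq : 2 ≤ q) {r : ℕ∞} (hr : 1 ≤ r) {s ε : ℝ} (hs : 0 ≤ s)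
    (hsε : 0 ≤ s - ε) {ν : Measure (FGIsoClass R)} (h : HasLevelFormula R ν q r s ε) :
    ν = law R q r s ε := by
  have hlaw := hasLevelFormula_law (R := R) hq hr hs hsε
  have h0 := law_not_finite (R := R) q r s ε
  have hsingle (κ : YoungDiagram) : ν {partClass R κ} = law R q r s ε {partClass R κ} := by
    obtain ⟨k, hk⟩ := exists_colLen_eq_zero κ
    rw [← levelSet_eq_singleton hk]
    exact hlaw.levelSet_eq h (by have := κ.colLen_anti k (k + 1) (Nat.le_succ k); omega)
  have huniv : ν Set.univ = 1 := by
    rw [← law_univ (R := R) hq hr hs hsε, measure_univ_eq_tsum_levelSet ν 1,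
      measure_univ_eq_tsum_levelSet _ 1]
    exact tsum_congr fun τ => hlaw.levelSet_eq h τ.2
  have : IsProbabilityMeasure ν := ⟨huniv⟩
  have : IsProbabilityMeasure (law R q r s ε) := ⟨law_univ (R := R) hq hr hs hsε⟩
  have hfin (ν : Measure (FGIsoClass R)) :
      ν {X | Finite X.rep} = ∑' κ, ν {partClass R κ} := by
    rw [finite_classes_eq, ← Set.iUnion_singleton_eq_range]
    refine measure_iUnion (fun κ τ hκτ => ?_) measurableSet_singleton_partClass
    exact Set.disjoint_singleton.2 fun e => hκτ (partClass_injective e)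
  refine measure_ext_of_singleton h0 ?_ hsingle
  have h1 : law R q r s ε {X | Finite X.rep} = 1 :=
    (prob_compl_eq_zero_iff measurableSet_finite_classes).1 h0
  refine (prob_compl_eq_zero_iff measurableSet_finite_classes).2 ?_
  rw [← h1, hfin, hfin]
  exact tsum_congr hsingle

theorem card_sur_congr {R : Type u} [CommRing R] [IsLocalRing R] {X Y M N : Type u}
    [AddCommGroup X] [Module R X] [AddCommGroup Y] [Module R Y] [AddCommGroup M] [Module R M]
    [AddCommGroup N] [Module R N] (e : X ≃ₗ[R] Y) (f : M ≃ₗ[R] N) :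
    Nat.card (Sur R X M) = Nat.card (Sur R Y N) :=
  Nat.card_congr <| (e.arrowCongr f).toEquiv.subtypeEquiv fun g => by
    have : ⇑(e.arrowCongr f g) = f ∘ g ∘ e.symm := rfl
    change _ ↔ Function.Surjective (e.arrowCongr f g)
    rw [this, ← Function.comp_assoc, e.symm.surjective.of_comp_iff, ← f.coe_toEquiv,
      EquivLike.comp_surjective]

omit [IsDomain R] [IsDiscreteValuationRing R] [Finite (ResidueField R)] in
theorem card_sur_trunc [IsLocalRing R] (k : ℕ) (X N : Type u) [AddCommGroup X] [Module R X]
    [AddCommGroup N] [Module R N] (hN : maximalIdeal R ^ k • (⊤ : Submodule R N) = ⊥) :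
    Nat.card (Sur R (Trunc R k X) N) = Nat.card (Sur R X N) := by
  have hle (g : X →ₗ[R] N) : maximalIdeal R ^ k • (⊤ : Submodule R X) ≤ LinearMap.ker g := by
    rw [← Submodule.comap_bot, ← Submodule.map_le_iff_le_comap, Submodule.map_smul'', ← hN]
    exact Submodule.smul_mono le_rfl le_top
  refine Nat.card_congr
    { toFun := fun g => ⟨g.1.comp (Submodule.mkQ _), g.2.comp (Submodule.mkQ_surjective _)⟩
      invFun := fun g => ⟨Submodule.liftQ _ g.1 (hle g.1), fun y => ?_⟩
      left_inv := fun g => Subtype.ext (by ext; rfl)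
      right_inv := fun g => Subtype.ext (by ext; rfl) }
  obtain ⟨x, hx⟩ := g.2 y
  exact ⟨Submodule.Quotient.mk x, hx⟩

/-- The count depends only on the truncation at a level that kills the target. -/
theorem measurable_card_sur (τ : YoungDiagram) :
    Measurable fun X : FGIsoClass R => (Nat.card (Sur R X.rep (partModule R τ)) : ℝ≥0∞) := by
  obtain ⟨k, hk⟩ := exists_colLen_eq_zero τ
  refine measurable_of_levelSet k fun κ X Y _ ⟨e⟩ ⟨f⟩ => ?_
  have hN := pow_smul_top_partModule (R := R) |>.2 hk
  rw [← card_sur_trunc k X.rep _ hN, ← card_sur_trunc k Y.rep _ hN,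
    card_sur_congr (e.trans f.symm) (LinearEquiv.refl R _)]

theorem moment_law {p : ℕ} (hp : Irreducible (p : R)) {r : ℕ∞} (hr : 1 ≤ r) {s ε : ℝ}
    (hs : 0 ≤ s) (hsε : 0 ≤ s - ε) (N : Type u) [AddCommGroup N] [Module R N] [Finite N] :
    moment R (law R (Nat.card (ResidueField R)) r s ε) N =
      ENNReal.ofReal (momentValue R p r s ε N) := by
  obtain ⟨τ, ⟨e⟩⟩ := exists_partModule_equiv (R := R) N
  obtain ⟨K, hK⟩ := exists_colLen_eq_zero τ
  have hK1 : τ.colLen (K + 1) = 0 := by have := τ.colLen_anti K (K + 1) (Nat.le_succ K); omega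
  rw [moment, momentValue_congr p r s ε e, momentValue_partModule hp r s ε τ hK1]
  simp only [card_sur_congr (LinearEquiv.refl R _) e]
  rw [lintegral_law (measurable_card_sur τ), ← tsum_moment (two_le_card_residueField R) hs hsε hr
    (fun j => τ.colLen_anti j (j + 1) (Nat.le_succ j)) hK1]
  refine tsum_congr fun κ => ?_
  rw [← card_sur_partModule κ τ hK1, ENNReal.ofReal_natCast,
    card_sur_congr (partClass_rep_equiv R κ).some (LinearEquiv.refl R _)]

theorem levelFormula_eq_momentValue {p : ℕ} (hp : Irreducible (p : R)) (r : ℕ∞) (s ε : ℝ) {k : ℕ}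
    {lam : YoungDiagram} (h : lam.rowLen k = 0) :
    levelFormula (Nat.card (ResidueField R)) r s ε k lam =
      momentValue R p r s ε (partModule R lam.transpose) /
        (Nat.card (partModule R lam.transpose ≃ₗ[R] partModule R lam.transpose) : ℝ) *
        levelFactor (Nat.card (ResidueField R)) r s ε k lam := by
  have h' : lam.transpose.colLen k = 0 := by rw [YoungDiagram.colLen_transpose, h]
  rw [levelFormula_eq (two_le_card_residueField R), momentValue_partModule hp r s ε _ h',
    card_aut_partModule _ h']
  simp only [YoungDiagram.colLen_transpose]
  rw [Finset.prod_div_distrib, Finset.prod_mul_distrib, div_div]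

end Law

end ModuleMoments

end

/-! ### The main theorem. -/

open ModuleMoments in
theorem proposition6 {R : Type u} [CommRing R] [IsDomain R] [IsDiscreteValuationRing R]
    [IsAdicComplete (maximalIdeal R) R] [Finite (ResidueField R)]
    (p : ℕ) [Fact p.Prime] (hp : Irreducible (p : R))
    (q : ℕ) (hq : Nat.card (ResidueField R) = q)
    (s ε : ℝ) (hs : 0 ≤ s) (hsε : 0 ≤ s - ε) (r : ℕ∞) (hr : 1 ≤ r) :
    (∀ (t : ℝ) (m : ℕ), 0 ≤ t → 0 < Pf q t m) ∧
    (∀ rho : YoungDiagram,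
      momentValue R p r s ε (partModule R rho.transpose) = (q : ℝ) ^ momentExponent r s ε rho) ∧
    WellBehaved R (fun X => momentValue R p r s ε X.rep) ∧
    Multipliable (fun i : ℕ => (1 + (q : ℝ) ^ (-s + ε - 1 - (i : ℝ)))⁻¹) ∧
    (∀ (k : ℕ) (lam : YoungDiagram), 1 ≤ k → part lam (k + 1) = 0 →
      levelFormula q r s ε k lam =
        momentValue R p r s ε (partModule R lam.transpose) /
          (Nat.card (partModule R lam.transpose ≃ₗ[R] partModule R lam.transpose) : ℝ) *
          levelFactor q r s ε k lam) ∧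
    ∃ ν : MeasureTheory.Measure (FGIsoClass R),
      HasLevelFormula R ν q r s ε ∧
      (∀ ν' : MeasureTheory.Measure (FGIsoClass R), HasLevelFormula R ν' q r s ε → ν' = ν) ∧
      (∀ (N : Type u) [AddCommGroup N] [Module R N] [Finite N],
        moment R ν N = ENNReal.ofReal (momentValue R p r s ε N)) ∧
      ν {X | ¬ Finite X.rep} = 0 ∧
      (∀ (lam : YoungDiagram) (k : ℕ), part lam.transpose 1 < k →
        ν {FGIsoClass.mk R (partModule R lam.transpose)} =
          ENNReal.ofReal (levelFormula q r s ε k lam)) := by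
  subst hq
  have hq := two_le_card_residueField R
  have hlaw := hasLevelFormula_law (R := R) hq hr hs hsε
  refine ⟨fun t m ht => Pf_pos hq ht m, fun rho => ?_, wellBehaved_momentValue hp r hs hsε, ?_,
    fun k lam _ hlam => levelFormula_eq_momentValue hp r s ε hlam,
    law R _ r s ε, hlaw, fun ν' h => h.eq_law hq hr hs hsε, fun N _ _ _ => moment_law hp hr hs hsε N,
    law_not_finite _ r s ε, fun lam k hk => ?_⟩
  · obtain ⟨K, hK⟩ := exists_colLen_eq_zero rho.transpose
    rw [momentValue_partModule hp r s ε _ hK, rpow_momentExponent hq rho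
      ((rho.colLen_transpose K).symm.trans hK)]
    simp only [YoungDiagram.colLen_transpose]
  · simp only [rpow_sub_natCast_eq hq]
    exact multipliable_inv_one_add hq (by positivity)
  -- The strict inequality says that 𝔪^(k-1) kills the module, which is what makes its level set at
  -- k a single point.
  · obtain ⟨k, rfl⟩ := Nat.exists_eq_add_of_le' (Nat.one_le_of_lt hk)
    have hτ : lam.transpose.colLen k = 0 :=
      (colLen_eq_zero_iff _ _).2 (Nat.lt_succ_iff.1 hk)
    have hτ' := lam.transpose.colLen_anti k (k + 1) (Nat.le_succ k)
    have h0 : part lam (k + 1 + 1) = 0 :=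
      (lam.colLen_transpose (k + 1)).symm.trans (Nat.le_zero.1 (hτ'.trans_eq hτ))
    have h1 := levelSet_eq_singleton (R := R) hτ
    rw [partClass] at h1
    rw [← h1]
    exact hlaw (k + 1) lam (by omega) h0
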